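/- Let $N\in\mathbb N$, let $l>0$ be real (not necessarily an integer) with $2l<N$, and let $s>N-2l$. Put $\theta=\frac{s}{s+2l-N}>1$. For $v\in C_c^\infty(\mathbb R^N)$ (complex-valued) define the homogeneous Sobolev norm of order $l$ by $$|v|_{l}^2=\sum_{|\nu|_1=l}\int_{\mathbb R^N}|\partial^\nu v|^2\,dX\quad\text{if } l \text{ is an integer},$$ $$|v|_{l}^2=\sum_{|\nu|_1=[l]}\int_{\mathbb R^N}\!\int_{\mathbb R^N}\frac{|\partial^\nu v(X)-\partial^\nu v(Y)|^2}{|X-Y|^{N+2(l-[l])}}\,dX\,dY\quad\text{otherwise}.$$ For a bounded open set $\Omega\subset\mathbb R^N$ let $H^l_0(\Omega)$ be the Hilbert space obtained by completing $C_c^\infty(\Omega)$ (functions being extended by zero to $\mathbb R^N$) in the norm $|\cdot|_l$. There is a constant $C>0$, depending only on $l,s,N$, such that the following holds. Let $\Omega\subset\mathbb R^N$ be a bounded open set, let $\mu$ be a Borel measure on $\mathbb R^N$ with $\mu(\mathbb R^N\setminus\Omega)=0$, and suppose that for some $\mathcal A>0$ $$\mu(B(X,r))\le \mathcal A\, r^{s}\qquad\text{for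 all } X\in\operatorname{supp}\mu,\ r>0 .$$ (i) Let $V$ be a real-valued function, $V\in L_\theta(\mu)$. Then the quadratic form $\mathbf s[v]=\int V|v|^2\,d\mu$, $v\in C_c^\infty(\Omega)$, defines a unique bounded operator $\mathbf S$ on $H^l_0(\Omega)$ by $(\mathbf S v,v)_{H^l_0(\Omega)}=\mathbf s[v]$; this operator is self-adjoint and compact, and for all $\lambda>0$ $$n_\pm(\lambda,\mathbf S)\le C\,\mathcal A^{\theta-1}\int V_\pm^\theta\,d\mu\;\lambda^{-\theta},$$ where $V_\pm=\max(\pm V,0)$ and $n_\pm(\lambda,\mathbf S)$ is the number of eigenvalues $\kappa$ of $\mathbf S$, counted with multiplicity, such that $\pm\kappa>\lambda$. (ii) Let $V$ be a complex-valued function, $V\in L_\theta(\mu)$. Then the same form defines, in the same way, a unique bounded operator $\mathbf S$ on $H^l_0(\Omega)$; it is compact, and for all $\lambda>0$ $$n(\lambda,\mathbf S)\le C\,\mathcal A^{\theta-1}\int |V|^\theta\,d\mu\;\lambda^{-\theta},$$ where $n(\lambda,\mathbf S)$ is the number of singular numbers of $\mathbf S$ (the square roots of the eigenvalues of $\mathbf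 S^*\mathbf S$, counted with multiplicity) that exceed $\lambda$. -/

import Mathlib

open MeasureTheory Set
open scoped Distributions ENNReal

noncomputable section

namespace SingularBS

variable {N : ℕ}

/-- The Sobolev multi-index derivative `∂^ν` on complex test functions supported in `Ω`:
the composition of `∂_i ^ (ν i)` over the coordinate directions `i`. -/
def multiDeriv (Ω : TopologicalSpace.Opens (EuclideanSpace ℝ (Fin N))) (ν : Fin N → ℕ) :
    𝓓(Ω, ℂ) →ₗ[ℂ] 𝓓(Ω, ℂ) :=
  (List.ofFn fun i : Fin N =>
    ((TestFunction.lineDerivCLM ℂ (EuclideanSpace.single i (1 : ℝ)) :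
      𝓓(Ω, ℂ) →L[ℂ] 𝓓(Ω, ℂ)).toLinearMap ^ ν i : Module.End ℂ 𝓓(Ω, ℂ))).prod

/-- The `L²` inner product of two functions on `ℝ^N` (conjugate linear in the first slot). -/
def l2Inner (f g : EuclideanSpace ℝ (Fin N) → ℂ) : ℂ :=
  ∫ x, inner ℂ (f x) (g x)

/-- The sesquilinear form of the fractional (Gagliardo) seminorm of order `σ ∈ (0,1)`:
`∬ conj (f x - f y) (g x - g y) / |x - y|^(N + 2σ) dx dy`. -/
def gagliardoInner (σ : ℝ) (f g : EuclideanSpace ℝ (Fin N) → ℂ) : ℂ :=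
  ∫ z : EuclideanSpace ℝ (Fin N) × EuclideanSpace ℝ (Fin N),
    (((‖z.1 - z.2‖ ^ ((N : ℝ) + 2 * σ))⁻¹ : ℝ) : ℂ) * inner ℂ (f z.1 - f z.2) (g z.1 - g z.2)

open scoped Classical in
/-- The inner product of the homogeneous Sobolev norm of real order `l ≥ 0`: the sum over the
multi-indices `ν` with `|ν|₁ = ⌊l⌋` of the `L²` inner products of `∂^ν u, ∂^ν v` if `l` is an
integer, and of their Gagliardo forms of order `l - ⌊l⌋` otherwise. Test functions on `Ω` are
functions on `ℝ^N` vanishing off a compact subset of `Ω`, and all integrals are over `ℝ^N`. -/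
def homInner (l : ℝ) {Ω : TopologicalSpace.Opens (EuclideanSpace ℝ (Fin N))}
    (u v : 𝓓(Ω, ℂ)) : ℂ :=
  ∑ ν ∈ Finset.piAntidiag (Finset.univ : Finset (Fin N)) ⌊l⌋₊,
    if Int.fract l = 0 then l2Inner (multiDeriv Ω ν u) (multiDeriv Ω ν v)
    else gagliardoInner (Int.fract l) (multiDeriv Ω ν u) (multiDeriv Ω ν v)

section Integrability

lemma integrable_kernel {σ : ℝ} (h0 : 0 < σ) (h1 : σ < 1)
    [Nontrivial (EuclideanSpace ℝ (Fin N))] :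
    Integrable (fun w : EuclideanSpace ℝ (Fin N) =>
      (‖w‖ ^ ((N : ℝ) + 2 * σ))⁻¹ * (min 1 ‖w‖) ^ 2) := by
  have hN : 1 ≤ N := by
    rcases Nat.eq_zero_or_pos N with h | h
    · subst h
      exact absurd (inferInstance : Subsingleton (EuclideanSpace ℝ (Fin 0)))
        (not_subsingleton _)
    · exact h
  have key := (integrable_fun_norm_addHaar (volume : Measure (EuclideanSpace ℝ (Fin N)))
    (f := fun r : ℝ => (r ^ ((N : ℝ) + 2 * σ))⁻¹ * (min 1 r) ^ 2)).2
  refine key ?_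
  rw [finrank_euclideanSpace_fin, ← Ioc_union_Ioi_eq_Ioi (zero_le_one' ℝ)]
  have hpow : ∀ r : ℝ, 0 < r → r ^ (N - 1) * (r ^ ((N : ℝ) + 2 * σ))⁻¹ = r ^ (-1 - 2 * σ) := by
    intro r hr
    rw [← Real.rpow_natCast, ← Real.rpow_neg hr.le, ← Real.rpow_add hr]
    congr 1
    rw [Nat.cast_sub hN]
    push_cast
    ring
  refine IntegrableOn.union ?_ ?_
  · have : IntegrableOn (fun r : ℝ => r ^ (1 - 2 * σ)) (Ioc 0 1) := by
      have := (intervalIntegral.intervalIntegrable_rpow' (a := 0) (b := 1) (r := 1 - 2 * σ)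
        (by linarith))
      rwa [intervalIntegrable_iff_integrableOn_Ioc_of_le zero_le_one] at this
    refine this.congr_fun ?_ measurableSet_Ioc
    intro r hr
    simp only [smul_eq_mul]
    rw [min_eq_right hr.2, ← mul_assoc, hpow r hr.1, ← Real.rpow_natCast r 2,
      ← Real.rpow_add hr.1]
    congr 1
    push_cast
    ring
  · have : IntegrableOn (fun r : ℝ => r ^ (-1 - 2 * σ)) (Ioi 1) :=
      integrableOn_Ioi_rpow_of_lt (by linarith) one_pos
    refine this.congr_fun ?_ measurableSet_Ioi
    intro r hr
    have hr' : (1 : ℝ) < r := hr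
    simp only [smul_eq_mul]
    rw [min_eq_left hr'.le, one_pow, mul_one, hpow r (by linarith)]

variable {Ω : TopologicalSpace.Opens (EuclideanSpace ℝ (Fin N))}

lemma exists_increment_bound (f : 𝓓(Ω, ℂ)) :
    ∃ M : ℝ, 0 ≤ M ∧ ∀ x y, ‖f x - f y‖ ≤ M * min 1 ‖x - y‖ := by
  have hc : ContDiff ℝ 1 (f : EuclideanSpace ℝ (Fin N) → ℂ) :=
    f.contDiff'.of_le (by simp)
  obtain ⟨L, hL⟩ := hc.lipschitzWith_of_hasCompactSupport f.hasCompactSupport' one_ne_zero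
  obtain ⟨B, hB⟩ := f.hasCompactSupport'.exists_bound_of_continuous hc.continuous
  have hB0 : 0 ≤ B := (norm_nonneg _).trans (hB 0)
  refine ⟨L + 2 * B, by positivity, fun x y => ?_⟩
  rcases le_total 1 ‖x - y‖ with h | h
  · rw [min_eq_left h]
    have h1 : ‖f x‖ ≤ B := hB x
    have h2 : ‖f y‖ ≤ B := hB y
    have h3 := norm_sub_le (f x) (f y)
    have : (0 : ℝ) ≤ L := L.2
    linarith
  · rw [min_eq_right h]
    have h1 : ‖f x - f y‖ ≤ L * ‖x - y‖ := hL.norm_sub_le x y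
    have : 0 ≤ 2 * B * ‖x - y‖ := by positivity
    linarith

lemma integrable_l2Inner (f g : 𝓓(Ω, ℂ)) :
    Integrable (fun x => inner ℂ (f x) (g x)) := by
  have hf : Continuous (f : EuclideanSpace ℝ (Fin N) → ℂ) := f.contDiff'.continuous
  have hg : Continuous (g : EuclideanSpace ℝ (Fin N) → ℂ) := g.contDiff'.continuous
  refine (hf.inner hg).integrable_of_hasCompactSupport ?_
  refine f.hasCompactSupport'.mono ?_
  intro x hx hfx
  apply hx
  have hfx' : f x = 0 := hfx
  simp [hfx']

lemma integrable_gagliardo_sq {σ : ℝ} (h0 : 0 < σ) (h1 : σ < 1) (f : 𝓓(Ω, ℂ)) :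
    Integrable (fun z : EuclideanSpace ℝ (Fin N) × EuclideanSpace ℝ (Fin N) =>
      (‖z.1 - z.2‖ ^ ((N : ℝ) + 2 * σ))⁻¹ * ‖f z.1 - f z.2‖ ^ 2) := by
  have hf : Continuous (f : EuclideanSpace ℝ (Fin N) → ℂ) := f.contDiff'.continuous
  rcases subsingleton_or_nontrivial (EuclideanSpace ℝ (Fin N)) with hs | hs
  · have : (fun z : EuclideanSpace ℝ (Fin N) × EuclideanSpace ℝ (Fin N) =>
        (‖z.1 - z.2‖ ^ ((N : ℝ) + 2 * σ))⁻¹ * ‖f z.1 - f z.2‖ ^ 2) = fun _ => 0 := by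
      funext z
      rw [Subsingleton.elim z.1 z.2]
      simp
    rw [this]
    exact integrable_zero _ _ _
  obtain ⟨M, hM0, hM⟩ := exists_increment_bound f
  set K : Set (EuclideanSpace ℝ (Fin N)) := tsupport f with hK
  have hKm : MeasurableSet K := (isClosed_tsupport _).measurableSet
  have hKfin : volume K < ∞ := f.hasCompactSupport'.isCompact.measure_lt_top
  set ind : EuclideanSpace ℝ (Fin N) → ℝ := K.indicator fun _ => 1 with hind
  have hindI : Integrable ind := (integrable_indicator_iff hKm).2
    (integrableOn_const hKfin.ne)
  have hk := integrable_kernel (N := N) h0 h1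
  have c1 := hindI.convolution_integrand (ContinuousLinearMap.mul ℝ ℝ) hk
  have c2 := c1.swap
  have hmaj := (c1.add c2).const_mul (M ^ 2)
  refine hmaj.mono' ?_ ?_
  · refine Measurable.aestronglyMeasurable ?_
    have := hf.measurable
    fun_prop
  · refine Filter.Eventually.of_forall fun z => ?_
    have hker : 0 ≤ (‖z.1 - z.2‖ ^ ((N : ℝ) + 2 * σ))⁻¹ := by positivity
    rw [Real.norm_of_nonneg (by positivity)]
    simp only [Pi.add_apply, Function.comp, Prod.fst_swap, Prod.snd_swap,
      ContinuousLinearMap.mul_apply']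
    rw [norm_sub_rev z.2 z.1]
    have hsum : ‖f z.1 - f z.2‖ ^ 2 ≤
        M ^ 2 * (min 1 ‖z.1 - z.2‖) ^ 2 * (ind z.2 + ind z.1) := by
      have hi1 : 0 ≤ ind z.1 := indicator_nonneg (fun _ _ => zero_le_one) _
      have hi2 : 0 ≤ ind z.2 := indicator_nonneg (fun _ _ => zero_le_one) _
      by_cases hz : z.1 ∈ K ∨ z.2 ∈ K
      · have hge : 1 ≤ ind z.2 + ind z.1 := by
          rcases hz with hz | hz
          · have : ind z.1 = 1 := indicator_of_mem hz _
            linarith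
          · have : ind z.2 = 1 := indicator_of_mem hz _
            linarith
        have hb : ‖f z.1 - f z.2‖ ^ 2 ≤ M ^ 2 * (min 1 ‖z.1 - z.2‖) ^ 2 := by
          rw [← mul_pow]
          exact pow_le_pow_left₀ (norm_nonneg _) (hM _ _) 2
        exact hb.trans (le_mul_of_one_le_right (by positivity) hge)
      · push Not at hz
        have e1 : f z.1 = 0 := image_eq_zero_of_notMem_tsupport hz.1
        have e2 : f z.2 = 0 := image_eq_zero_of_notMem_tsupport hz.2
        rw [e1, e2]
        simp only [sub_self, norm_zero, ne_eq, OfNat.ofNat_ne_zero, not_false_eq_true, zero_pow]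
        positivity
    calc _ ≤ (‖z.1 - z.2‖ ^ ((N : ℝ) + 2 * σ))⁻¹ *
        (M ^ 2 * (min 1 ‖z.1 - z.2‖) ^ 2 * (ind z.2 + ind z.1)) :=
          mul_le_mul_of_nonneg_left hsum hker
      _ = _ := by ring

lemma integrable_gagliardoInner {σ : ℝ} (h0 : 0 < σ) (h1 : σ < 1) (f g : 𝓓(Ω, ℂ)) :
    Integrable (fun z : EuclideanSpace ℝ (Fin N) × EuclideanSpace ℝ (Fin N) =>
      (((‖z.1 - z.2‖ ^ ((N : ℝ) + 2 * σ))⁻¹ : ℝ) : ℂ) *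
        inner ℂ (f z.1 - f z.2) (g z.1 - g z.2)) := by
  have hf : Continuous (f : EuclideanSpace ℝ (Fin N) → ℂ) := f.contDiff'.continuous
  have hg : Continuous (g : EuclideanSpace ℝ (Fin N) → ℂ) := g.contDiff'.continuous
  refine ((integrable_gagliardo_sq h0 h1 f).add (integrable_gagliardo_sq h0 h1 g)).mono' ?_ ?_
  · refine AEStronglyMeasurable.mul ?_ ?_
    · refine Measurable.aestronglyMeasurable ?_
      fun_prop
    · refine Continuous.aestronglyMeasurable ?_
      exact Continuous.inner (by fun_prop) (by fun_prop)
  · refine Filter.Eventually.of_forall fun z => ?_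
    have hker : 0 ≤ (‖z.1 - z.2‖ ^ ((N : ℝ) + 2 * σ))⁻¹ := by positivity
    rw [norm_mul, Complex.norm_real, Real.norm_of_nonneg hker]
    simp only [Pi.add_apply]
    rw [← mul_add]
    refine mul_le_mul_of_nonneg_left ((norm_inner_le_norm _ _).trans ?_) hker
    nlinarith [sq_nonneg (‖f z.1 - f z.2‖ - ‖g z.1 - g z.2‖),
      sq_nonneg (‖f z.1 - f z.2‖), sq_nonneg (‖g z.1 - g z.2‖)]

end Integrability

/-- The complex test functions `C_c^∞(Ω)`, to be equipped with the homogeneous Sobolev inner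
product of order `l` (a type synonym, so that this does not clash with the usual topology). -/
def TestSpace (_l : ℝ) (Ω : TopologicalSpace.Opens (EuclideanSpace ℝ (Fin N))) : Type :=
  𝓓(Ω, ℂ)

instance (l : ℝ) (Ω : TopologicalSpace.Opens (EuclideanSpace ℝ (Fin N))) :
    AddCommGroup (TestSpace l Ω) :=
  inferInstanceAs (AddCommGroup 𝓓(Ω, ℂ))

instance (l : ℝ) (Ω : TopologicalSpace.Opens (EuclideanSpace ℝ (Fin N))) :
    Module ℂ (TestSpace l Ω) :=
  inferInstanceAs (Module ℂ 𝓓(Ω, ℂ))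

lemma fract_pos {l : ℝ} (h : ¬ Int.fract l = 0) : 0 < Int.fract l :=
  lt_of_le_of_ne (Int.fract_nonneg l) (Ne.symm h)

lemma homInner_conj (l : ℝ) {Ω : TopologicalSpace.Opens (EuclideanSpace ℝ (Fin N))}
    (u v : 𝓓(Ω, ℂ)) : (starRingEnd ℂ) (homInner l v u) = homInner l u v := by
  unfold homInner
  rw [map_sum]
  refine Finset.sum_congr rfl fun ν _ => ?_
  split_ifs
  · unfold l2Inner
    rw [← integral_conj]
    exact integral_congr_ae (Filter.Eventually.of_forall fun x => inner_conj_symm _ _)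
  · unfold gagliardoInner
    rw [← integral_conj]
    refine integral_congr_ae (Filter.Eventually.of_forall fun z => ?_)
    simp only [map_mul, Complex.conj_ofReal]
    rw [inner_conj_symm]

lemma homInner_re_nonneg (l : ℝ) {Ω : TopologicalSpace.Opens (EuclideanSpace ℝ (Fin N))}
    (u : 𝓓(Ω, ℂ)) : 0 ≤ (homInner l u u).re := by
  unfold homInner
  rw [Complex.re_sum]
  refine Finset.sum_nonneg fun ν _ => ?_
  split_ifs with h
  · unfold l2Inner
    have := integral_re (𝕜 := ℂ) (integrable_l2Inner (multiDeriv Ω ν u) (multiDeriv Ω ν u))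
    refine le_of_le_of_eq ?_ this
    exact integral_nonneg fun x => inner_self_nonneg
  · unfold gagliardoInner
    have := integral_re (𝕜 := ℂ) (integrable_gagliardoInner (fract_pos h) (Int.fract_lt_one l)
      (multiDeriv Ω ν u) (multiDeriv Ω ν u))
    refine le_of_le_of_eq ?_ this
    refine integral_nonneg fun z => ?_
    simp only [Pi.zero_apply, RCLike.re_to_complex, Complex.re_ofReal_mul]
    exact mul_nonneg (by positivity) (inner_self_nonneg (𝕜 := ℂ)
      (x := multiDeriv Ω ν u z.1 - multiDeriv Ω ν u z.2))

lemma homInner_add (l : ℝ) {Ω : TopologicalSpace.Opens (EuclideanSpace ℝ (Fin N))}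
    (u v w : 𝓓(Ω, ℂ)) : homInner l (u + v) w = homInner l u w + homInner l v w := by
  unfold homInner
  rw [← Finset.sum_add_distrib]
  refine Finset.sum_congr rfl fun ν _ => ?_
  rw [map_add]
  split_ifs with h
  · unfold l2Inner
    rw [← integral_add (integrable_l2Inner _ _) (integrable_l2Inner _ _)]
    refine integral_congr_ae (Filter.Eventually.of_forall fun x => ?_)
    exact inner_add_left _ _ _
  · unfold gagliardoInner
    rw [← integral_add
      (integrable_gagliardoInner (fract_pos h) (Int.fract_lt_one l) _ _)
      (integrable_gagliardoInner (fract_pos h) (Int.fract_lt_one l) _ _)]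
    refine integral_congr_ae (Filter.Eventually.of_forall fun z => ?_)
    simp only
    rw [← mul_add, ← inner_add_left]
    congr 2
    simp only [add_apply]
    ring

lemma homInner_smul (l : ℝ) {Ω : TopologicalSpace.Opens (EuclideanSpace ℝ (Fin N))}
    (u v : 𝓓(Ω, ℂ)) (c : ℂ) : homInner l (c • u) v = (starRingEnd ℂ) c * homInner l u v := by
  unfold homInner
  rw [Finset.mul_sum]
  refine Finset.sum_congr rfl fun ν _ => ?_
  rw [map_smul]
  split_ifs with h
  · unfold l2Inner
    rw [← integral_const_mul]
    refine integral_congr_ae (Filter.Eventually.of_forall fun x => ?_)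
    exact inner_smul_left _ _ _
  · unfold gagliardoInner
    rw [← integral_const_mul]
    refine integral_congr_ae (Filter.Eventually.of_forall fun z => ?_)
    simp only
    rw [mul_left_comm, ← inner_smul_left]
    congr 2
    simp only [smul_apply, smul_eq_mul]
    ring

/-- The homogeneous Sobolev form is a positive semidefinite Hermitian form. -/
abbrev homCore (l : ℝ) (Ω : TopologicalSpace.Opens (EuclideanSpace ℝ (Fin N))) :
    PreInnerProductSpace.Core ℂ (TestSpace l Ω) where
  inner u v := homInner l (Ω := Ω) u v
  conj_inner_symm u v := homInner_conj l (Ω := Ω) u v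
  re_inner_nonneg u := homInner_re_nonneg l (Ω := Ω) u
  add_left u v w := homInner_add l (Ω := Ω) u v w
  smul_left u v c := homInner_smul l (Ω := Ω) u v c

instance (l : ℝ) (Ω : TopologicalSpace.Opens (EuclideanSpace ℝ (Fin N))) :
    SeminormedAddCommGroup (TestSpace l Ω) :=
  @InnerProductSpace.Core.toSeminormedAddCommGroup ℂ (TestSpace l Ω) _ _ _ (homCore l Ω)

instance (l : ℝ) (Ω : TopologicalSpace.Opens (EuclideanSpace ℝ (Fin N))) :
    InnerProductSpace ℂ (TestSpace l Ω) :=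
  InnerProductSpace.ofCore (homCore l Ω)

/-- The Hilbert space `H₀^l(Ω)`: the completion of `C_c^∞(Ω)` in the homogeneous Sobolev norm of
order `l` (for bounded `Ω` and `2l < N` this norm is equivalent on `C_c^∞(Ω)` to the
inhomogeneous one). -/
abbrev HSob (l : ℝ) (Ω : TopologicalSpace.Opens (EuclideanSpace ℝ (Fin N))) : Type :=
  UniformSpace.Completion (TestSpace l Ω)

/-- The class in `H₀^l(Ω)` of a test function. -/
def toHSob (l : ℝ) {Ω : TopologicalSpace.Opens (EuclideanSpace ℝ (Fin N))}
    (v : 𝓓(Ω, ℂ)) : HSob l Ω :=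
  UniformSpace.Completion.coe' (α := TestSpace l Ω) v

lemma inner_toHSob (l : ℝ) {Ω : TopologicalSpace.Opens (EuclideanSpace ℝ (Fin N))}
    (u v : 𝓓(Ω, ℂ)) : inner ℂ (toHSob l u) (toHSob l v) = homInner l u v :=
  UniformSpace.Completion.inner_coe (E := TestSpace l Ω) u v

/-- `S` is the bounded operator on `H₀^l(Ω)` defined by the quadratic form `∫ V |v|² dμ`, given on
the dense set of test functions: `(S v, v) = ∫ V |v|² dμ` (a convergent integral). -/
def IsOperatorOfForm (l : ℝ) (Ω : TopologicalSpace.Opens (EuclideanSpace ℝ (Fin N)))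
    (μ : Measure (EuclideanSpace ℝ (Fin N))) (V : EuclideanSpace ℝ (Fin N) → ℂ)
    (S : HSob l Ω →L[ℂ] HSob l Ω) : Prop :=
  ∀ v : 𝓓(Ω, ℂ),
    Integrable (fun x => V x * ((‖v x‖ ^ 2 : ℝ) : ℂ)) μ ∧
    inner ℂ (toHSob l v) (S (toHSob l v)) = ∫ x, V x * ((‖v x‖ ^ 2 : ℝ) : ℂ) ∂μ

section Counting

variable {H : Type*} [NormedAddCommGroup H] [InnerProductSpace ℂ H]

/-- The number of eigenvalues of `T` in the set `I` of reals, counted with multiplicity. -/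
def eigCount (T : H →L[ℂ] H) (I : Set ℝ) : ℝ≥0∞ :=
  ∑' κ : I, ((Module.rank ℂ
    (Module.End.eigenspace (T : H →ₗ[ℂ] H) ((κ : ℝ) : ℂ))).toENat : ℝ≥0∞)

/-- `n₊(lam, T)`, the number of eigenvalues `κ > lam`. -/
def nPlus (lam : ℝ) (T : H →L[ℂ] H) : ℝ≥0∞ := eigCount T {κ | lam < κ}

/-- `n₋(lam, T)`, the number of eigenvalues `κ` with `-κ > lam`. -/
def nMinus (lam : ℝ) (T : H →L[ℂ] H) : ℝ≥0∞ := eigCount T {κ | lam < -κ}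

/-- `n(lam, T)`, the number of singular numbers of `T` (the square roots of the eigenvalues of
`T* T`, with multiplicity) that exceed `lam`. -/
def nSing [CompleteSpace H] (lam : ℝ) (T : H →L[ℂ] H) : ℝ≥0∞ :=
  eigCount (ContinuousLinearMap.adjoint T ∘L T) {κ | lam < √κ}

end Counting

end SingularBS

end

/-! The bound is of Cwikel type, and all of it comes from the operator `T : v ↦ √W · v` from H₀^l(Ω)
to L²(μ) with a weight W ≥ 0. For complex V one takes W = |V| and S = T* U T, where U multiplies by
the phase of V. For real V one takes W = V₊ or V₋, and then ±(S v, v) ≤ ‖T v‖².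

The key is a decomposition (`exists_sqrt_weight_op`): for every b > 0 there is H with ‖T - H‖ ≤ b
whose squared Hilbert–Schmidt norm is at most C A^(θ-1) ∫ W^θ dμ · b^(-2(θ-1)). Hence T is compact.
If n orthonormal vectors satisfy ‖T e_i‖² > λ on average, then nλ ≤ 2nb² + 2‖H‖²_HS, and b² = λ/4
gives n ≤ 4‖H‖²_HS/λ, which is of order λ^(-θ).

The decomposition is a cut in heat time. Since |ξ|^(-2l) is a multiple of ∫ t^(l-1) exp(-πt|ξ|²) dt,
a test function is the integral over (ξ, t) of a kernel of modulus t^((l-1)/2) exp(-πt|ξ|²/2)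
against a lift whose L² norm is controlled by |v|_l (`exists_heatLift_op`). At the point x the
kernel is cut at a time T(x) depending on W(x). Times beyond T(x) give a Hilbert–Schmidt operator:
integration over ξ produces t^(l-1-N/2), integrable at infinity because 2l < N. Times before T(x)
give a bounded operator. By duality this is an estimate of Gaussian energies of measures p dμ; the
growth of μ gives ∫ exp(-π|x-y|²/t) dμ(y) ≤ c A t^(s/2), and the remaining time integral ∫₀
t^(γ/2-1) dt with γ = s + 2l - N converges because γ > 0. The cut is chosen so that the bound of
this part does not depend on W. -/

open MeasureTheory Set
open scoped Distributions ENNReal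

noncomputable section

namespace SingularBS

/-! ### Hilbert–Schmidt bounds and compactness -/

section Hilbert

variable {E F : Type*} [NormedAddCommGroup E] [InnerProductSpace ℂ E]
  [NormedAddCommGroup F] [InnerProductSpace ℂ F]

/-- The square of the Hilbert--Schmidt norm of `T` is at most `M`. -/
def HSBound (T : E →L[ℂ] F) (M : ℝ) : Prop :=
  ∀ (ι : Type) [Fintype ι] (e : ι → E), Orthonormal ℂ e → ∑ i, ‖T (e i)‖ ^ 2 ≤ M

lemma orthonormal_option_elim {ι : Type} {e : ι → E} (he : Orthonormal ℂ e) {v : E}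
    (hv : ‖v‖ = 1) (h : ∀ i, inner ℂ (e i) v = 0) :
    Orthonormal ℂ (fun o : Option ι => o.elim v e) := by
  refine ⟨?_, ?_⟩
  · rintro (_ | i)
    · exact hv
    · exact he.1 i
  · rintro (_ | i) (_ | j) hij
    · exact absurd rfl hij
    · exact inner_eq_zero_symm.1 (h j)
    · exact h i
    · exact he.2 (fun hh => hij (by rw [hh]))

/-- A Hilbert--Schmidt operator is small on the complement of a finite-dimensional space. -/
lemma HSBound.exists_small {T : E →L[ℂ] F} {M : ℝ} (h : HSBound T M) {ε : ℝ} (hε : 0 < ε) :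
    ∃ W : Submodule ℂ E, FiniteDimensional ℂ W ∧ ∀ v ∈ Wᗮ, ‖T v‖ ≤ ε * ‖v‖ := by
  classical
  set Z : Set ℝ := {r | ∃ (n : ℕ) (e : Fin n → E), Orthonormal ℂ e ∧ r = ∑ i, ‖T (e i)‖ ^ 2}
    with hZ
  have hb : BddAbove Z := ⟨M, by rintro r ⟨n, e, he, rfl⟩; exact h _ e he⟩
  have hne : Z.Nonempty := ⟨_, 0, fun i => i.elim0, ⟨fun i => i.elim0, fun i => i.elim0⟩, rfl⟩
  -- A finite orthonormal family is taken whose sum is within ε² of the supremum. Adjoining a unit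
  -- vector w orthogonal to it adds ‖T w‖² to the sum, so ‖T w‖ ≤ ε.
  obtain ⟨r, ⟨n, e, he, rfl⟩, hr⟩ := exists_lt_of_lt_csSup hne
    (show sSup Z - ε ^ 2 < sSup Z by linarith [pow_pos hε 2])
  refine ⟨Submodule.span ℂ (Set.range e), FiniteDimensional.span_of_finite ℂ (Set.finite_range e),
    fun v hv => ?_⟩
  have hv' : ∀ i, inner ℂ (e i) v = 0 := fun i =>
    (Submodule.mem_orthogonal _ _).1 hv _ (Submodule.subset_span ⟨i, rfl⟩)
  rcases eq_or_ne v 0 with rfl | hv0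
  · simp
  have hvn : 0 < ‖v‖ := norm_pos_iff.2 hv0
  set w : E := ((‖v‖⁻¹ : ℝ) : ℂ) • v with hw
  have hw1 : ‖w‖ = 1 := by
    rw [hw, norm_smul, Complex.norm_real, norm_inv, norm_norm, inv_mul_cancel₀ hvn.ne']
  have ho := orthonormal_option_elim he hw1 (fun i => by rw [hw, inner_smul_right, hv', mul_zero])
  have hle : ∑ o : Option (Fin n), ‖T (o.elim w e)‖ ^ 2 ≤ sSup Z := by
    refine le_csSup hb ⟨n + 1, (fun o : Option (Fin n) => o.elim w e) ∘
      (finSuccEquiv n), ho.comp _ (finSuccEquiv n).injective, ?_⟩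
    exact (Fintype.sum_equiv (finSuccEquiv n) _ _ fun i => rfl).symm
  rw [Fintype.sum_option] at hle
  simp only [Option.elim] at hle
  have hTw : ‖T w‖ ≤ ε := by
    exact (sq_le_sq₀ (norm_nonneg _) hε.le).1 (by linarith)
  have : ‖T w‖ = ‖v‖⁻¹ * ‖T v‖ := by
    rw [hw, map_smul, norm_smul, Complex.norm_real, norm_inv, norm_norm]
  rw [this] at hTw
  calc ‖T v‖ = ‖v‖ * (‖v‖⁻¹ * ‖T v‖) := by field_simp
    _ ≤ ‖v‖ * ε := by gcongr
    _ = _ := mul_comm _ _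

/-- A norm limit of Hilbert--Schmidt operators is compact. -/
lemma isCompactOperator_of_forall_hsBound [CompleteSpace F] {T : E →L[ℂ] F}
    (h : ∀ b : ℝ, 0 < b → ∃ (H : E →L[ℂ] F) (M : ℝ), HSBound H M ∧ ‖T - H‖ ≤ b) :
    IsCompactOperator T := by
  have key : ∀ ε : ℝ, 0 < ε → ∃ R : E →L[ℂ] F, IsCompactOperator R ∧ ‖T - R‖ ≤ ε := by
    intro ε hε
    obtain ⟨H, M, hM, hTH⟩ := h (ε / 2) (by positivity)
    obtain ⟨W, hW, hWs⟩ := hM.exists_small (show 0 < ε / 2 by positivity)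
    -- The approximant has finite rank. The error is T on the component u in Wᗮ, where T = (T - H) +
    -- H and each summand costs at most ε/2.
    refine ⟨T ∘L W.starProjection, ?_, ?_⟩
    · refine IsCompactOperator.clm_comp ?_ T
      have : ProperSpace W := FiniteDimensional.proper ℂ W
      have hc : IsCompactOperator (W.subtypeL : W → E) :=
        isCompactOperator_of_locallyCompactSpace_rng W.subtypeL
      exact hc.comp_clm W.orthogonalProjectionOnto
    · refine ContinuousLinearMap.opNorm_le_bound _ hε.le fun v => ?_
      set u := v - W.starProjection v with hu
      have hu' : u ∈ Wᗮ := W.sub_starProjection_mem_orthogonal v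
      have hun : ‖u‖ ≤ ‖v‖ := by
        have := W.norm_sq_eq_add_norm_sq_starProjection v
        have h2 : Wᗮ.starProjection v = u := by
          rw [Submodule.starProjection_orthogonal_val]
        rw [h2] at this
        refine (sq_le_sq₀ (norm_nonneg _) (norm_nonneg _)).1 ?_
        nlinarith [sq_nonneg ‖W.starProjection v‖]
      have e1 : (T - T ∘L W.starProjection) v = (T - H) u + H u := by
        simp [hu]
      rw [e1]
      calc ‖(T - H) u + H u‖ ≤ ‖(T - H) u‖ + ‖H u‖ := norm_add_le _ _
        _ ≤ ε / 2 * ‖u‖ + ε / 2 * ‖u‖ :=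
          add_le_add ((T - H).le_of_opNorm_le hTH u) (hWs u hu')
        _ = ε * ‖u‖ := by ring
        _ ≤ ε * ‖v‖ := by gcongr
  choose! R hR hTR using key
  refine isCompactOperator_of_tendsto (l := Filter.atTop)
    (F := fun n : ℕ => R (1 / ((n : ℝ) + 1))) ?_
    (Filter.Eventually.of_forall fun n => hR _ (by positivity))
  rw [tendsto_iff_norm_sub_tendsto_zero]
  refine squeeze_zero (fun _ => norm_nonneg _) (fun n => ?_)
    tendsto_one_div_add_atTop_nhds_zero_nat
  rw [norm_sub_rev]
  exact hTR _ (by positivity)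

/-- From ‖T e‖² ≤ 2‖(T - H) e‖² + 2‖H e‖². The first term grows with the number of vectors; the
counting lemmas absorb it by taking b small. -/
lemma HSBound.sum_norm_sq_le {T H : E →L[ℂ] F} {M b : ℝ} (hH : HSBound H M) (hb : ‖T - H‖ ≤ b)
    {ι : Type} [Fintype ι] {e : ι → E} (he : Orthonormal ℂ e) :
    ∑ i, ‖T (e i)‖ ^ 2 ≤ 2 * Fintype.card ι * b ^ 2 + 2 * M := by
  have h1 : ∀ i, ‖T (e i)‖ ^ 2 ≤ 2 * b ^ 2 + 2 * ‖H (e i)‖ ^ 2 := by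
    intro i
    have h2 : ‖(T - H) (e i)‖ ≤ b := by
      simpa [he.1 i] using (T - H).le_of_opNorm_le hb (e i)
    have h3 : ‖T (e i)‖ ≤ b + ‖H (e i)‖ := by
      calc ‖T (e i)‖ = ‖(T - H) (e i) + H (e i)‖ := by simp
        _ ≤ _ := (norm_add_le _ _).trans (by gcongr)
    have h4 : ‖T (e i)‖ ^ 2 ≤ (b + ‖H (e i)‖) ^ 2 := by gcongr
    nlinarith [sq_nonneg (b - ‖H (e i)‖)]
  calc ∑ i, ‖T (e i)‖ ^ 2 ≤ ∑ i, (2 * b ^ 2 + 2 * ‖H (e i)‖ ^ 2) :=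
        Finset.sum_le_sum fun i _ => h1 i
    _ = 2 * Fintype.card ι * b ^ 2 + 2 * ∑ i, ‖H (e i)‖ ^ 2 := by
      rw [Finset.sum_add_distrib, ← Finset.mul_sum (Finset.univ) (fun i => ‖H (e i)‖ ^ 2), Finset.sum_const, Finset.card_univ,
        nsmul_eq_mul]
      ring
    _ ≤ _ := by
      have := hH ι e he
      linarith

end Hilbert

/-! ### Counting eigenvalues and singular numbers -/

section Counting

variable {E F : Type*} [NormedAddCommGroup E] [InnerProductSpace ℂ E]
  [NormedAddCommGroup F] [InnerProductSpace ℂ F]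

/-- The eigenvalues are counted by orthonormal families of eigenvectors. -/
lemma eigCount_le {S : E →L[ℂ] E} (hS : (S : E →ₗ[ℂ] E).IsSymmetric) {I : Set ℝ} {X : ℝ}
    (h : ∀ (ι : Type) [Fintype ι] (e : ι → E) (κ : ι → ℝ), Orthonormal ℂ e → (∀ i, κ i ∈ I) →
      (∀ i, S (e i) = (κ i : ℂ) • e i) → (Fintype.card ι : ℝ) ≤ X) :
    eigCount S I ≤ ENNReal.ofReal X := by
  classical
  set V : I → Submodule ℂ E := fun κ =>
    Module.End.eigenspace (S : E →ₗ[ℂ] E) ((κ : ℝ) : ℂ) with hV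
  have hfin : ∀ κ, FiniteDimensional ℂ (V κ) := by
    intro κ
    by_contra hcon
    have hrank : Cardinal.aleph0 ≤ Module.rank ℂ (V κ) := by
      by_contra hlt
      exact hcon (Module.rank_lt_aleph0_iff.1 (not_le.1 hlt))
    -- An infinite-dimensional eigenspace would contain ⌊X⌋ + 1 orthonormal eigenvectors, against
    -- the hypothesis `h`.
    obtain ⟨s, hs, hli⟩ := le_rank_iff_exists_linearIndependent_finset.1
      ((Cardinal.natCast_lt_aleph0 (n := ⌊X⌋₊ + 1)).le.trans hrank)
    set W := Submodule.span ℂ (s : Set (V κ))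
    have hWf : FiniteDimensional ℂ W := FiniteDimensional.span_of_finite ℂ s.finite_toSet
    have hWd : Module.finrank ℂ W = ⌊X⌋₊ + 1 := by
      rw [← hs]
      exact finrank_span_finset_eq_card hli
    have ho := (stdOrthonormalBasis ℂ W).orthonormal
    have := h (Fin (Module.finrank ℂ W)) (fun i => ((stdOrthonormalBasis ℂ W i : V κ) : E))
      (fun _ => κ) ((ho.comp_linearIsometry W.subtypeₗᵢ).comp_linearIsometry (V κ).subtypeₗᵢ)
      (fun _ => κ.2) (fun i => Module.End.mem_eigenspace_iff.1 (stdOrthonormalBasis ℂ W i : V κ).2)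
    rw [Fintype.card_fin, hWd] at this
    push_cast at this
    linarith [Nat.lt_floor_add_one X]
  unfold eigCount
  rw [ENNReal.tsum_eq_iSup_sum]
  refine iSup_le fun s => ?_
  have hterm : ∀ κ : I, ((Module.rank ℂ (V κ)).toENat : ℝ≥0∞) = (Module.finrank ℂ (V κ) : ℕ) := by
    intro κ
    rw [← Module.finrank_eq_rank ℂ (V κ), Cardinal.toENat_nat]
    rfl
  rw [Finset.sum_congr rfl fun κ _ => hterm κ, ← Nat.cast_sum, ← ENNReal.ofReal_natCast]
  refine ENNReal.ofReal_le_ofReal ?_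
  -- Eigenspaces of a symmetric operator are mutually orthogonal, so orthonormal bases of finitely
  -- many of them form one orthonormal family, to which `h` applies.
  have hof : OrthogonalFamily ℂ (fun κ : s => V κ) fun κ => (V κ).subtypeₗᵢ :=
    hS.orthogonalFamily_eigenspaces.comp (f := fun κ : s => ((κ : I) : ℝ) |> Complex.ofReal)
      (fun a b hab => Subtype.ext (Subtype.ext (Complex.ofReal_injective hab)))
  have ho := hof.orthonormal_sigma_orthonormal
    (fun κ : s => (stdOrthonormalBasis ℂ (V κ)).orthonormal)
  have := h _ _ (fun a => ((a.1 : I) : ℝ)) ho (fun a => (a.1 : I).2)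
    (fun a => Module.End.mem_eigenspace_iff.1 (stdOrthonormalBasis ℂ (V a.1) a.2).2)
  rw [Fintype.card_sigma] at this
  simp only [Fintype.card_fin] at this
  rwa [Finset.sum_coe_sort s (fun κ => Module.finrank ℂ (V κ))] at this

/-- For n orthonormal eigenvectors, nλ ≤ ∑ ‖T e_i‖² ≤ nλ/2 + 2M: the choice b² = λ/4 leaves half of
nλ on the left. -/
lemma eigCount_le_of_form_le {S : E →L[ℂ] E} (hS : (S : E →ₗ[ℂ] E).IsSymmetric)
    {T H : E →L[ℂ] F} {lam M b ε : ℝ} (hlam : 0 < lam) (hb : ‖T - H‖ ≤ b) (hb2 : b ^ 2 = lam / 4)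
    (hH : HSBound H M) (hform : ∀ v, ε * (inner ℂ v (S v)).re ≤ ‖T v‖ ^ 2) :
    eigCount S {κ | lam < ε * κ} ≤ ENNReal.ofReal (4 * M / lam) := by
  refine eigCount_le hS fun ι _ e κ he hκ hSe => ?_
  have h1 : Fintype.card ι * lam ≤ ∑ i, ‖T (e i)‖ ^ 2 := by
    have : ∑ _i : ι, lam ≤ ∑ i, ‖T (e i)‖ ^ 2 := by
      refine Finset.sum_le_sum fun i _ => ?_
      refine (le_of_lt (hκ i)).trans (le_trans (le_of_eq ?_) (hform (e i)))
      rw [hSe, inner_smul_right, inner_self_eq_norm_sq_to_K, he.1 i]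
      simp
    simpa using this
  have h2 := hH.sum_norm_sq_le hb he
  rw [hb2] at h2
  rw [le_div_iff₀ hlam]
  linarith

/-- S need not be normal, so the eigenvectors e_i of S*S are paired with g_i = S e_i / √κ_i, which
are again orthonormal. Then √κ_i = (g_i, S e_i) = (T g_i, U T e_i) is at most the mean of ‖T g_i‖²
and ‖T e_i‖², and both families obey the bound used for forms. -/
lemma nSing_le [CompleteSpace E] [CompleteSpace F] {T H : E →L[ℂ] F} {U : F →L[ℂ] F}
    {lam M b : ℝ} (hlam : 0 < lam) (hb : ‖T - H‖ ≤ b) (hb2 : b ^ 2 = lam / 4)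
    (hH : HSBound H M) (hU : ‖U‖ ≤ 1) :
    nSing lam (ContinuousLinearMap.adjoint T ∘L U ∘L T) ≤ ENNReal.ofReal (4 * M / lam) := by
  set S := ContinuousLinearMap.adjoint T ∘L U ∘L T with hSdef
  refine eigCount_le ?_ fun ι _ e κ he hκ hSe => ?_
  · intro x y
    simp [ContinuousLinearMap.adjoint_inner_left, ContinuousLinearMap.adjoint_inner_right]
  have hκ0 : ∀ i, 0 < √(κ i) := fun i => hlam.trans (hκ i)
  have hκ1 : ∀ i, 0 < κ i := fun i => Real.sqrt_pos.1 (hκ0 i)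
  have hSS : ∀ i j, inner ℂ (S (e i)) (S (e j)) = (κ j : ℂ) * inner ℂ (e i) (e j) := by
    intro i j
    rw [← ContinuousLinearMap.adjoint_inner_right, ← inner_smul_right, ← hSe]
    rfl
  set g : ι → E := fun i => (((√(κ i))⁻¹ : ℝ) : ℂ) • S (e i) with hg
  have hgo : Orthonormal ℂ g := by
    classical
    rw [orthonormal_iff_ite]
    intro i j
    simp only [hg]
    rw [inner_smul_left, inner_smul_right, hSS, Complex.conj_ofReal]
    rw [orthonormal_iff_ite.1 he i j]
    split_ifs with hij
    · subst hij
      rw [mul_one]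
      norm_cast
      have := Real.mul_self_sqrt (hκ1 i).le
      field_simp [(hκ0 i).ne']
      nlinarith
    · simp
  have hgS : ∀ i, √(κ i) ≤ (‖T (g i)‖ ^ 2 + ‖T (e i)‖ ^ 2) / 2 := by
    intro i
    have h1 : inner ℂ (g i) (S (e i)) = ((√(κ i) : ℝ) : ℂ) := by
      simp only [hg]
      rw [inner_smul_left, hSS, Complex.conj_ofReal, inner_self_eq_norm_sq_to_K, he.1 i]
      have := Real.mul_self_sqrt (hκ1 i).le
      simp only [Complex.coe_algebraMap, Complex.ofReal_one, one_pow, mul_one]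
      norm_cast
      rw [inv_mul_eq_iff_eq_mul₀ (hκ0 i).ne', this]
    have h2 : inner ℂ (g i) (S (e i)) = inner ℂ (T (g i)) (U (T (e i))) := by
      rw [hSdef]
      simp [ContinuousLinearMap.adjoint_inner_right]
    have h3 : ‖inner ℂ (T (g i)) (U (T (e i)))‖ ≤ ‖T (g i)‖ * ‖T (e i)‖ := by
      refine (norm_inner_le_norm _ _).trans ?_
      gcongr
      simpa using U.le_of_opNorm_le hU (T (e i))
    rw [← h2, h1, Complex.norm_real, Real.norm_of_nonneg (hκ0 i).le] at h3
    nlinarith [sq_nonneg (‖T (g i)‖ - ‖T (e i)‖)]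
  have h1 : Fintype.card ι * lam ≤ ∑ i, (‖T (g i)‖ ^ 2 + ‖T (e i)‖ ^ 2) / 2 := by
    have : ∑ _i : ι, lam ≤ ∑ i, (‖T (g i)‖ ^ 2 + ‖T (e i)‖ ^ 2) / 2 :=
      Finset.sum_le_sum fun i _ => (le_of_lt (hκ i)).trans (hgS i)
    simpa using this
  rw [← Finset.sum_div, Finset.sum_add_distrib] at h1
  have h2 := hH.sum_norm_sq_le hb he
  have h3 := hH.sum_norm_sq_le hb hgo
  rw [hb2] at h2 h3
  rw [le_div_iff₀ hlam]
  linarith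

end Counting

end SingularBS

namespace SingularBS

variable {N : ℕ}

/-! ### Gaussian energies of a measure with power growth -/

section Energy

lemma summable_exp_neg_mul_succ_rpow (s : ℝ) :
    Summable fun k : ℕ => Real.exp (-k) * ((k : ℝ) + 1) ^ s := by
  have h1 := (summable_nat_add_iff 1).2
    (Real.summable_pow_mul_exp_neg_nat_mul ⌈s⌉₊ (r := 1) one_pos)
  refine Summable.of_nonneg_of_le (fun k => by positivity) (fun k => ?_)
    (h1.mul_left (Real.exp 1))
  have h2 : ((k : ℝ) + 1) ^ s ≤ ((k : ℝ) + 1) ^ ⌈s⌉₊ := by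
    rw [← Real.rpow_natCast]
    exact Real.rpow_le_rpow_of_exponent_le (by linarith [k.cast_nonneg (α := ℝ)]) (Nat.le_ceil s)
  have h3 : Real.exp (-k) = Real.exp 1 * Real.exp (-1 * ((k + 1 : ℕ) : ℝ)) := by
    rw [← Real.exp_add]
    congr 1
    push_cast
    ring
  rw [h3]
  calc _ ≤ Real.exp 1 * Real.exp (-1 * ((k + 1 : ℕ) : ℝ)) * ((k : ℝ) + 1) ^ ⌈s⌉₊ := by gcongr
    _ = _ := by push_cast; ring

/-- The constant in the bound of Gaussian averages of a measure of dimension `s`. -/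
def gaussConst (s : ℝ) : ℝ := ∑' k : ℕ, Real.exp (-k) * ((k : ℝ) + 1) ^ s

lemma gaussConst_nonneg (s : ℝ) : 0 ≤ gaussConst s := tsum_nonneg fun k => by positivity

/-- Shells of width √t: at distance between k√t and (k+1)√t the Gaussian is at most exp(-k), since
πk² ≥ k, and the ball of radius (k+1)√t has measure at most A((k+1)√t)^s. -/
lemma lintegral_gaussian_le {X : Type*} [PseudoMetricSpace X] [MeasurableSpace X]
    [OpensMeasurableSpace X] {μ : Measure X} {A s : ℝ} (hA : 0 ≤ A) {x : X}
    (h : ∀ r : ℝ, 0 < r → μ (Metric.ball x r) ≤ ENNReal.ofReal (A * r ^ s)) {t : ℝ} (ht : 0 < t) :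
    ∫⁻ y, ENNReal.ofReal (Real.exp (-Real.pi * dist y x ^ 2 / t)) ∂μ ≤
      ENNReal.ofReal (gaussConst s * A * t ^ (s / 2)) := by
  have hst : 0 < √t := Real.sqrt_pos.2 ht
  set B : ℕ → Set X := fun k => Metric.ball x (((k : ℝ) + 1) * √t) with hB
  have hpt : ∀ y, ENNReal.ofReal (Real.exp (-Real.pi * dist y x ^ 2 / t)) ≤
      ∑' k : ℕ, (B k).indicator (fun _ => ENNReal.ofReal (Real.exp (-k))) y := by
    intro y
    set k := ⌊dist y x / √t⌋₊ with hk
    refine le_trans ?_ (ENNReal.le_tsum k)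
    have h1 : (k : ℝ) ≤ dist y x / √t := Nat.floor_le (by positivity)
    have h2 : dist y x / √t < k + 1 := Nat.lt_floor_add_one _
    have hy : y ∈ B k := by
      rw [div_lt_iff₀ hst] at h2
      exact h2
    rw [indicator_of_mem hy]
    refine ENNReal.ofReal_le_ofReal (Real.exp_le_exp.2 ?_)
    have h3 : (k : ℝ) ^ 2 ≤ dist y x ^ 2 / t := by
      calc (k : ℝ) ^ 2 ≤ (dist y x / √t) ^ 2 := by gcongr
        _ = _ := by rw [div_pow, Real.sq_sqrt ht.le]
    have h4 : (k : ℝ) ≤ (k : ℝ) ^ 2 := by exact_mod_cast Nat.le_self_pow two_ne_zero k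
    have h5 := Real.pi_gt_three
    have h6 : -Real.pi * dist y x ^ 2 / t = -(Real.pi * (dist y x ^ 2 / t)) := by ring
    rw [h6]
    nlinarith
  calc _ ≤ ∫⁻ y, ∑' k : ℕ, (B k).indicator (fun _ => ENNReal.ofReal (Real.exp (-k))) y ∂μ :=
        lintegral_mono hpt
    _ = ∑' k : ℕ, ∫⁻ y, (B k).indicator (fun _ => ENNReal.ofReal (Real.exp (-k))) y ∂μ :=
        lintegral_tsum fun k =>
          (measurable_const.indicator Metric.isOpen_ball.measurableSet).aemeasurable
    _ ≤ ∑' k : ℕ, ENNReal.ofReal ((A * t ^ (s / 2)) * (Real.exp (-k) * ((k : ℝ) + 1) ^ s)) := by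
        refine ENNReal.tsum_le_tsum fun k => ?_
        rw [lintegral_indicator Metric.isOpen_ball.measurableSet, setLIntegral_const]
        calc _ ≤ ENNReal.ofReal (Real.exp (-k)) *
              ENNReal.ofReal (A * (((k : ℝ) + 1) * √t) ^ s) := by
              gcongr
              exact h _ (by positivity)
          _ = _ := by
              rw [← ENNReal.ofReal_mul (by positivity), Real.mul_rpow (by positivity) hst.le,
                Real.sqrt_eq_rpow, ← Real.rpow_mul ht.le]
              congr 1
              rw [show (1 / 2 : ℝ) * s = s / 2 by ring]
              ring
    _ = ENNReal.ofReal (∑' k : ℕ, (A * t ^ (s / 2)) * (Real.exp (-k) * ((k : ℝ) + 1) ^ s)) := by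
        rw [ENNReal.ofReal_tsum_of_nonneg (fun k => by positivity)
          ((summable_exp_neg_mul_succ_rpow s).mul_left _)]
    _ = _ := by
        rw [tsum_mul_left, gaussConst]
        congr 1
        ring

/-- The character `x ↦ exp (2πi ⟨x, ξ⟩)`. -/
def char2pi (x ξ : EuclideanSpace ℝ (Fin N)) : ℂ :=
  Complex.exp (2 * Real.pi * Complex.I * inner ℝ x ξ)

lemma norm_char2pi (x ξ : EuclideanSpace ℝ (Fin N)) : ‖char2pi x ξ‖ = 1 := by
  have : char2pi x ξ = Complex.exp (((2 * Real.pi * inner ℝ x ξ : ℝ) : ℂ) * Complex.I) := by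
    unfold char2pi
    congr 1
    push_cast
    ring
  rw [this, Complex.norm_exp_ofReal_mul_I]

lemma continuous_char2pi :
    Continuous fun z : EuclideanSpace ℝ (Fin N) × EuclideanSpace ℝ (Fin N) =>
      char2pi z.1 z.2 := by
  unfold char2pi
  refine Complex.continuous_exp.comp (continuous_const.mul (Complex.continuous_ofReal.comp ?_))
  exact continuous_fst.inner continuous_snd

lemma measurable_char2pi {α : Type*} [MeasurableSpace α] {f g : α → EuclideanSpace ℝ (Fin N)}
    (hf : Measurable f) (hg : Measurable g) : Measurable (fun a => char2pi (f a) (g a)) :=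
  Complex.measurable_exp.comp
    (measurable_const.mul (Complex.measurable_ofReal.comp (hf.inner hg)))

lemma char2pi_mul_conj (x y ξ : EuclideanSpace ℝ (Fin N)) :
    char2pi x ξ * (starRingEnd ℂ) (char2pi y ξ) = char2pi (x - y) ξ := by
  unfold char2pi
  rw [← Complex.exp_conj, ← Complex.exp_add]
  congr 1
  simp only [map_mul, Complex.conj_ofReal, Complex.conj_I, inner_sub_left, Complex.ofReal_sub,
    map_ofNat]
  ring

lemma integral_gaussian_mul_char2pi {t : ℝ} (ht : 0 < t) (w : EuclideanSpace ℝ (Fin N)) :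
    ∫ ξ : EuclideanSpace ℝ (Fin N),
      ((Real.exp (-Real.pi * t * ‖ξ‖ ^ 2) : ℝ) : ℂ) * char2pi w ξ =
      ((t ^ (-(N : ℝ) / 2) * Real.exp (-Real.pi * ‖w‖ ^ 2 / t) : ℝ) : ℂ) := by
  have hπ := Real.pi_pos
  have hb : 0 < ((Real.pi * t : ℝ) : ℂ).re := by
    rw [Complex.ofReal_re]
    positivity
  have key := GaussianFourier.integral_cexp_neg_mul_sq_norm_add (b := ((Real.pi * t : ℝ) : ℂ)) hb
    (2 * Real.pi * Complex.I) w
  have h1 : ∀ ξ : EuclideanSpace ℝ (Fin N),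
      ((Real.exp (-Real.pi * t * ‖ξ‖ ^ 2) : ℝ) : ℂ) * char2pi w ξ =
      Complex.exp (-((Real.pi * t : ℝ) : ℂ) * ‖ξ‖ ^ 2 +
        2 * Real.pi * Complex.I * inner ℝ w ξ) := by
    intro ξ
    unfold char2pi
    rw [Complex.ofReal_exp, ← Complex.exp_add]
    congr 2
    push_cast
    ring
  simp_rw [h1]
  rw [key, finrank_euclideanSpace_fin, Complex.ofReal_mul (t ^ (-(N : ℝ) / 2)), Complex.ofReal_exp]
  congr 1
  · have h2 : (Real.pi : ℂ) / ((Real.pi * t : ℝ) : ℂ) = ((t⁻¹ : ℝ) : ℂ) := by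
      rw [← Complex.ofReal_div]
      congr 1
      field_simp
    rw [h2, show (N : ℂ) / 2 = (((N : ℝ) / 2 : ℝ) : ℂ) by push_cast; rfl,
      ← Complex.ofReal_cpow (by positivity), Real.inv_rpow ht.le, ← Real.rpow_neg ht.le, neg_div]
  · congr 1
    push_cast
    have h3 : (t : ℂ) ≠ 0 := by exact_mod_cast ht.ne'
    have h4 : (Real.pi : ℂ) ≠ 0 := by exact_mod_cast hπ.ne'
    rw [mul_pow, mul_pow, Complex.I_sq]
    field_simp
    ring

lemma integrable_gaussian {t : ℝ} (ht : 0 < t) :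
    Integrable fun ξ : EuclideanSpace ℝ (Fin N) => Real.exp (-Real.pi * t * ‖ξ‖ ^ 2) := by
  have hb : 0 < ((Real.pi * t : ℝ) : ℂ).re := by
    rw [Complex.ofReal_re]
    exact mul_pos Real.pi_pos ht
  have := (GaussianFourier.integrable_cexp_neg_mul_sq_norm_add (V := EuclideanSpace ℝ (Fin N))
    hb 0 0).norm
  refine this.congr (Filter.Eventually.of_forall fun ξ => ?_)
  simp only [zero_mul, add_zero, Complex.norm_exp]
  congr 1
  rw [← Complex.ofReal_neg, ← Complex.ofReal_pow, ← Complex.ofReal_mul, Complex.ofReal_re]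
  ring

/-- The Fourier transform of the complex measure `p dμ`. -/
def measFourier (μ : Measure (EuclideanSpace ℝ (Fin N))) (p : EuclideanSpace ℝ (Fin N) → ℂ)
    (ξ : EuclideanSpace ℝ (Fin N)) : ℂ := ∫ x, p x * char2pi x ξ ∂μ

/-- The Gaussian energy of `p dμ`, on the Fourier side and in the space variables. -/
lemma lintegral_gaussian_mul_measFourier_le {μ : Measure (EuclideanSpace ℝ (Fin N))}
    [IsFiniteMeasure μ] {p : EuclideanSpace ℝ (Fin N) → ℂ} (hp : Integrable p μ) {t : ℝ}
    (ht : 0 < t) :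
    ∫⁻ ξ, ENNReal.ofReal (Real.exp (-Real.pi * t * ‖ξ‖ ^ 2)) * ‖measFourier μ p ξ‖ₑ ^ 2 ≤
      ∫⁻ x, ∫⁻ y, ‖p x‖ₑ * ‖p y‖ₑ *
        ENNReal.ofReal (t ^ (-(N : ℝ) / 2) * Real.exp (-Real.pi * dist y x ^ 2 / t)) ∂μ ∂μ := by
  set G : EuclideanSpace ℝ (Fin N) → ℝ := fun ξ => Real.exp (-Real.pi * t * ‖ξ‖ ^ 2) with hG
  -- Fubini for Φ(ξ, (x, y)): integrating over (x, y) first gives the Gaussian times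
  -- |`measFourier`|², integrating over ξ first gives the Gaussian in x - y. Integrability is that
  -- of a product, since characters have modulus one.
  set Φ : EuclideanSpace ℝ (Fin N) × (EuclideanSpace ℝ (Fin N) × EuclideanSpace ℝ (Fin N)) → ℂ :=
    fun z => (G z.1 : ℂ) * ((p z.2.1 * (starRingEnd ℂ) (p z.2.2)) * char2pi (z.2.1 - z.2.2) z.1)
    with hΦ
  have hpc : Integrable (fun x => (starRingEnd ℂ) (p x)) μ := by
    refine hp.congr' (Complex.continuous_conj.comp_aestronglyMeasurable hp.1) ?_
    exact Filter.Eventually.of_forall fun x => (RCLike.norm_conj _).symm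
  have hpp : Integrable (fun z : EuclideanSpace ℝ (Fin N) × EuclideanSpace ℝ (Fin N) =>
      p z.1 * (starRingEnd ℂ) (p z.2)) (μ.prod μ) := hp.mul_prod hpc
  have hGc : Integrable (fun ξ => (G ξ : ℂ)) := (integrable_gaussian ht).ofReal
  have hchar : Measurable fun z : EuclideanSpace ℝ (Fin N) ×
      (EuclideanSpace ℝ (Fin N) × EuclideanSpace ℝ (Fin N)) => char2pi (z.2.1 - z.2.2) z.1 :=
    measurable_char2pi (by fun_prop) (by fun_prop)
  have hΦi : Integrable Φ (volume.prod (μ.prod μ)) := by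
    have h0 := hGc.mul_prod hpp
    refine h0.congr' ?_ (Filter.Eventually.of_forall fun z => ?_)
    · have := h0.1.mul hchar.aestronglyMeasurable
      refine this.congr (Filter.Eventually.of_forall fun z => ?_)
      simp only [hΦ, Pi.mul_apply]
      ring
    · simp only [hΦ, norm_mul, norm_char2pi, mul_one]
  have hin : ∀ ξ, ∫ z, Φ (ξ, z) ∂(μ.prod μ) = ((G ξ * ‖measFourier μ p ξ‖ ^ 2 : ℝ) : ℂ) := by
    intro ξ
    simp only [hΦ]
    rw [integral_const_mul]
    have h1 : ∀ z : EuclideanSpace ℝ (Fin N) × EuclideanSpace ℝ (Fin N),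
        p z.1 * (starRingEnd ℂ) (p z.2) * char2pi (z.1 - z.2) ξ =
        (p z.1 * char2pi z.1 ξ) * (starRingEnd ℂ) (p z.2 * char2pi z.2 ξ) := by
      intro z
      rw [← char2pi_mul_conj, map_mul]
      ring
    simp_rw [h1]
    rw [integral_prod_mul (fun x => p x * char2pi x ξ)
      (fun y => (starRingEnd ℂ) (p y * char2pi y ξ)), integral_conj]
    change (G ξ : ℂ) * (measFourier μ p ξ * (starRingEnd ℂ) (measFourier μ p ξ)) = _
    rw [Complex.mul_conj, Complex.normSq_eq_norm_sq]
    push_cast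
    ring
  have hout : ∀ z : EuclideanSpace ℝ (Fin N) × EuclideanSpace ℝ (Fin N), ∫ ξ, Φ (ξ, z) =
      p z.1 * (starRingEnd ℂ) (p z.2) *
        ((t ^ (-(N : ℝ) / 2) * Real.exp (-Real.pi * ‖z.1 - z.2‖ ^ 2 / t) : ℝ) : ℂ) := by
    intro z
    rw [← integral_gaussian_mul_char2pi ht, ← integral_const_mul]
    refine integral_congr_ae (Filter.Eventually.of_forall fun ξ => ?_)
    simp only [hΦ, hG]
    ring
  have hswap : ∫ ξ, (G ξ * ‖measFourier μ p ξ‖ ^ 2 : ℝ) = ‖∫ z, p z.1 * (starRingEnd ℂ) (p z.2) *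
        ((t ^ (-(N : ℝ) / 2) * Real.exp (-Real.pi * ‖z.1 - z.2‖ ^ 2 / t) : ℝ) : ℂ)
        ∂(μ.prod μ)‖ := by
    have h1 := integral_integral_swap (f := fun ξ z => Φ (ξ, z)) hΦi
    simp_rw [hin, hout] at h1
    rw [← h1, integral_complex_ofReal, Complex.norm_real, Real.norm_of_nonneg]
    exact integral_nonneg fun ξ => by positivity
  have hint : Integrable fun ξ => (G ξ * ‖measFourier μ p ξ‖ ^ 2 : ℝ) := by
    have := hΦi.integral_prod_left
    simp_rw [hin] at this
    exact this.re
  have hL : ∫⁻ ξ, ENNReal.ofReal (G ξ) * ‖measFourier μ p ξ‖ₑ ^ 2 =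
      ENNReal.ofReal (∫ ξ, (G ξ * ‖measFourier μ p ξ‖ ^ 2 : ℝ)) := by
    rw [ofReal_integral_eq_lintegral_ofReal hint (Filter.Eventually.of_forall fun ξ => by positivity)]
    refine lintegral_congr fun ξ => ?_
    rw [ENNReal.ofReal_mul (by positivity), ENNReal.ofReal_pow (norm_nonneg _), ofReal_norm]
  rw [hL, hswap, ofReal_norm]
  refine (enorm_integral_le_lintegral_enorm _).trans ?_
  rw [lintegral_prod]
  · refine lintegral_mono fun x => lintegral_mono fun y => le_of_eq ?_
    simp only [enorm_mul]
    rw [RCLike.enorm_conj, dist_comm, dist_eq_norm, ← ofReal_norm (( _ : ℝ) : ℂ),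
      Complex.norm_real, Real.norm_of_nonneg (by positivity)]
  · refine AEMeasurable.enorm ?_
    refine hpp.1.aemeasurable.mul (Measurable.aemeasurable ?_)
    fun_prop

lemma ENNReal_mul_le_sq_add_sq (a b : ℝ≥0∞) : a * b ≤ a ^ 2 + b ^ 2 := by
  rcases le_total a b with h | h
  · calc a * b ≤ b * b := by gcongr
      _ = b ^ 2 := (sq b).symm
      _ ≤ _ := le_add_self
  · calc a * b ≤ a * a := by gcongr
      _ = a ^ 2 := (sq a).symm
      _ ≤ _ := le_self_add

/-- Schur's test: |p(x)||p(y)| ≤ |p(x)|² + |p(y)|², and the kernel is symmetric with integral in y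
of order A t^(s/2) t^(-N/2). The two symmetric terms give the factor 2. -/
lemma lintegral_gaussian_mul_measFourier_le' {μ : Measure (EuclideanSpace ℝ (Fin N))}
    [IsFiniteMeasure μ] {A s : ℝ} (hA : 0 ≤ A)
    (hμ : ∀ᵐ x ∂μ, ∀ r : ℝ, 0 < r → μ (Metric.ball x r) ≤ ENNReal.ofReal (A * r ^ s))
    {p : EuclideanSpace ℝ (Fin N) → ℂ} (hp : Integrable p μ) {t : ℝ} (ht : 0 < t) :
    ∫⁻ ξ, ENNReal.ofReal (Real.exp (-Real.pi * t * ‖ξ‖ ^ 2)) * ‖measFourier μ p ξ‖ₑ ^ 2 ≤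
      ENNReal.ofReal (2 * gaussConst s * A * t ^ ((s - N) / 2)) * ∫⁻ x, ‖p x‖ₑ ^ 2 ∂μ := by
  refine (lintegral_gaussian_mul_measFourier_le hp ht).trans ?_
  set g : EuclideanSpace ℝ (Fin N) → EuclideanSpace ℝ (Fin N) → ℝ≥0∞ := fun x y =>
    ENNReal.ofReal (t ^ (-(N : ℝ) / 2) * Real.exp (-Real.pi * dist y x ^ 2 / t)) with hg
  have hgm : Measurable (Function.uncurry g) := by
    simp only [hg, Function.uncurry_def]
    fun_prop
  have hgs : ∀ x y, g x y = g y x := fun x y => by simp only [hg, dist_comm]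
  have hga : ∀ᵐ x ∂μ, ∫⁻ y, g x y ∂μ ≤
      ENNReal.ofReal (gaussConst s * A * t ^ ((s - N) / 2)) := by
    filter_upwards [hμ] with x hx
    have h1 := lintegral_gaussian_le hA hx ht
    simp only [hg]
    simp_rw [ENNReal.ofReal_mul (show 0 ≤ t ^ (-(N : ℝ) / 2) by positivity)]
    rw [lintegral_const_mul _ (by fun_prop)]
    calc _ ≤ ENNReal.ofReal (t ^ (-(N : ℝ) / 2)) *
          ENNReal.ofReal (gaussConst s * A * t ^ (s / 2)) := by gcongr
      _ = _ := by
        rw [← ENNReal.ofReal_mul (by positivity)]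
        congr 1
        rw [show (s - N) / 2 = -(N : ℝ) / 2 + s / 2 by ring, Real.rpow_add ht]
        ring
  have hpm : AEMeasurable (fun x => ‖p x‖ₑ ^ 2) μ := hp.1.aemeasurable.enorm.pow_const 2
  have hm1 : AEMeasurable (fun z : EuclideanSpace ℝ (Fin N) × EuclideanSpace ℝ (Fin N) =>
      ‖p z.1‖ₑ ^ 2 * g z.1 z.2) (μ.prod μ) := hpm.comp_fst.mul hgm.aemeasurable
  have hm2 : AEMeasurable (fun z : EuclideanSpace ℝ (Fin N) × EuclideanSpace ℝ (Fin N) =>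
      ‖p z.2‖ₑ ^ 2 * g z.1 z.2) (μ.prod μ) := hpm.comp_snd.mul hgm.aemeasurable
  have hone : ∫⁻ x, ∫⁻ y, ‖p x‖ₑ ^ 2 * g x y ∂μ ∂μ ≤
      ENNReal.ofReal (gaussConst s * A * t ^ ((s - N) / 2)) * ∫⁻ x, ‖p x‖ₑ ^ 2 ∂μ := by
    rw [← lintegral_const_mul'' _ hpm]
    refine lintegral_mono_ae ?_
    filter_upwards [hga] with x hx
    rw [lintegral_const_mul _ (hgm.of_uncurry_left), mul_comm]
    gcongr
  calc _ ≤ ∫⁻ x, ∫⁻ y, (‖p x‖ₑ ^ 2 * g x y + ‖p y‖ₑ ^ 2 * g x y) ∂μ ∂μ := by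
        refine lintegral_mono fun x => lintegral_mono fun y => ?_
        rw [← add_mul]
        gcongr
        exact ENNReal_mul_le_sq_add_sq _ _
    _ = ∫⁻ z, ‖p z.1‖ₑ ^ 2 * g z.1 z.2 + ‖p z.2‖ₑ ^ 2 * g z.1 z.2 ∂(μ.prod μ) :=
        (lintegral_prod _ (hm1.add hm2)).symm
    _ = ∫⁻ x, ∫⁻ y, ‖p x‖ₑ ^ 2 * g x y ∂μ ∂μ + ∫⁻ y, ∫⁻ x, ‖p y‖ₑ ^ 2 * g x y ∂μ ∂μ := by
        rw [lintegral_add_left' hm1, lintegral_prod _ hm1, lintegral_prod_symm _ hm2]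
    _ = ∫⁻ x, ∫⁻ y, ‖p x‖ₑ ^ 2 * g x y ∂μ ∂μ + ∫⁻ x, ∫⁻ y, ‖p x‖ₑ ^ 2 * g x y ∂μ ∂μ := by
        congr 1
        refine lintegral_congr fun y => lintegral_congr fun x => ?_
        rw [hgs]
    _ ≤ _ := by
        refine (add_le_add hone hone).trans (le_of_eq ?_)
        have h0 := gaussConst_nonneg s
        rw [← add_mul, ← ENNReal.ofReal_add (by positivity) (by positivity)]
        congr 2
        ring

end Energy

end SingularBS

namespace SingularBS

/-! ### Integral operators with square integrable kernels -/

section KernelOperator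

variable {α β : Type*} [MeasurableSpace α] [MeasurableSpace β] {μ : Measure α} {ρ : Measure β}

lemma sq_lintegral_mul_le {f g : β → ℝ≥0∞} (hf : AEMeasurable f ρ) (hg : AEMeasurable g ρ) :
    (∫⁻ y, f y * g y ∂ρ) ^ 2 ≤ (∫⁻ y, f y ^ 2 ∂ρ) * ∫⁻ y, g y ^ 2 ∂ρ := by
  have h := ENNReal.lintegral_mul_le_Lp_mul_Lq ρ Real.HolderConjugate.two_two hf hg
  have hr : ∀ a : ℝ≥0∞, (a ^ (1 / 2 : ℝ)) ^ 2 = a := fun a => by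
    rw [← ENNReal.rpow_natCast, ← ENNReal.rpow_mul]
    norm_num
  simp only [ENNReal.rpow_two] at h
  calc _ ≤ _ := pow_le_pow_left' h 2
    _ = _ := by rw [mul_pow, hr, hr]

lemma eLpNorm_two_sq (f : α → ℂ) : eLpNorm f 2 μ ^ 2 = ∫⁻ x, ‖f x‖ₑ ^ 2 ∂μ := by
  have := eLpNorm_nnreal_pow_eq_lintegral (f := f) (μ := μ) (p := 2) two_ne_zero
  simpa [ENNReal.rpow_two] using this

lemma memLp_two_iff_lintegral {f : α → ℂ} (hf : AEStronglyMeasurable f μ) :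
    MemLp f 2 μ ↔ ∫⁻ x, ‖f x‖ₑ ^ 2 ∂μ < ∞ := by
  rw [← eLpNorm_two_sq, MemLp, and_iff_right hf, ENNReal.pow_lt_top_iff]
  simp

lemma ofReal_norm_toLp_sq {f : α → ℂ} (hf : MemLp f 2 μ) :
    ENNReal.ofReal (‖hf.toLp f‖ ^ 2) = ∫⁻ x, ‖f x‖ₑ ^ 2 ∂μ := by
  rw [ENNReal.ofReal_pow (norm_nonneg _), Lp.norm_toLp, ENNReal.ofReal_toReal hf.2.ne,
    eLpNorm_two_sq]

lemma lintegral_enorm_sq_Lp (h : Lp ℂ 2 μ) :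
    ∫⁻ x, ‖h x‖ₑ ^ 2 ∂μ = ENNReal.ofReal (‖h‖ ^ 2) := by
  rw [← ofReal_norm_toLp_sq (Lp.memLp h), Lp.toLp_coeFn]

lemma enorm_integral_mul_sq_le {k h : β → ℂ} (hk : AEStronglyMeasurable k ρ)
    (hh : AEStronglyMeasurable h ρ) :
    ‖∫ y, k y * h y ∂ρ‖ₑ ^ 2 ≤ (∫⁻ y, ‖k y‖ₑ ^ 2 ∂ρ) * ∫⁻ y, ‖h y‖ₑ ^ 2 ∂ρ := by
  refine le_trans ?_ (sq_lintegral_mul_le hk.enorm hh.enorm)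
  refine pow_le_pow_left' ((enorm_integral_le_lintegral_enorm _).trans (le_of_eq ?_)) 2
  exact lintegral_congr fun y => enorm_mul _ _

lemma memLp_kernel_section {K : α × β → ℂ} (hK : Measurable K) {x : α}
    (hx : ∫⁻ y, ‖K (x, y)‖ₑ ^ 2 ∂ρ < ∞) : MemLp (fun y => K (x, y)) 2 ρ :=
  (memLp_two_iff_lintegral (hK.comp measurable_prodMk_left).aestronglyMeasurable).2 hx

variable [SFinite ρ]

lemma measurable_kernel_sq {K : α × β → ℂ} (hK : Measurable K) :
    Measurable fun x => ∫⁻ y, ‖K (x, y)‖ₑ ^ 2 ∂ρ :=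
  (hK.enorm.pow_const 2).lintegral_prod_right'

lemma aestronglyMeasurable_kernel {K : α × β → ℂ} (hK : Measurable K) (h : Lp ℂ 2 ρ) :
    AEStronglyMeasurable (fun x => ∫ y, K (x, y) * h y ∂ρ) μ := by
  have hm : StronglyMeasurable fun z : α × β => K z * h z.2 :=
    hK.stronglyMeasurable.mul ((Lp.stronglyMeasurable h).comp_measurable measurable_snd)
  exact hm.integral_prod_right'.aestronglyMeasurable

lemma lintegral_kernel_le {K : α × β → ℂ} (hK : Measurable K) (h : Lp ℂ 2 ρ) :
    ∫⁻ x, ‖∫ y, K (x, y) * h y ∂ρ‖ₑ ^ 2 ∂μ ≤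
      (∫⁻ x, ∫⁻ y, ‖K (x, y)‖ₑ ^ 2 ∂ρ ∂μ) * ENNReal.ofReal (‖h‖ ^ 2) := by
  rw [← lintegral_mul_const _ (measurable_kernel_sq hK)]
  refine lintegral_mono fun x => ?_
  rw [← lintegral_enorm_sq_Lp]
  exact enorm_integral_mul_sq_le (hK.comp measurable_prodMk_left).aestronglyMeasurable
    (Lp.aestronglyMeasurable h)

lemma memLp_kernel {K : α × β → ℂ} (hK : Measurable K)
    (hK2 : ∫⁻ x, ∫⁻ y, ‖K (x, y)‖ₑ ^ 2 ∂ρ ∂μ < ∞) (h : Lp ℂ 2 ρ) :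
    MemLp (fun x => ∫ y, K (x, y) * h y ∂ρ) 2 μ :=
  (memLp_two_iff_lintegral (aestronglyMeasurable_kernel hK h)).2
    ((lintegral_kernel_le hK h).trans_lt (ENNReal.mul_lt_top hK2 ENNReal.ofReal_lt_top))

/-- The integral operator with a square integrable kernel. -/
def kernelOp (μ : Measure α) (ρ : Measure β) [SFinite ρ] (K : α × β → ℂ) (hK : Measurable K)
    (hK2 : ∫⁻ x, ∫⁻ y, ‖K (x, y)‖ₑ ^ 2 ∂ρ ∂μ < ∞) : Lp ℂ 2 ρ →L[ℂ] Lp ℂ 2 μ :=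
  LinearMap.mkContinuous
    { toFun := fun h => (memLp_kernel hK hK2 h).toLp _
      map_add' := fun g h => by
        rw [← MemLp.toLp_add]
        refine MemLp.toLp_congr _ _ ?_
        filter_upwards [ae_lt_top (measurable_kernel_sq hK) hK2.ne] with x hx
        have hs := memLp_kernel_section hK hx
        have hg : Integrable (fun y => K (x, y) * g y) ρ := hs.integrable_mul (Lp.memLp g)
        have hh : Integrable (fun y => K (x, y) * h y) ρ := hs.integrable_mul (Lp.memLp h)
        rw [Pi.add_apply, ← integral_add hg hh]
        refine integral_congr_ae ?_
        filter_upwards [Lp.coeFn_add g h] with y hy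
        rw [hy, Pi.add_apply, mul_add]
      map_smul' := fun c h => by
        rw [RingHom.id_apply, ← MemLp.toLp_const_smul]
        refine MemLp.toLp_congr _ _ (Filter.Eventually.of_forall fun x => ?_)
        rw [Pi.smul_apply, smul_eq_mul, ← integral_const_mul]
        refine integral_congr_ae ?_
        filter_upwards [Lp.coeFn_smul c h] with y hy
        rw [hy, Pi.smul_apply, smul_eq_mul]
        ring }
    (√(∫⁻ x, ∫⁻ y, ‖K (x, y)‖ₑ ^ 2 ∂ρ ∂μ).toReal) (fun h => by
      refine (sq_le_sq₀ (norm_nonneg _) (by positivity)).1 ?_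
      rw [mul_pow, Real.sq_sqrt ENNReal.toReal_nonneg,
        ← ENNReal.ofReal_le_ofReal_iff (by positivity), ENNReal.ofReal_mul ENNReal.toReal_nonneg,
        ENNReal.ofReal_toReal hK2.ne]
      exact (ofReal_norm_toLp_sq (memLp_kernel hK hK2 h)).trans_le (lintegral_kernel_le hK h))

lemma kernelOp_apply (K : α × β → ℂ) (hK : Measurable K)
    (hK2 : ∫⁻ x, ∫⁻ y, ‖K (x, y)‖ₑ ^ 2 ∂ρ ∂μ < ∞) (h : Lp ℂ 2 ρ) :
    kernelOp μ ρ K hK hK2 h = (memLp_kernel hK hK2 h).toLp _ := rfl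

/-- For almost every x, the value at x of the image of e_i is the inner product of J e_i with the
conjugate of K(x, ·), that is, of e_i with a vector of norm at most ‖J‖ ‖K(x, ·)‖. Bessel's
inequality bounds the sum over i, and integration in x concludes. -/
lemma hsBound_kernelOp_comp {E : Type*} [NormedAddCommGroup E] [InnerProductSpace ℂ E]
    [CompleteSpace E] (K : α × β → ℂ) (hK : Measurable K)
    (hK2 : ∫⁻ x, ∫⁻ y, ‖K (x, y)‖ₑ ^ 2 ∂ρ ∂μ < ∞) (J : E →L[ℂ] Lp ℂ 2 ρ) {c M : ℝ}
    (hJ : ‖J‖ ^ 2 ≤ c) (hM : 0 ≤ M)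
    (hKM : ∫⁻ x, ∫⁻ y, ‖K (x, y)‖ₑ ^ 2 ∂ρ ∂μ ≤ ENNReal.ofReal M) :
    HSBound (kernelOp μ ρ K hK hK2 ∘L J) (c * M) := by
  intro ι _ e he
  have hc : 0 ≤ c := (sq_nonneg _).trans hJ
  have hx : ∀ᵐ x ∂μ, ∑ i, ‖∫ y, K (x, y) * J (e i) y ∂ρ‖ₑ ^ 2 ≤
      ENNReal.ofReal c * ∫⁻ y, ‖K (x, y)‖ₑ ^ 2 ∂ρ := by
    filter_upwards [ae_lt_top (measurable_kernel_sq hK) hK2.ne] with x hx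
    have hs := memLp_kernel_section hK hx
    set k : Lp ℂ 2 ρ := hs.star.toLp _ with hk
    have hin : ∀ h : Lp ℂ 2 ρ, ∫ y, K (x, y) * h y ∂ρ = inner ℂ k h := by
      intro h
      rw [L2.inner_def]
      refine integral_congr_ae ?_
      filter_upwards [hs.star.coeFn_toLp] with y hy
      rw [hk, hy]
      simp [mul_comm]
    have hkn : ENNReal.ofReal (‖k‖ ^ 2) = ∫⁻ y, ‖K (x, y)‖ₑ ^ 2 ∂ρ := by
      rw [hk, ofReal_norm_toLp_sq]
      refine lintegral_congr fun y => ?_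
      rw [Pi.star_apply]
      exact congrArg (· ^ 2) (RCLike.enorm_conj _)
    have hb := he.sum_inner_products_le (ContinuousLinearMap.adjoint J k) (s := Finset.univ)
    have hadj : ‖ContinuousLinearMap.adjoint J k‖ ^ 2 ≤ c * ‖k‖ ^ 2 := by
      have h1 := (ContinuousLinearMap.adjoint J).le_opNorm k
      rw [LinearIsometryEquiv.norm_map] at h1
      calc _ ≤ (‖J‖ * ‖k‖) ^ 2 := by gcongr
        _ = ‖J‖ ^ 2 * ‖k‖ ^ 2 := mul_pow _ _ _
        _ ≤ _ := by gcongr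
    rw [← hkn, ← ENNReal.ofReal_mul hc]
    have hterm : ∀ i, ‖∫ y, K (x, y) * J (e i) y ∂ρ‖ₑ ^ 2 =
        ENNReal.ofReal (‖inner ℂ (e i) (ContinuousLinearMap.adjoint J k)‖ ^ 2) := by
      intro i
      rw [hin, ← ContinuousLinearMap.adjoint_inner_left, norm_inner_symm,
        ENNReal.ofReal_pow (norm_nonneg _), ofReal_norm]
    rw [Finset.sum_congr rfl fun i _ => hterm i, ← ENNReal.ofReal_sum_of_nonneg
      fun i _ => by positivity]
    exact ENNReal.ofReal_le_ofReal (hb.trans hadj)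
  rw [← ENNReal.ofReal_le_ofReal_iff (by positivity),
    ENNReal.ofReal_sum_of_nonneg fun i _ => by positivity]
  have hterm : ∀ i, ENNReal.ofReal (‖(kernelOp μ ρ K hK hK2 ∘L J) (e i)‖ ^ 2) =
      ∫⁻ x, ‖∫ y, K (x, y) * J (e i) y ∂ρ‖ₑ ^ 2 ∂μ := fun i => by
    rw [ContinuousLinearMap.comp_apply, kernelOp_apply, ofReal_norm_toLp_sq]
  rw [Finset.sum_congr rfl fun i _ => hterm i, ← lintegral_finsetSum' _ fun i _ =>
    (aestronglyMeasurable_kernel hK _).enorm.pow_const 2]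
  calc _ ≤ ∫⁻ x, ENNReal.ofReal c * ∫⁻ y, ‖K (x, y)‖ₑ ^ 2 ∂ρ ∂μ := lintegral_mono_ae hx
    _ = ENNReal.ofReal c * ∫⁻ x, ∫⁻ y, ‖K (x, y)‖ₑ ^ 2 ∂ρ ∂μ :=
      lintegral_const_mul _ (measurable_kernel_sq hK)
    _ ≤ _ := by
      rw [ENNReal.ofReal_mul hc]
      gcongr

end KernelOperator

end SingularBS

namespace SingularBS

variable {N : ℕ}

/-! ### Heat representation of functions through frequency and time -/

section Heat

lemma lintegral_Ioo_rpow {a T : ℝ} (ha : 0 < a) (hT : 0 ≤ T) :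
    ∫⁻ t in Ioo 0 T, ENNReal.ofReal (t ^ (a - 1)) = ENNReal.ofReal (T ^ a / a) := by
  have hi : IntegrableOn (fun t : ℝ => t ^ (a - 1)) (Ioc 0 T) := by
    have := intervalIntegral.intervalIntegrable_rpow' (a := 0) (b := T) (r := a - 1) (by linarith)
    rwa [intervalIntegrable_iff_integrableOn_Ioc_of_le hT] at this
  have hnn : 0 ≤ᵐ[volume.restrict (Ioc 0 T)] fun t : ℝ => t ^ (a - 1) := by
    filter_upwards [ae_restrict_mem measurableSet_Ioc] with t ht
    exact Real.rpow_nonneg ht.1.le _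
  rw [setLIntegral_congr Ioo_ae_eq_Ioc, ← ofReal_integral_eq_lintegral_ofReal hi hnn,
    ← intervalIntegral.integral_of_le hT, integral_rpow (Or.inl (by linarith))]
  congr 1
  rw [sub_add_cancel, Real.zero_rpow ha.ne', sub_zero]

lemma lintegral_Ici_rpow {a T : ℝ} (ha : 0 < a) (hT : 0 < T) :
    ∫⁻ t in Ici T, ENNReal.ofReal (t ^ (-a - 1)) = ENNReal.ofReal (T ^ (-a) / a) := by
  have hi : IntegrableOn (fun t : ℝ => t ^ (-a - 1)) (Ioi T) :=
    integrableOn_Ioi_rpow_of_lt (by linarith) hT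
  have hnn : 0 ≤ᵐ[volume.restrict (Ioi T)] fun t : ℝ => t ^ (-a - 1) := by
    filter_upwards [ae_restrict_mem measurableSet_Ioi] with t ht
    exact Real.rpow_nonneg (hT.trans ht).le _
  rw [setLIntegral_congr Ioi_ae_eq_Ici.symm, ← ofReal_integral_eq_lintegral_ofReal hi hnn,
    integral_Ioi_rpow_of_lt (by linarith) hT]
  congr 1
  rw [sub_add_cancel, div_neg, neg_div, neg_neg]

lemma lintegral_rpow_mul_exp {l r : ℝ} (hl : 0 < l) (hr : 0 < r) :
    ∫⁻ t in Ioi 0, ENNReal.ofReal (t ^ (l - 1) * Real.exp (-(r * t))) =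
      ENNReal.ofReal ((1 / r) ^ l * Real.Gamma l) := by
  have hv := Real.integral_rpow_mul_exp_neg_mul_Ioi hl hr
  have hi : IntegrableOn (fun t : ℝ => t ^ (l - 1) * Real.exp (-(r * t))) (Ioi 0) := by
    -- A non-integrable function has integral 0 by convention, whereas the Gamma integral is
    -- positive.
    by_contra hcon
    rw [integral_undef hcon] at hv
    have h1 := Real.Gamma_pos_of_pos hl
    have h2 : 0 < (1 / r) ^ l := by positivity
    exact (mul_pos h2 h1).ne hv
  rw [← ofReal_integral_eq_lintegral_ofReal hi, hv]
  filter_upwards [ae_restrict_mem measurableSet_Ioi] with t ht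
  have : (0 : ℝ) < t := ht
  change (0 : ℝ) ≤ _
  positivity

lemma lintegral_gaussian {t : ℝ} (ht : 0 < t) :
    ∫⁻ ξ : EuclideanSpace ℝ (Fin N), ENNReal.ofReal (Real.exp (-Real.pi * t * ‖ξ‖ ^ 2)) =
      ENNReal.ofReal (t ^ (-(N : ℝ) / 2)) := by
  rw [← ofReal_integral_eq_lintegral_ofReal (integrable_gaussian ht)
    (Filter.Eventually.of_forall fun ξ => by positivity)]
  congr 1
  have h := integral_gaussian_mul_char2pi ht (0 : EuclideanSpace ℝ (Fin N))
  have h1 : ∀ ξ : EuclideanSpace ℝ (Fin N), char2pi 0 ξ = 1 := fun ξ => by simp [char2pi]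
  simp_rw [h1, mul_one] at h
  rw [integral_complex_ofReal] at h
  have := Complex.ofReal_injective h
  rw [this]
  simp

/-- The space of frequencies `ξ` and heat times `t > 0`. -/
def heatMeasure (N : ℕ) : Measure (EuclideanSpace ℝ (Fin N) × ℝ) :=
  volume.prod (volume.restrict (Ioi 0))

instance : SFinite (heatMeasure N) := by unfold heatMeasure; infer_instance

lemma ae_heatMeasure_pos : ∀ᵐ z ∂heatMeasure N, 0 < z.2 := by
  have h : ∀ᵐ t : ℝ ∂(volume.restrict (Ioi 0)), 0 < t := ae_restrict_mem measurableSet_Ioi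
  exact Measure.quasiMeasurePreserving_snd.ae h

/-- The modulus of the kernel of `(-Δ)^{-l/2}` in the heat representation. -/
def heatMod (l : ℝ) (z : EuclideanSpace ℝ (Fin N) × ℝ) : ℝ :=
  z.2 ^ ((l - 1) / 2) * Real.exp (-Real.pi * z.2 * ‖z.1‖ ^ 2 / 2)

@[fun_prop]
lemma measurable_heatMod (l : ℝ) : Measurable (heatMod l (N := N)) := by
  unfold heatMod
  fun_prop

lemma heatMod_sq (l : ℝ) {z : EuclideanSpace ℝ (Fin N) × ℝ} (hz : 0 < z.2) :
    heatMod l z ^ 2 = z.2 ^ (l - 1) * Real.exp (-Real.pi * z.2 * ‖z.1‖ ^ 2) := by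
  unfold heatMod
  rw [mul_pow, ← Real.rpow_natCast, ← Real.rpow_mul hz.le, ← Real.exp_nat_mul]
  congr 2
  · push_cast
    ring
  · push_cast
    ring

lemma heatMod_nonneg (l : ℝ) {z : EuclideanSpace ℝ (Fin N) × ℝ} (hz : 0 < z.2) :
    0 ≤ heatMod l z := by
  unfold heatMod
  positivity

/-- The lift to frequencies and heat times of a function with Fourier transform `g`. -/
def heatLift (l : ℝ) (g : EuclideanSpace ℝ (Fin N) → ℂ) (z : EuclideanSpace ℝ (Fin N) × ℝ) : ℂ :=
  ((heatMod l z * ((Real.pi * ‖z.1‖ ^ 2) ^ l / Real.Gamma l) : ℝ) : ℂ) * g z.1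

lemma measurable_heatLift (l : ℝ) {g : EuclideanSpace ℝ (Fin N) → ℂ} (hg : Measurable g) :
    Measurable (heatLift l g) := by
  unfold heatLift
  fun_prop

/-- The Gamma integral with rate π|ξ|². Its reciprocal is the normalising factor in `heatLift`. -/
lemma lintegral_heatMod_sq {l : ℝ} (hl : 0 < l) {ξ : EuclideanSpace ℝ (Fin N)} (hξ : ξ ≠ 0) :
    ∫⁻ t in Ioi 0, ENNReal.ofReal (heatMod l (ξ, t) ^ 2) =
      ENNReal.ofReal (Real.Gamma l / (Real.pi * ‖ξ‖ ^ 2) ^ l) := by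
  have hr : 0 < Real.pi * ‖ξ‖ ^ 2 := by
    have := norm_pos_iff.2 hξ
    have := Real.pi_pos
    positivity
  have h := lintegral_rpow_mul_exp hl hr
  rw [one_div, Real.inv_rpow hr.le, inv_mul_eq_div] at h
  rw [← h]
  refine setLIntegral_congr_fun measurableSet_Ioi fun t ht => ?_
  rw [heatMod_sq l (z := (ξ, t)) ht]
  simp only
  congr 3
  ring

lemma ae_ne_zero [Nontrivial (EuclideanSpace ℝ (Fin N))] :
    ∀ᵐ ξ : EuclideanSpace ℝ (Fin N), ξ ≠ 0 := by
  rw [ae_iff]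
  simp

/-- The squared normalising factor times its reciprocal, from the time integral, leaves (π|ξ|²)^l /
Γ(l). So up to a constant the lift is isometric for the homogeneous Sobolev norm on the Fourier
side. -/
lemma lintegral_heatLift_sq [Nontrivial (EuclideanSpace ℝ (Fin N))] {l : ℝ} (hl : 0 < l)
    {g : EuclideanSpace ℝ (Fin N) → ℂ} (hg : Measurable g) :
    ∫⁻ z, ‖heatLift l g z‖ₑ ^ 2 ∂heatMeasure N =
      ENNReal.ofReal (Real.pi ^ l / Real.Gamma l) *
        ∫⁻ ξ, ENNReal.ofReal (‖ξ‖ ^ (2 * l)) * ‖g ξ‖ₑ ^ 2 := by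
  have hπ := Real.pi_pos
  rw [heatMeasure, lintegral_prod _ ((measurable_heatLift l hg).enorm.pow_const 2).aemeasurable,
    ← lintegral_const_mul _ (by fun_prop)]
  refine lintegral_congr_ae ?_
  filter_upwards [ae_ne_zero] with ξ hξ
  have hn := norm_pos_iff.2 hξ
  have h1 : ∀ t : ℝ, ‖heatLift l g (ξ, t)‖ₑ ^ 2 = ENNReal.ofReal (heatMod l (ξ, t) ^ 2) *
      (ENNReal.ofReal (((Real.pi * ‖ξ‖ ^ 2) ^ l / Real.Gamma l) ^ 2) * ‖g ξ‖ₑ ^ 2) := by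
    intro t
    unfold heatLift
    rw [enorm_mul, mul_pow, ← ofReal_norm (( _ : ℝ) : ℂ), Complex.norm_real,
      ← ENNReal.ofReal_pow (norm_nonneg _), Real.norm_eq_abs, sq_abs, mul_pow,
      ENNReal.ofReal_mul (sq_nonneg _), mul_assoc]
  simp_rw [h1]
  rw [lintegral_mul_const _ (by fun_prop), lintegral_heatMod_sq hl hξ, ← mul_assoc, ← mul_assoc,
    ← ENNReal.ofReal_mul (by positivity), ← ENNReal.ofReal_mul (by positivity)]
  congr 2
  have h2 : (Real.pi * ‖ξ‖ ^ 2) ^ l = Real.pi ^ l * ‖ξ‖ ^ (2 * l) := by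
    rw [Real.mul_rpow hπ.le (by positivity), ← Real.rpow_natCast, ← Real.rpow_mul hn.le]
    norm_num
  rw [div_mul_eq_mul_div (Real.pi ^ l), ← h2]
  field_simp

lemma lintegral_heatMod_mul_heatLift_le [Nontrivial (EuclideanSpace ℝ (Fin N))] {l : ℝ}
    (hl : 0 < l) {g : EuclideanSpace ℝ (Fin N) → ℂ} (hg : Measurable g) :
    ∫⁻ z, ENNReal.ofReal (heatMod l z) * ‖heatLift l g z‖ₑ ∂heatMeasure N ≤ ∫⁻ ξ, ‖g ξ‖ₑ := by
  have hm : Measurable fun z => ENNReal.ofReal (heatMod l z) * ‖heatLift l g z‖ₑ :=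
    (by fun_prop : Measurable fun z => ENNReal.ofReal (heatMod l z)).mul
      (measurable_heatLift l hg).enorm
  rw [heatMeasure, lintegral_prod _ hm.aemeasurable]
  refine lintegral_mono_ae ?_
  filter_upwards [ae_ne_zero] with ξ hξ
  have h1 : ∀ t ∈ Ioi (0 : ℝ), ENNReal.ofReal (heatMod l (ξ, t)) * ‖heatLift l g (ξ, t)‖ₑ =
      ENNReal.ofReal (heatMod l (ξ, t) ^ 2) *
      (ENNReal.ofReal ((Real.pi * ‖ξ‖ ^ 2) ^ l / Real.Gamma l) * ‖g ξ‖ₑ) := by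
    intro t ht
    have h0 : 0 ≤ heatMod l (ξ, t) := heatMod_nonneg l ht
    unfold heatLift
    rw [enorm_mul, ← ofReal_norm (( _ : ℝ) : ℂ), Complex.norm_real,
      Real.norm_of_nonneg (by positivity), ENNReal.ofReal_mul h0, ENNReal.ofReal_pow h0]
    ring
  rw [setLIntegral_congr_fun measurableSet_Ioi h1, lintegral_mul_const _ (by fun_prop),
    lintegral_heatMod_sq hl hξ, ← mul_assoc, ← ENNReal.ofReal_mul (by positivity)]
  refine le_of_eq ?_
  rw [show Real.Gamma l / (Real.pi * ‖ξ‖ ^ 2) ^ l * ((Real.pi * ‖ξ‖ ^ 2) ^ l / Real.Gamma l) = 1 by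
    field_simp, ENNReal.ofReal_one, one_mul]

/-- The kernel of the heat representation. -/
def heatKernel (l : ℝ) (x : EuclideanSpace ℝ (Fin N)) (z : EuclideanSpace ℝ (Fin N) × ℝ) : ℂ :=
  (heatMod l z : ℂ) * char2pi x z.1

lemma measurable_heatKernel (l : ℝ) : Measurable
    (fun w : EuclideanSpace ℝ (Fin N) × (EuclideanSpace ℝ (Fin N) × ℝ) =>
      heatKernel l w.1 w.2) := by
  unfold heatKernel
  exact (Complex.measurable_ofReal.comp ((measurable_heatMod l).comp measurable_snd)).mul
    (measurable_char2pi measurable_fst (measurable_fst.comp measurable_snd))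

lemma norm_heatKernel (l : ℝ) (x : EuclideanSpace ℝ (Fin N))
    {z : EuclideanSpace ℝ (Fin N) × ℝ} (hz : 0 < z.2) : ‖heatKernel l x z‖ = heatMod l z := by
  unfold heatKernel
  rw [norm_mul, norm_char2pi, mul_one, Complex.norm_real, Real.norm_of_nonneg (heatMod_nonneg l hz)]

lemma integrable_heatKernel_mul_heatLift [Nontrivial (EuclideanSpace ℝ (Fin N))] {l : ℝ}
    (hl : 0 < l) {g : EuclideanSpace ℝ (Fin N) → ℂ} (hg : Measurable g) (hgi : Integrable g)
    (x : EuclideanSpace ℝ (Fin N)) :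
    Integrable (fun z => heatKernel l x z * heatLift l g z) (heatMeasure N) := by
  refine ⟨(((measurable_heatKernel l).comp measurable_prodMk_left).mul
    (measurable_heatLift l hg)).aestronglyMeasurable, ?_⟩
  refine lt_of_le_of_lt ?_ hgi.2
  refine le_trans (le_of_eq ?_) (lintegral_heatMod_mul_heatLift_le hl hg)
  refine lintegral_congr_ae ?_
  filter_upwards [ae_heatMeasure_pos] with z hz
  rw [enorm_mul, ← ofReal_norm (heatKernel l x z), norm_heatKernel l x hz]

/-- Integrating in time first, `heatMod`² cancels the normalising factor and the inverse Fourier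
integral of g remains. The identity holds at every x, not just almost everywhere, which matters
because μ may be singular to Lebesgue measure. -/
lemma integral_heatKernel_mul_heatLift [Nontrivial (EuclideanSpace ℝ (Fin N))] {l : ℝ}
    (hl : 0 < l) {g : EuclideanSpace ℝ (Fin N) → ℂ} (hg : Measurable g) (hgi : Integrable g)
    (x : EuclideanSpace ℝ (Fin N)) :
    ∫ z, heatKernel l x z * heatLift l g z ∂heatMeasure N = ∫ ξ, g ξ * char2pi x ξ := by
  have hI := integrable_heatKernel_mul_heatLift hl hg hgi x
  unfold heatMeasure at hI ⊢
  rw [integral_prod _ hI]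
  refine integral_congr_ae ?_
  filter_upwards [ae_ne_zero] with ξ hξ
  have h1 : ∀ t : ℝ, heatKernel l x (ξ, t) * heatLift l g (ξ, t) =
      ((heatMod l (ξ, t) ^ 2 : ℝ) : ℂ) *
        ((((Real.pi * ‖ξ‖ ^ 2) ^ l / Real.Gamma l : ℝ) : ℂ) * (g ξ * char2pi x ξ)) := by
    intro t
    unfold heatKernel heatLift
    push_cast
    ring
  simp_rw [h1]
  rw [integral_mul_const, integral_complex_ofReal, integral_eq_lintegral_of_nonneg_ae
    (Filter.Eventually.of_forall fun t => sq_nonneg _)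
    (by fun_prop : Measurable fun t => heatMod l (ξ, t) ^ 2).aestronglyMeasurable,
    lintegral_heatMod_sq hl hξ, ENNReal.toReal_ofReal (by positivity), ← mul_assoc,
    ← Complex.ofReal_mul]
  rw [show Real.Gamma l / (Real.pi * ‖ξ‖ ^ 2) ^ l * ((Real.pi * ‖ξ‖ ^ 2) ^ l / Real.Gamma l) = 1 by
    field_simp, Complex.ofReal_one, one_mul]

end Heat

end SingularBS

namespace SingularBS

variable {N : ℕ}

/-! ### Cutting the weighted kernel in time: far and near parts -/

section Cutoff

/-- The heat time at which the kernel with weight `r` is cut. -/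
def cutTime (τ γ r : ℝ) : ℝ := (τ ^ 2 / r ^ 2) ^ (2 / γ)

lemma cutTime_nonneg (τ γ r : ℝ) : 0 ≤ cutTime τ γ r := by
  unfold cutTime
  positivity

lemma measurable_cutTime (τ γ : ℝ) : Measurable (cutTime τ γ) := by
  unfold cutTime
  fun_prop

/-- The cut time is defined as the solution T of r² T^(γ/2) = τ². Only the inequality survives at r
= 0, where the left side vanishes. -/
lemma sq_mul_cutTime_rpow_le {τ γ : ℝ} (hγ : 0 < γ) (r : ℝ) :
    r ^ 2 * cutTime τ γ r ^ (γ / 2) ≤ τ ^ 2 := by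
  unfold cutTime
  rw [← Real.rpow_mul (by positivity), show 2 / γ * (γ / 2) = 1 by field_simp, Real.rpow_one]
  rcases eq_or_ne r 0 with rfl | hr
  · simp [sq_nonneg]
  · exact le_of_eq (by field_simp)

lemma sq_mul_cutTime_rpow_neg {τ γ a r : ℝ} (hτ : 0 < τ) (hr : 0 < r) :
    r ^ 2 * cutTime τ γ r ^ (-a) = τ ^ (-(4 * a / γ)) * r ^ (2 + 4 * a / γ) := by
  unfold cutTime
  rw [← div_pow, ← Real.rpow_natCast (τ / r), ← Real.rpow_mul (by positivity),
    ← Real.rpow_mul (by positivity), Real.div_rpow hτ.le hr.le, Real.rpow_add hr, Real.rpow_two,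
    show ((2 : ℕ) : ℝ) * (2 / γ * -a) = -(4 * a / γ) by push_cast; ring, Real.rpow_neg hr.le]
  field_simp

/-- The part of the weighted heat kernel with times beyond the cut. -/
def farKernel (l τ γ : ℝ) (f : EuclideanSpace ℝ (Fin N) → ℝ)
    (w : EuclideanSpace ℝ (Fin N) × (EuclideanSpace ℝ (Fin N) × ℝ)) : ℂ :=
  if cutTime τ γ (f w.1) ≤ w.2.2 then (f w.1 : ℂ) * heatKernel l w.1 w.2 else 0

/-- The part of the weighted heat kernel with times before the cut. -/
def nearKernel (l τ γ : ℝ) (f : EuclideanSpace ℝ (Fin N) → ℝ)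
    (w : EuclideanSpace ℝ (Fin N) × (EuclideanSpace ℝ (Fin N) × ℝ)) : ℂ :=
  if cutTime τ γ (f w.1) ≤ w.2.2 then 0 else (f w.1 : ℂ) * heatKernel l w.1 w.2

variable {f : EuclideanSpace ℝ (Fin N) → ℝ}

lemma measurableSet_cut (τ γ : ℝ) (hf : Measurable f) : MeasurableSet
    {w : EuclideanSpace ℝ (Fin N) × (EuclideanSpace ℝ (Fin N) × ℝ) |
      cutTime τ γ (f w.1) ≤ w.2.2} :=
  measurableSet_le ((measurable_cutTime τ γ).comp (hf.comp measurable_fst))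
    (measurable_snd.comp measurable_snd)

lemma measurable_farKernel (l τ γ : ℝ) (hf : Measurable f) : Measurable (farKernel l τ γ f) :=
  Measurable.ite (measurableSet_cut τ γ hf)
    ((Complex.measurable_ofReal.comp (hf.comp measurable_fst)).mul (measurable_heatKernel l))
    measurable_const

lemma measurable_nearKernel (l τ γ : ℝ) (hf : Measurable f) : Measurable (nearKernel l τ γ f) :=
  Measurable.ite (measurableSet_cut τ γ hf) measurable_const
    ((Complex.measurable_ofReal.comp (hf.comp measurable_fst)).mul (measurable_heatKernel l))

lemma farKernel_add_nearKernel (l τ γ : ℝ) (x : EuclideanSpace ℝ (Fin N))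
    (z : EuclideanSpace ℝ (Fin N) × ℝ) :
    farKernel l τ γ f (x, z) + nearKernel l τ γ f (x, z) = (f x : ℂ) * heatKernel l x z := by
  unfold farKernel nearKernel
  split_ifs <;> simp

lemma norm_nearKernel_le (l τ γ : ℝ) (x : EuclideanSpace ℝ (Fin N))
    (z : EuclideanSpace ℝ (Fin N) × ℝ) :
    ‖nearKernel l τ γ f (x, z)‖ ≤ ‖(f x : ℂ) * heatKernel l x z‖ := by
  unfold nearKernel
  split_ifs
  · rw [norm_zero]
    exact norm_nonneg _
  · exact le_rfl

/-- The Hilbert--Schmidt norm of the far part at a point. -/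
lemma lintegral_farKernel_sq_le {l τ γ a : ℝ} (hτ : 0 < τ) (ha : 0 < a)
    (hla : l = N / 2 - a) (hf : Measurable f) (hf0 : ∀ x, 0 ≤ f x) (x : EuclideanSpace ℝ (Fin N)) :
    ∫⁻ z, ‖farKernel l τ γ f (x, z)‖ₑ ^ 2 ∂heatMeasure N ≤
      ENNReal.ofReal (a⁻¹ * τ ^ (-(4 * a / γ)) * f x ^ (2 + 4 * a / γ)) := by
  rcases (hf0 x).eq_or_lt with h0 | hpos
  · have : ∀ z, farKernel l τ γ f (x, z) = 0 := fun z => by simp [farKernel, ← h0]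
    simp [this]
  have hT : 0 < cutTime τ γ (f x) := by
    unfold cutTime
    positivity
  set T := cutTime τ γ (f x) with hTdef
  have hm : Measurable fun z => ‖farKernel l τ γ f (x, z)‖ₑ ^ 2 :=
    ((measurable_farKernel l τ γ hf).comp measurable_prodMk_left).enorm.pow_const 2
  rw [heatMeasure, lintegral_prod_symm _ hm.aemeasurable]
  have h1 : ∀ t ∈ Ioi (0 : ℝ), ∫⁻ ξ, ‖farKernel l τ γ f (x, (ξ, t))‖ₑ ^ 2 =
      (Ici T).indicator (fun t => ENNReal.ofReal (f x ^ 2) * ENNReal.ofReal (t ^ (-a - 1))) t := by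
    intro t ht
    have ht' : 0 < t := ht
    by_cases hTt : T ≤ t
    · rw [indicator_of_mem (show t ∈ Ici T from hTt)]
      have h2 : ∀ ξ, ‖farKernel l τ γ f (x, (ξ, t))‖ₑ ^ 2 = ENNReal.ofReal (f x ^ 2 * t ^ (l - 1)) *
          ENNReal.ofReal (Real.exp (-Real.pi * t * ‖ξ‖ ^ 2)) := by
        intro ξ
        have h3 : farKernel l τ γ f (x, (ξ, t)) = (f x : ℂ) * heatKernel l x (ξ, t) := by
          unfold farKernel
          exact if_pos hTt
        rw [h3, ← ofReal_norm, norm_mul, norm_heatKernel l x (z := (ξ, t)) ht', Complex.norm_real,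
          ← ENNReal.ofReal_pow (by have := heatMod_nonneg l (z := (ξ, t)) ht'; positivity),
          mul_pow, heatMod_sq l (z := (ξ, t)) ht', Real.norm_eq_abs, sq_abs, ← mul_assoc,
          ENNReal.ofReal_mul (by positivity)]
      simp_rw [h2]
      -- The Gaussian contributes t^(-N/2), and t^(l-1) t^(-N/2) = t^(-a-1) because l = N/2 - a; a >
      -- 0 makes this integrable at infinity.
      rw [lintegral_const_mul _ (by fun_prop), lintegral_gaussian ht',
        ← ENNReal.ofReal_mul (by positivity), ← ENNReal.ofReal_mul (by positivity), mul_assoc,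
        ← Real.rpow_add ht', hla]
      congr 3
      ring
    · rw [indicator_of_notMem (show t ∉ Ici T from hTt)]
      have h3 : ∀ ξ, farKernel l τ γ f (x, (ξ, t)) = 0 := fun ξ => by
        unfold farKernel
        exact if_neg hTt
      simp [h3]
  rw [setLIntegral_congr_fun measurableSet_Ioi h1]
  calc _ ≤ ∫⁻ t, (Ici T).indicator
        (fun t => ENNReal.ofReal (f x ^ 2) * ENNReal.ofReal (t ^ (-a - 1))) t :=
        setLIntegral_le_lintegral _ _
    _ = ENNReal.ofReal (f x ^ 2 * (T ^ (-a) / a)) := by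
        rw [lintegral_indicator measurableSet_Ici, lintegral_const_mul _ (by fun_prop),
          lintegral_Ici_rpow ha hT, ENNReal.ofReal_mul (by positivity)]
    _ = _ := by
        congr 1
        rw [← mul_div_assoc, sq_mul_cutTime_rpow_neg hτ hpos]
        field_simp

lemma lintegral_lintegral_farKernel_sq_le {μ : Measure (EuclideanSpace ℝ (Fin N))} {l τ γ a : ℝ}
    (hτ : 0 < τ) (ha : 0 < a) (hla : l = N / 2 - a) (hf : Measurable f) (hf0 : ∀ x, 0 ≤ f x)
    (hfi : Integrable (fun x => f x ^ (2 + 4 * a / γ)) μ) :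
    ∫⁻ x, ∫⁻ z, ‖farKernel l τ γ f (x, z)‖ₑ ^ 2 ∂heatMeasure N ∂μ ≤
      ENNReal.ofReal (a⁻¹ * τ ^ (-(4 * a / γ)) * ∫ x, f x ^ (2 + 4 * a / γ) ∂μ) := by
  refine (lintegral_mono fun x => lintegral_farKernel_sq_le hτ ha hla hf hf0 x).trans ?_
  rw [← integral_const_mul, ofReal_integral_eq_lintegral_ofReal (hfi.const_mul _)]
  refine Filter.Eventually.of_forall fun x => ?_
  have := Real.rpow_nonneg (hf0 x) (2 + 4 * a / γ)
  change (0 : ℝ) ≤ _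
  positivity

/-- The dual form of the bound of the near part. -/
lemma lintegral_adjoint_nearKernel_le {μ : Measure (EuclideanSpace ℝ (Fin N))}
    [IsFiniteMeasure μ] {A s l τ γ : ℝ} (hA : 0 ≤ A) (hγ : 0 < γ) (hγs : γ = s + 2 * l - N)
    (hμ : ∀ᵐ x ∂μ, ∀ r : ℝ, 0 < r → μ (Metric.ball x r) ≤ ENNReal.ofReal (A * r ^ s))
    (hf : Measurable f) {q : EuclideanSpace ℝ (Fin N) → ℂ} (hq : Measurable q)
    (hqf : Integrable (fun x => q x * f x) μ) :
    ∫⁻ z, ‖∫ x, q x * nearKernel l τ γ f (x, z) ∂μ‖ₑ ^ 2 ∂heatMeasure N ≤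
      ENNReal.ofReal (4 * gaussConst s / γ * A * τ ^ 2) * ∫⁻ x, ‖q x‖ₑ ^ 2 ∂μ := by
  have hg := gaussConst_nonneg s
  -- At a fixed time t only the points with cut time beyond t contribute. The adjoint is therefore
  -- `heatMod` times the Fourier transform of p_t dμ, and the Gaussian energy bound applies to each
  -- t separately.
  set p : ℝ → EuclideanSpace ℝ (Fin N) → ℂ := fun t =>
    {x | t < cutTime τ γ (f x)}.indicator fun x => q x * f x with hp
  have hcm : ∀ t, MeasurableSet {x | t < cutTime τ γ (f x)} := fun t =>
    measurableSet_lt measurable_const ((measurable_cutTime τ γ).comp hf)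
  have hpi : ∀ t, Integrable (p t) μ := fun t => hqf.indicator (hcm t)
  have hR : ∀ z : EuclideanSpace ℝ (Fin N) × ℝ, ∫ x, q x * nearKernel l τ γ f (x, z) ∂μ =
      (heatMod l z : ℂ) * measFourier μ (p z.2) z.1 := by
    intro z
    unfold measFourier
    rw [← integral_const_mul]
    refine integral_congr_ae (Filter.Eventually.of_forall fun x => ?_)
    simp only [nearKernel, hp, heatKernel]
    by_cases h : cutTime τ γ (f x) ≤ z.2
    · rw [if_pos h, indicator_of_notMem (show x ∉ {x | z.2 < cutTime τ γ (f x)} from not_lt.2 h)]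
      simp
    · rw [if_neg h, indicator_of_mem (show x ∈ {x | z.2 < cutTime τ γ (f x)} from not_le.1 h)]
      ring
  have hRm : Measurable fun z => ‖∫ x, q x * nearKernel l τ γ f (x, z) ∂μ‖ₑ ^ 2 := by
    have h1 : StronglyMeasurable fun w : (EuclideanSpace ℝ (Fin N) × ℝ) × EuclideanSpace ℝ (Fin N) =>
        q w.2 * nearKernel l τ γ f (w.2, w.1) :=
      ((hq.comp measurable_snd).mul ((measurable_nearKernel l τ γ hf).comp
        measurable_swap)).stronglyMeasurable
    exact h1.integral_prod_right'.measurable.enorm.pow_const 2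
  rw [heatMeasure, lintegral_prod_symm _ hRm.aemeasurable]
  have h1 : ∀ t ∈ Ioi (0 : ℝ), ∫⁻ ξ, ‖∫ x, q x * nearKernel l τ γ f (x, (ξ, t)) ∂μ‖ₑ ^ 2 ≤
      ENNReal.ofReal (2 * gaussConst s * A) *
        ∫⁻ x, ‖q x * f x‖ₑ ^ 2 * (Iio (cutTime τ γ (f x))).indicator
          (fun t => ENNReal.ofReal (t ^ (γ / 2 - 1))) t ∂μ := by
    intro t ht
    have ht' : 0 < t := ht
    have h2 : ∀ ξ, ‖∫ x, q x * nearKernel l τ γ f (x, (ξ, t)) ∂μ‖ₑ ^ 2 =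
        ENNReal.ofReal (t ^ (l - 1)) * (ENNReal.ofReal (Real.exp (-Real.pi * t * ‖ξ‖ ^ 2)) *
          ‖measFourier μ (p t) ξ‖ₑ ^ 2) := by
      intro ξ
      rw [hR, enorm_mul, mul_pow, ← ofReal_norm (( _ : ℝ) : ℂ), Complex.norm_real,
        ← ENNReal.ofReal_pow (norm_nonneg _), Real.norm_eq_abs, sq_abs,
        heatMod_sq l (z := (ξ, t)) ht', ENNReal.ofReal_mul (by positivity), mul_assoc]
    simp_rw [h2]
    rw [lintegral_const_mul' _ _ ENNReal.ofReal_ne_top]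
    calc _ ≤ ENNReal.ofReal (t ^ (l - 1)) * (ENNReal.ofReal (2 * gaussConst s * A *
          t ^ ((s - N) / 2)) * ∫⁻ x, ‖p t x‖ₑ ^ 2 ∂μ) := by
          gcongr
          exact lintegral_gaussian_mul_measFourier_le' hA hμ (hpi t) ht'
      _ = ENNReal.ofReal (2 * gaussConst s * A) *
          ∫⁻ x, ENNReal.ofReal (t ^ (γ / 2 - 1)) * ‖p t x‖ₑ ^ 2 ∂μ := by
          rw [lintegral_const_mul' _ _ ENNReal.ofReal_ne_top, ← mul_assoc, ← mul_assoc,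
            ← ENNReal.ofReal_mul (by positivity), ← ENNReal.ofReal_mul (by positivity)]
          congr 2
          rw [show γ / 2 - 1 = (l - 1) + (s - N) / 2 by rw [hγs]; ring, Real.rpow_add ht']
          ring
      _ = _ := by
          congr 1
          refine lintegral_congr fun x => ?_
          simp only [hp]
          by_cases h : t < cutTime τ γ (f x)
          · rw [indicator_of_mem (show x ∈ {x | t < cutTime τ γ (f x)} from h),
              indicator_of_mem (show t ∈ Iio (cutTime τ γ (f x)) from h), mul_comm]
          · rw [indicator_of_notMem (show x ∉ {x | t < cutTime τ γ (f x)} from h),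
              indicator_of_notMem (show t ∉ Iio (cutTime τ γ (f x)) from h)]
            simp
  refine (setLIntegral_mono' measurableSet_Ioi h1).trans ?_
  rw [lintegral_const_mul' _ _ ENNReal.ofReal_ne_top]
  have hm : Measurable fun w : ℝ × EuclideanSpace ℝ (Fin N) =>
      ‖q w.2 * f w.2‖ₑ ^ 2 * (Iio (cutTime τ γ (f w.2))).indicator
          (fun t => ENNReal.ofReal (t ^ (γ / 2 - 1))) w.1 := by
    refine Measurable.mul (by fun_prop) ?_
    have hS : MeasurableSet {w : ℝ × EuclideanSpace ℝ (Fin N) | w.1 < cutTime τ γ (f w.2)} :=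
      measurableSet_lt measurable_fst ((measurable_cutTime τ γ).comp (hf.comp measurable_snd))
    have h3 : Measurable fun w : ℝ × EuclideanSpace ℝ (Fin N) =>
      ENNReal.ofReal (w.1 ^ (γ / 2 - 1)) := by fun_prop
    exact h3.indicator hS
  -- With x fixed, t runs over (0, T) for the cut time T, and f(x)² ∫₀^T t^(γ/2-1) dt = (2/γ) f(x)²
  -- T^(γ/2) ≤ (2/γ) τ², uniformly in x.
  rw [lintegral_lintegral_swap hm.aemeasurable]
  have h4 : ∀ x, ∫⁻ t in Ioi 0, ‖q x * f x‖ₑ ^ 2 * (Iio (cutTime τ γ (f x))).indicator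
          (fun t => ENNReal.ofReal (t ^ (γ / 2 - 1))) t ≤
      ENNReal.ofReal (2 / γ * τ ^ 2) * ‖q x‖ₑ ^ 2 := by
    intro x
    rw [lintegral_const_mul _ ((by fun_prop : Measurable fun t : ℝ =>
      ENNReal.ofReal (t ^ (γ / 2 - 1))).indicator measurableSet_Iio),
      setLIntegral_indicator measurableSet_Iio, Iio_inter_Ioi,
      lintegral_Ioo_rpow (by positivity) (cutTime_nonneg _ _ _), enorm_mul, mul_pow, mul_assoc,
      mul_comm, ← ofReal_norm ((f x : ℝ) : ℂ), ← ENNReal.ofReal_pow (norm_nonneg _),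
      Complex.norm_real, Real.norm_eq_abs, sq_abs, ← ENNReal.ofReal_mul (by positivity)]
    refine mul_le_mul' (ENNReal.ofReal_le_ofReal ?_) le_rfl
    have := sq_mul_cutTime_rpow_le (τ := τ) hγ (f x)
    calc _ = 2 / γ * (f x ^ 2 * cutTime τ γ (f x) ^ (γ / 2)) := by field_simp
      _ ≤ _ := by gcongr
  calc _ ≤ ENNReal.ofReal (2 * gaussConst s * A) *
      ∫⁻ x, ENNReal.ofReal (2 / γ * τ ^ 2) * ‖q x‖ₑ ^ 2 ∂μ := by
        gcongr with x
        exact h4 x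
    _ = _ := by
        rw [lintegral_const_mul' _ _ ENNReal.ofReal_ne_top, ← mul_assoc,
          ← ENNReal.ofReal_mul (by positivity)]
        congr 2
        ring

/-- Both parts are dominated by the full integrand, so the representation splits. For g the
transform of v, the near integral is exactly the remainder of f·v after the far operator. -/
lemma integral_nearKernel_eq [Nontrivial (EuclideanSpace ℝ (Fin N))] {l τ γ : ℝ} (hl : 0 < l)
    (hf : Measurable f) {g : EuclideanSpace ℝ (Fin N) → ℂ} (hg : Measurable g)
    (hgi : Integrable g) (x : EuclideanSpace ℝ (Fin N)) :
    (f x : ℂ) * (∫ ξ, g ξ * char2pi x ξ) -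
        ∫ z, farKernel l τ γ f (x, z) * heatLift l g z ∂heatMeasure N =
      ∫ z, nearKernel l τ γ f (x, z) * heatLift l g z ∂heatMeasure N := by
  have hI := (integrable_heatKernel_mul_heatLift hl hg hgi x).const_mul (f x : ℂ)
  have hn : Integrable (fun z => nearKernel l τ γ f (x, z) * heatLift l g z) (heatMeasure N) := by
    refine hI.mono (((measurable_nearKernel l τ γ hf).comp measurable_prodMk_left).mul
      (measurable_heatLift l hg)).aestronglyMeasurable (Filter.Eventually.of_forall fun z => ?_)
    rw [← mul_assoc, norm_mul, norm_mul (_ * _)]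
    gcongr
    exact norm_nearKernel_le l τ γ x z
  have hfar : ∀ z, farKernel l τ γ f (x, z) * heatLift l g z =
      (f x : ℂ) * (heatKernel l x z * heatLift l g z) -
        nearKernel l τ γ f (x, z) * heatLift l g z := by
    intro z
    rw [← mul_assoc, ← farKernel_add_nearKernel l τ γ]
    ring
  simp_rw [hfar]
  rw [integral_sub hI hn, integral_const_mul, integral_heatKernel_mul_heatLift hl hg hgi]
  ring

/-- The near part is bounded. -/
lemma lintegral_nearKernel_le [Nontrivial (EuclideanSpace ℝ (Fin N))]
    {μ : Measure (EuclideanSpace ℝ (Fin N))}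
    [IsFiniteMeasure μ] {A s l τ γ : ℝ} (hl : 0 < l) (hA : 0 ≤ A) (hγ : 0 < γ)
    (hγs : γ = s + 2 * l - N)
    (hμ : ∀ᵐ x ∂μ, ∀ r : ℝ, 0 < r → μ (Metric.ball x r) ≤ ENNReal.ofReal (A * r ^ s))
    (hf : Measurable f) (hf2 : MemLp (fun x => (f x : ℂ)) 2 μ)
    {g : EuclideanSpace ℝ (Fin N) → ℂ} (hg : Measurable g) (hgi : Integrable g)
    (hfin : ∫⁻ x, ‖∫ z, nearKernel l τ γ f (x, z) * heatLift l g z ∂heatMeasure N‖ₑ ^ 2 ∂μ < ∞) :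
    ∫⁻ x, ‖∫ z, nearKernel l τ γ f (x, z) * heatLift l g z ∂heatMeasure N‖ₑ ^ 2 ∂μ ≤
      ENNReal.ofReal (4 * gaussConst s / γ * A * τ ^ 2) *
        ∫⁻ z, ‖heatLift l g z‖ₑ ^ 2 ∂heatMeasure N := by
  set b : EuclideanSpace ℝ (Fin N) → ℂ := fun x =>
    ∫ z, nearKernel l τ γ f (x, z) * heatLift l g z ∂heatMeasure N with hb
  have hbm : Measurable b := by
    have h1 : StronglyMeasurable fun w : EuclideanSpace ℝ (Fin N) ×
        (EuclideanSpace ℝ (Fin N) × ℝ) => nearKernel l τ γ f w * heatLift l g w.2 :=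
      ((measurable_nearKernel l τ γ hf).mul
        ((measurable_heatLift l hg).comp measurable_snd)).stronglyMeasurable
    exact h1.integral_prod_right'.measurable
  have hb2 : MemLp b 2 μ := (memLp_two_iff_lintegral hbm.aestronglyMeasurable).2 hfin
  -- Duality with b itself: Q = ∫ |b|² dμ is the pairing of the lift with the adjoint applied to the
  -- conjugate of b, whence Q² ≤ L · cQ.
  set q : EuclideanSpace ℝ (Fin N) → ℂ := fun x => (starRingEnd ℂ) (b x) with hq
  have hqm : Measurable q := Complex.continuous_conj.measurable.comp hbm
  have hq2 : MemLp q 2 μ := hb2.star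
  have hqe : ∀ x, ‖q x‖ₑ = ‖b x‖ₑ := fun x => RCLike.enorm_conj _
  have hqf : Integrable (fun x => q x * f x) μ := hq2.integrable_mul hf2
  set Q := ∫⁻ x, ‖b x‖ₑ ^ 2 ∂μ with hQ
  set L := ∫⁻ z, ‖heatLift l g z‖ₑ ^ 2 ∂heatMeasure N with hL
  set c := ENNReal.ofReal (4 * gaussConst s / γ * A * τ ^ 2) with hc
  have hdual := lintegral_adjoint_nearKernel_le (τ := τ) hA hγ hγs hμ hf hqm hqf
  simp_rw [hqe] at hdual
  rw [← hQ, ← hc] at hdual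
  have hFub : Integrable (Function.uncurry fun (x : EuclideanSpace ℝ (Fin N))
      (z : EuclideanSpace ℝ (Fin N) × ℝ) => q x * (nearKernel l τ γ f (x, z) * heatLift l g z))
      (μ.prod (heatMeasure N)) := by
    -- The modulus of the heat kernel does not depend on x, so its value at 0 provides a majorant
    -- that is a product of a function of x and a function of z.
    have h0 := hqf.mul_prod (integrable_heatKernel_mul_heatLift hl hg hgi 0)
    refine h0.mono ?_ ?_
    · exact ((hqm.comp measurable_fst).mul ((measurable_nearKernel l τ γ hf).mul
        ((measurable_heatLift l hg).comp measurable_snd))).aestronglyMeasurable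
    · have hae : ∀ᵐ w ∂(μ.prod (heatMeasure N)), 0 < w.2.2 :=
        Measure.quasiMeasurePreserving_snd.ae ae_heatMeasure_pos
      filter_upwards [hae] with w hw
      simp only [Function.uncurry_def, norm_mul]
      rw [mul_assoc, norm_heatKernel l 0 hw]
      gcongr ?_ * ?_
      rw [← mul_assoc]
      gcongr ?_ * ?_
      refine (norm_nearKernel_le l τ γ w.1 w.2).trans (le_of_eq ?_)
      rw [norm_mul, norm_heatKernel l w.1 hw]
  have hQeq : Q = ‖∫ z, heatLift l g z * ∫ x, q x * nearKernel l τ γ f (x, z) ∂μ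
      ∂heatMeasure N‖ₑ := by
    have h1 : ∫ x, q x * b x ∂μ = ∫ z, heatLift l g z * ∫ x, q x * nearKernel l τ γ f (x, z) ∂μ
      ∂heatMeasure N := by
      calc ∫ x, q x * b x ∂μ = ∫ x, ∫ z, q x * (nearKernel l τ γ f (x, z) * heatLift l g z)
            ∂heatMeasure N ∂μ := by
            refine integral_congr_ae (Filter.Eventually.of_forall fun x => ?_)
            simp only [hb]
            rw [integral_const_mul]
        _ = ∫ z, ∫ x, q x * (nearKernel l τ γ f (x, z) * heatLift l g z) ∂μ ∂heatMeasure N :=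
            integral_integral_swap hFub
        _ = _ := by
            refine integral_congr_ae (Filter.Eventually.of_forall fun z => ?_)
            simp only
            rw [← integral_const_mul]
            refine integral_congr_ae (Filter.Eventually.of_forall fun x => ?_)
            simp only
            ring
    have h2 : ∫ x, q x * b x ∂μ = ((∫ x, ‖b x‖ ^ 2 ∂μ : ℝ) : ℂ) := by
      rw [← integral_complex_ofReal]
      refine integral_congr_ae (Filter.Eventually.of_forall fun x => ?_)
      simp only [hq]
      rw [mul_comm, Complex.mul_conj, Complex.normSq_eq_norm_sq]
    rw [← h1, h2, ← ofReal_norm, Complex.norm_real,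
      Real.norm_of_nonneg (integral_nonneg fun x => sq_nonneg _),
      ofReal_integral_eq_lintegral_ofReal (by simpa using hb2.integrable_norm_pow two_ne_zero)
        (Filter.Eventually.of_forall fun x => sq_nonneg _)]
    refine lintegral_congr fun x => ?_
    rw [ENNReal.ofReal_pow (norm_nonneg _), ofReal_norm]
  have hRm : Measurable fun z => ∫ x, q x * nearKernel l τ γ f (x, z) ∂μ := by
    have h1 : StronglyMeasurable fun w : (EuclideanSpace ℝ (Fin N) × ℝ) × EuclideanSpace ℝ (Fin N) =>
        q w.2 * nearKernel l τ γ f (w.2, w.1) :=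
      ((hqm.comp measurable_snd).mul ((measurable_nearKernel l τ γ hf).comp
        measurable_swap)).stronglyMeasurable
    exact h1.integral_prod_right'.measurable
  have hCS : Q ^ 2 ≤ L * (c * Q) := by
    have h1 := enorm_integral_mul_sq_le (measurable_heatLift l hg).aestronglyMeasurable
      hRm.aestronglyMeasurable (ρ := heatMeasure N)
    rw [← hQeq] at h1
    exact h1.trans (mul_le_mul' le_rfl hdual)
  -- Cancelling Q requires it to be finite, which is the a priori hypothesis `hfin`.
  rcases eq_or_ne Q 0 with h0 | h0
  · rw [h0]
    exact zero_le
  · have h1 : Q * Q ≤ c * L * Q := by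
      calc Q * Q = Q ^ 2 := (sq Q).symm
        _ ≤ L * (c * Q) := hCS
        _ = _ := by ring
    exact (ENNReal.mul_le_mul_iff_left h0 hfin.ne).1 h1

end Cutoff

end SingularBS

namespace SingularBS

variable {N : ℕ} {Ω : TopologicalSpace.Opens (EuclideanSpace ℝ (Fin N))}

/-! ### Fourier lower bound for the homogeneous Sobolev norm -/

section Plancherel

open scoped FourierTransform LineDeriv SchwartzMap

/-- A test function as a Schwartz function. -/
def toSchwartz (v : 𝓓(Ω, ℂ)) : 𝓢(EuclideanSpace ℝ (Fin N), ℂ) :=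
  v.hasCompactSupport'.toSchwartzMap v.contDiff'

lemma toSchwartz_apply (v : 𝓓(Ω, ℂ)) (x : EuclideanSpace ℝ (Fin N)) : toSchwartz v x = v x := rfl

/-- The Fourier transform of a test function. -/
def fhat (v : 𝓓(Ω, ℂ)) : 𝓢(EuclideanSpace ℝ (Fin N), ℂ) := 𝓕 (toSchwartz v)

lemma fhat_lineDeriv (m : EuclideanSpace ℝ (Fin N)) (v : 𝓓(Ω, ℂ)) (ξ : EuclideanSpace ℝ (Fin N)) :
    fhat ((TestFunction.lineDerivCLM ℂ m : 𝓓(Ω, ℂ) →L[ℂ] 𝓓(Ω, ℂ)) v) ξ =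
      (2 * Real.pi * Complex.I * (inner ℝ ξ m : ℝ)) * fhat v ξ := by
  have h1 : toSchwartz ((TestFunction.lineDerivCLM ℂ m : 𝓓(Ω, ℂ) →L[ℂ] 𝓓(Ω, ℂ)) v) =
      ∂_{m} (toSchwartz v) := by
    ext x
    rw [toSchwartz_apply, TestFunction.lineDerivCLM_apply_of_le (by simp),
      SchwartzMap.lineDerivOp_apply]
    rfl
  have ht : Function.HasTemperateGrowth (fun x : EuclideanSpace ℝ (Fin N) => (inner ℝ x m : ℝ)) :=
    ((innerSL ℝ).flip m).hasTemperateGrowth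
  unfold fhat
  rw [h1, SchwartzMap.fourier_lineDerivOp_eq, smul_apply,
    SchwartzMap.smulLeftCLM_apply_apply ht, smul_eq_mul, Complex.real_smul]
  ring

lemma fhat_pow_lineDeriv (m : EuclideanSpace ℝ (Fin N)) (k : ℕ) (v : 𝓓(Ω, ℂ))
    (ξ : EuclideanSpace ℝ (Fin N)) :
    fhat (((TestFunction.lineDerivCLM ℂ m : 𝓓(Ω, ℂ) →L[ℂ] 𝓓(Ω, ℂ)).toLinearMap ^ k :
      Module.End ℂ 𝓓(Ω, ℂ)) v) ξ =
      (2 * Real.pi * Complex.I * (inner ℝ ξ m : ℝ)) ^ k * fhat v ξ := by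
  induction k with
  | zero => simp
  | succ k ih =>
    rw [pow_succ', Module.End.mul_apply]
    refine (fhat_lineDeriv m _ ξ).trans ?_
    rw [ih]
    ring

lemma fhat_multiDeriv (ν : Fin N → ℕ) (v : 𝓓(Ω, ℂ)) (ξ : EuclideanSpace ℝ (Fin N)) :
    fhat (multiDeriv Ω ν v) ξ = (∏ i, (2 * Real.pi * Complex.I * (ξ i : ℝ)) ^ ν i) * fhat v ξ := by
  have key : ∀ L : List (Fin N), fhat ((L.map fun i =>
      ((TestFunction.lineDerivCLM ℂ (EuclideanSpace.single i (1 : ℝ)) :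
      𝓓(Ω, ℂ) →L[ℂ] 𝓓(Ω, ℂ)).toLinearMap ^ ν i : Module.End ℂ 𝓓(Ω, ℂ))).prod v) ξ =
      (L.map fun i => (2 * Real.pi * Complex.I * ((ξ i : ℝ) : ℂ)) ^ ν i).prod * fhat v ξ := by
    intro L
    induction L with
    | nil => simp
    | cons i L ih =>
      rw [List.map_cons, List.prod_cons, Module.End.mul_apply, fhat_pow_lineDeriv, ih,
        List.map_cons, List.prod_cons, EuclideanSpace.inner_single_right]
      simp only [one_mul, conj_trivial]
      ring
  unfold multiDeriv
  rw [List.ofFn_eq_map, key, ← List.ofFn_eq_map, List.prod_ofFn]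

lemma integrable_norm_sq_schwartz (f : 𝓢(EuclideanSpace ℝ (Fin N), ℂ)) :
    Integrable fun x => ‖f x‖ ^ 2 := by
  simpa using (f.memLp 2).integrable_norm_pow two_ne_zero

lemma lintegral_schwartz_sq (f : 𝓢(EuclideanSpace ℝ (Fin N), ℂ)) :
    ∫⁻ x, ‖f x‖ₑ ^ 2 = ∫⁻ ξ, ‖(𝓕 f : 𝓢(EuclideanSpace ℝ (Fin N), ℂ)) ξ‖ₑ ^ 2 := by
  have key : ∀ g : 𝓢(EuclideanSpace ℝ (Fin N), ℂ),
      ∫⁻ x, ‖g x‖ₑ ^ 2 = ENNReal.ofReal (∫ x, ‖g x‖ ^ 2) := by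
    intro g
    rw [ofReal_integral_eq_lintegral_ofReal (integrable_norm_sq_schwartz g)
      (Filter.Eventually.of_forall fun x => sq_nonneg _)]
    refine lintegral_congr fun x => ?_
    rw [ENNReal.ofReal_pow (norm_nonneg _), ofReal_norm]
  rw [key, key, SchwartzMap.integral_norm_sq_fourier]

lemma fourier_translate (f : 𝓢(EuclideanSpace ℝ (Fin N), ℂ)) (h ξ : EuclideanSpace ℝ (Fin N)) :
    (𝓕 (f.compSubConstCLM ℂ (-h)) : 𝓢(EuclideanSpace ℝ (Fin N), ℂ)) ξ =
      char2pi h ξ * (𝓕 f : 𝓢(EuclideanSpace ℝ (Fin N), ℂ)) ξ := by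
  have h1 : ((f.compSubConstCLM ℂ (-h) : 𝓢(EuclideanSpace ℝ (Fin N), ℂ)) :
      EuclideanSpace ℝ (Fin N) → ℂ) = f ∘ fun x => x + h := by
    ext x
    rw [SchwartzMap.compSubConstCLM_apply, sub_neg_eq_add, Function.comp]
  rw [SchwartzMap.fourier_coe, SchwartzMap.fourier_coe, h1]
  have h2 := congrFun (VectorFourier.fourierIntegral_comp_add_right Real.fourierChar volume
    (innerₗ (EuclideanSpace ℝ (Fin N))) f h) ξ
  refine h2.trans ?_
  rw [Circle.smul_def, smul_eq_mul, Real.fourierChar_apply]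
  congr 1
  unfold char2pi
  congr 1
  push_cast
  rw [innerₗ_apply_apply]
  ring

/-- Plancherel, since translation by h multiplies the transform by a character. -/
lemma lintegral_increment_sq (v : 𝓓(Ω, ℂ)) (h : EuclideanSpace ℝ (Fin N)) :
    ∫⁻ x, ‖v (h + x) - v x‖ₑ ^ 2 = ∫⁻ ξ, ‖char2pi h ξ - 1‖ₑ ^ 2 * ‖fhat v ξ‖ₑ ^ 2 := by
  have h1 := lintegral_schwartz_sq ((toSchwartz v).compSubConstCLM ℂ (-h) - toSchwartz v)
  have h2 : ∀ x, ((toSchwartz v).compSubConstCLM ℂ (-h) - toSchwartz v) x = v (h + x) - v x := by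
    intro x
    rw [sub_apply, SchwartzMap.compSubConstCLM_apply, sub_neg_eq_add, add_comm,
      toSchwartz_apply, toSchwartz_apply]
  simp_rw [h2] at h1
  rw [h1]
  refine lintegral_congr fun ξ => ?_
  have h3 := map_sub (SchwartzMap.fourierTransformCLM ℂ)
    ((toSchwartz v).compSubConstCLM ℂ (-h)) (toSchwartz v)
  simp only [SchwartzMap.fourierTransformCLM_apply] at h3
  rw [h3, sub_apply, fourier_translate, ← mul_pow,
    ← enorm_mul]
  unfold fhat
  ring_nf

/-- |exp(ia) - 1|² = 2 - 2 cos a, and cos a ≤ 0 for a between π/2 and 3π/2. -/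
lemma two_le_norm_char2pi_sub_one_sq {h ξ : EuclideanSpace ℝ (Fin N)}
    (h1 : 1 / 4 ≤ (inner ℝ h ξ : ℝ)) (h2 : (inner ℝ h ξ : ℝ) ≤ 3 / 4) :
    2 ≤ ‖char2pi h ξ - 1‖ ^ 2 := by
  have hπ := Real.pi_pos
  have : char2pi h ξ = Complex.exp (((2 * Real.pi * inner ℝ h ξ : ℝ) : ℂ) * Complex.I) := by
    unfold char2pi
    congr 1
    push_cast
    ring
  rw [this, ← Complex.normSq_eq_norm_sq, Complex.normSq_apply]
  simp only [Complex.sub_re, Complex.sub_im, Complex.exp_ofReal_mul_I_re,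
    Complex.exp_ofReal_mul_I_im, Complex.one_re, Complex.one_im]
  set a := 2 * Real.pi * inner ℝ h ξ with ha
  have hcos : Real.cos a ≤ 0 := by
    refine Real.cos_nonpos_of_pi_div_two_le_of_le ?_ ?_ <;> rw [ha] <;> nlinarith
  nlinarith [Real.sin_sq_add_cos_sq a]

/-- The volume of the unit ball. -/
def ballVol (N : ℕ) : ℝ := (volume (Metric.ball (0 : EuclideanSpace ℝ (Fin N)) 1)).toReal

lemma ballVol_pos : 0 < ballVol N :=
  ENNReal.toReal_pos (Metric.measure_ball_pos _ _ one_pos).ne' measure_ball_lt_top.ne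

/-- The symbol of the fractional seminorm dominates the power of the frequency. -/
lemma le_lintegral_fractional_symbol {σ : ℝ} (hσ : 0 ≤ σ) {ξ : EuclideanSpace ℝ (Fin N)}
    (hξ : ξ ≠ 0) :
    ENNReal.ofReal (ballVol N / 4 ^ N * ‖ξ‖ ^ (2 * σ)) ≤
      ∫⁻ h : EuclideanSpace ℝ (Fin N), ENNReal.ofReal ((‖h‖ ^ ((N : ℝ) + 2 * σ))⁻¹) *
        ‖char2pi h ξ - 1‖ₑ ^ 2 := by
  have hn : 0 < ‖ξ‖ := norm_pos_iff.2 hξ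
  -- On this ball ⟨h, ξ⟩ stays within 1/4 of 1/2 and |h| ≤ 1/|ξ|, so the integrand is at least
  -- |ξ|^(N+2σ). The volume `ballVol N` / (4|ξ|)^N turns this into the stated bound.
  set c : EuclideanSpace ℝ (Fin N) := (1 / (2 * ‖ξ‖ ^ 2)) • ξ with hc
  set B := Metric.ball c (1 / (4 * ‖ξ‖)) with hB
  have hpt : ∀ h ∈ B, ENNReal.ofReal (‖ξ‖ ^ ((N : ℝ) + 2 * σ)) ≤
      ENNReal.ofReal ((‖h‖ ^ ((N : ℝ) + 2 * σ))⁻¹) * ‖char2pi h ξ - 1‖ₑ ^ 2 := by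
    intro h hh
    have hd : ‖h - c‖ < 1 / (4 * ‖ξ‖) := by rwa [hB, Metric.mem_ball, dist_eq_norm] at hh
    have hcn : ‖c‖ = 1 / (2 * ‖ξ‖) := by
      rw [hc, norm_smul, Real.norm_of_nonneg (by positivity)]
      field_simp
    have hcξ : inner ℝ c ξ = (1 / 2 : ℝ) := by
      rw [hc, real_inner_smul_left, real_inner_self_eq_norm_sq]
      field_simp
    have hin : |inner ℝ (h - c) ξ| ≤ (1 / 4 : ℝ) := by
      refine (abs_real_inner_le_norm _ _).trans ?_
      calc _ ≤ 1 / (4 * ‖ξ‖) * ‖ξ‖ := by gcongr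
        _ = _ := by field_simp
    rw [inner_sub_left, hcξ, abs_le] at hin
    have h2 := two_le_norm_char2pi_sub_one_sq (h := h) (ξ := ξ) (by linarith [hin.1])
      (by linarith [hin.2])
    have hh0 : 0 < ‖h‖ := by
      rw [norm_pos_iff]
      rintro rfl
      rw [inner_zero_left] at hin
      linarith [hin.1]
    have hhn : ‖h‖ ≤ ‖ξ‖⁻¹ := by
      have h3 : ‖h‖ ≤ ‖h - c‖ + ‖c‖ := by simpa using norm_add_le (h - c) c
      have h4 : 1 / (4 * ‖ξ‖) + 1 / (2 * ‖ξ‖) ≤ ‖ξ‖⁻¹ := by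
        rw [show 1 / (4 * ‖ξ‖) + 1 / (2 * ‖ξ‖) = 3 / 4 * ‖ξ‖⁻¹ by field_simp; norm_num]
        have := inv_pos.2 hn
        linarith
      linarith
    rw [← ofReal_norm, ← ENNReal.ofReal_pow (norm_nonneg _), ← ENNReal.ofReal_mul (by positivity)]
    refine ENNReal.ofReal_le_ofReal ?_
    have h5 : ‖ξ‖ ^ ((N : ℝ) + 2 * σ) ≤ (‖h‖ ^ ((N : ℝ) + 2 * σ))⁻¹ := by
      rw [← Real.inv_rpow hh0.le]
      refine Real.rpow_le_rpow hn.le ?_ (by positivity)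
      rwa [le_inv_comm₀ hn hh0]
    calc _ ≤ (‖h‖ ^ ((N : ℝ) + 2 * σ))⁻¹ := h5
      _ ≤ _ := le_mul_of_one_le_right (by positivity) (by linarith)
  calc _ = ∫⁻ _h in B, ENNReal.ofReal (‖ξ‖ ^ ((N : ℝ) + 2 * σ)) := by
        have : Nontrivial (EuclideanSpace ℝ (Fin N)) := ⟨ξ, 0, hξ⟩
        rw [setLIntegral_const, hB, Measure.addHaar_ball _ _ (by positivity),
          finrank_euclideanSpace_fin, ← ENNReal.ofReal_toReal
          (measure_ball_lt_top (μ := volume) (x := (0 : EuclideanSpace ℝ (Fin N))) (r := 1)).ne,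
          ← ENNReal.ofReal_mul (by positivity), ← ENNReal.ofReal_mul (by positivity)]
        congr 1
        change _ = ‖ξ‖ ^ ((N : ℝ) + 2 * σ) * ((1 / (4 * ‖ξ‖)) ^ N * ballVol N)
        rw [Real.rpow_add hn, Real.rpow_natCast, div_pow, one_pow, mul_pow]
        field_simp
    _ ≤ ∫⁻ h in B, ENNReal.ofReal ((‖h‖ ^ ((N : ℝ) + 2 * σ))⁻¹) * ‖char2pi h ξ - 1‖ₑ ^ 2 :=
        setLIntegral_mono' Metric.isOpen_ball.measurableSet hpt
    _ ≤ _ := setLIntegral_le_lintegral _ _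

lemma gagliardoInner_self_re (σ : ℝ) (v : 𝓓(Ω, ℂ)) : (gagliardoInner σ v v).re =
    ∫ z : EuclideanSpace ℝ (Fin N) × EuclideanSpace ℝ (Fin N),
      (‖z.1 - z.2‖ ^ ((N : ℝ) + 2 * σ))⁻¹ * ‖v z.1 - v z.2‖ ^ 2 := by
  rw [← Complex.ofReal_re (∫ z : EuclideanSpace ℝ (Fin N) × EuclideanSpace ℝ (Fin N),
      (‖z.1 - z.2‖ ^ ((N : ℝ) + 2 * σ))⁻¹ * ‖v z.1 - v z.2‖ ^ 2), ← integral_complex_ofReal]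
  congr 1
  refine integral_congr_ae (Filter.Eventually.of_forall fun z => ?_)
  simp only
  rw [inner_self_eq_norm_sq_to_K]
  push_cast
  rfl

lemma l2Inner_self_re (v : 𝓓(Ω, ℂ)) : (l2Inner v v).re = ∫ x, ‖toSchwartz v x‖ ^ 2 := by
  rw [← Complex.ofReal_re (∫ x, ‖toSchwartz v x‖ ^ 2), ← integral_complex_ofReal]
  congr 1
  refine integral_congr_ae (Filter.Eventually.of_forall fun z => ?_)
  simp only
  rw [inner_self_eq_norm_sq_to_K, toSchwartz_apply]
  push_cast
  rfl

/-- Substituting x = y + h and applying Plancherel in y for each h shows the Gagliardo form to be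
the integral of |v̂|² against the symbol bounded in `le_lintegral_fractional_symbol`. -/
lemma le_gagliardoInner [Nontrivial (EuclideanSpace ℝ (Fin N))] {σ : ℝ} (h0 : 0 < σ) (h1 : σ < 1)
    (v : 𝓓(Ω, ℂ)) :
    ∫⁻ ξ, ENNReal.ofReal (ballVol N / 4 ^ N * ‖ξ‖ ^ (2 * σ)) * ‖fhat v ξ‖ₑ ^ 2 ≤
      ENNReal.ofReal (gagliardoInner σ v v).re := by
  have hfm : Measurable (fhat v : EuclideanSpace ℝ (Fin N) → ℂ) := (fhat v).continuous.measurable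
  have hm : Measurable fun z : EuclideanSpace ℝ (Fin N) × EuclideanSpace ℝ (Fin N) =>
      ENNReal.ofReal ((‖z.1 - z.2‖ ^ ((N : ℝ) + 2 * σ))⁻¹) * ‖v z.1 - v z.2‖ₑ ^ 2 := by
    fun_prop
  have hcm : Measurable fun w : EuclideanSpace ℝ (Fin N) × EuclideanSpace ℝ (Fin N) =>
      char2pi w.1 w.2 := continuous_char2pi.measurable
  have heq : ENNReal.ofReal (gagliardoInner σ v v).re = ∫⁻ ξ, (∫⁻ h : EuclideanSpace ℝ (Fin N),
      ENNReal.ofReal ((‖h‖ ^ ((N : ℝ) + 2 * σ))⁻¹) * ‖char2pi h ξ - 1‖ₑ ^ 2) *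
        ‖fhat v ξ‖ₑ ^ 2 := by
    rw [gagliardoInner_self_re, ofReal_integral_eq_lintegral_ofReal (integrable_gagliardo_sq h0 h1 v)
      (Filter.Eventually.of_forall fun z => by positivity)]
    calc _ = ∫⁻ z : EuclideanSpace ℝ (Fin N) × EuclideanSpace ℝ (Fin N),
          ENNReal.ofReal ((‖z.1 - z.2‖ ^ ((N : ℝ) + 2 * σ))⁻¹) * ‖v z.1 - v z.2‖ₑ ^ 2 := by
          refine lintegral_congr fun z => ?_
          rw [ENNReal.ofReal_mul (by positivity), ENNReal.ofReal_pow (norm_nonneg _), ofReal_norm]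
      _ = ∫⁻ y : EuclideanSpace ℝ (Fin N), ∫⁻ h : EuclideanSpace ℝ (Fin N),
          ENNReal.ofReal ((‖h‖ ^ ((N : ℝ) + 2 * σ))⁻¹) * ‖v (h + y) - v y‖ₑ ^ 2 := by
          rw [Measure.volume_eq_prod, lintegral_prod_symm _ hm.aemeasurable]
          refine lintegral_congr fun y => ?_
          rw [← lintegral_add_right_eq_self _ y]
          simp
      _ = ∫⁻ h : EuclideanSpace ℝ (Fin N), ENNReal.ofReal ((‖h‖ ^ ((N : ℝ) + 2 * σ))⁻¹) *
          ∫⁻ y : EuclideanSpace ℝ (Fin N), ‖v (h + y) - v y‖ₑ ^ 2 := by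
          rw [lintegral_lintegral_swap (by fun_prop)]
          exact lintegral_congr fun h => lintegral_const_mul' _ _ ENNReal.ofReal_ne_top
      _ = ∫⁻ h : EuclideanSpace ℝ (Fin N), ∫⁻ ξ : EuclideanSpace ℝ (Fin N),
          ENNReal.ofReal ((‖h‖ ^ ((N : ℝ) + 2 * σ))⁻¹) *
            (‖char2pi h ξ - 1‖ₑ ^ 2 * ‖fhat v ξ‖ₑ ^ 2) := by
          refine lintegral_congr fun h => ?_
          rw [lintegral_increment_sq, lintegral_const_mul' _ _ ENNReal.ofReal_ne_top]
      _ = _ := by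
          rw [lintegral_lintegral_swap]
          · refine lintegral_congr fun ξ => ?_
            simp_rw [← mul_assoc]
            rw [lintegral_mul_const']
            simp
          · refine Measurable.aemeasurable ?_
            simp only [Function.uncurry_def]
            have h3 : Measurable fun w : EuclideanSpace ℝ (Fin N) × EuclideanSpace ℝ (Fin N) =>
                ENNReal.ofReal ((‖w.1‖ ^ ((N : ℝ) + 2 * σ))⁻¹) := by fun_prop
            exact h3.mul (((hcm.sub_const 1).enorm.pow_const 2).mul
              ((hfm.comp measurable_snd).enorm.pow_const 2))
  rw [heq]
  refine lintegral_mono_ae ?_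
  filter_upwards [ae_ne_zero] with ξ hξ
  exact mul_le_mul' (le_lintegral_fractional_symbol h0.le hξ) le_rfl

lemma l2Inner_re (v : 𝓓(Ω, ℂ)) : ENNReal.ofReal (l2Inner v v).re = ∫⁻ ξ, ‖fhat v ξ‖ₑ ^ 2 := by
  rw [l2Inner_self_re, ofReal_integral_eq_lintegral_ofReal
    (integrable_norm_sq_schwartz _) (Filter.Eventually.of_forall fun x => sq_nonneg _)]
  unfold fhat
  rw [← lintegral_schwartz_sq]
  refine lintegral_congr fun x => ?_
  rw [ENNReal.ofReal_pow (norm_nonneg _), ofReal_norm]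

-- Multinomial expansion of (∑ ξ_i²)^m: each coefficient is at most m!, and the factors 2π only
-- enlarge the right side.
open scoped Nat in
lemma norm_pow_le_sum_prod (m : ℕ) (ξ : EuclideanSpace ℝ (Fin N)) :
    ‖ξ‖ ^ (2 * m) ≤ m ! * ∑ ν ∈ Finset.piAntidiag (Finset.univ : Finset (Fin N)) m,
      ‖∏ i, (2 * Real.pi * Complex.I * ((ξ i : ℝ) : ℂ)) ^ ν i‖ ^ 2 := by
  rw [pow_mul, EuclideanSpace.norm_sq_eq, Finset.sum_pow_eq_sum_piAntidiag, Finset.mul_sum]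
  refine Finset.sum_le_sum fun ν hν => ?_
  have hsum : ∑ i, ν i = m := (Finset.mem_piAntidiag.1 hν).1
  have h1 : (Nat.multinomial Finset.univ ν : ℝ) ≤ m ! := by
    norm_cast
    unfold Nat.multinomial
    rw [hsum]
    exact Nat.div_le_self _ _
  refine mul_le_mul h1 ?_ (Finset.prod_nonneg fun i _ => by positivity) (by positivity)
  rw [norm_prod, ← Finset.prod_pow]
  refine Finset.prod_le_prod (fun i _ => by positivity) fun i _ => ?_
  have h2 : ‖ξ i‖ ≤ ‖2 * Real.pi * Complex.I * ((ξ i : ℝ) : ℂ)‖ := by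
    rw [norm_mul, norm_mul, norm_mul, Complex.norm_I, Complex.norm_real, Complex.norm_real,
      Complex.norm_ofNat, Real.norm_of_nonneg Real.pi_pos.le]
    exact le_mul_of_one_le_left (norm_nonneg _) (by linarith [Real.pi_gt_three])
  calc (‖ξ i‖ ^ 2) ^ ν i ≤ (‖2 * Real.pi * Complex.I * ((ξ i : ℝ) : ℂ)‖ ^ 2) ^ ν i := by gcongr
    _ = _ := by rw [norm_pow, ← pow_mul, ← pow_mul, mul_comm 2 (ν i)]

/-- The homogeneous Sobolev norm dominates its Fourier counterpart. -/
lemma exists_lintegral_fhat_le [Nontrivial (EuclideanSpace ℝ (Fin N))] {l : ℝ} (hl : 0 < l) :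
    ∃ C : ℝ, 0 < C ∧ ∀ (Ω : TopologicalSpace.Opens (EuclideanSpace ℝ (Fin N))) (v : 𝓓(Ω, ℂ)),
      ∫⁻ ξ, ENNReal.ofReal (‖ξ‖ ^ (2 * l)) * ‖fhat v ξ‖ₑ ^ 2 ≤
        ENNReal.ofReal (C * (homInner l v v).re) := by
  classical
  set m := ⌊l⌋₊ with hm
  set σ := Int.fract l with hσ
  have hlm : l = m + σ := by
    rw [hm, hσ, natCast_floor_eq_intCast_floor hl.le, Int.floor_add_fract]
  have hb := ballVol_pos (N := N)
  -- One constant serves both definitions of the norm: 1 for integer l, where Plancherel is an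
  -- equality, and the symbol constant otherwise.
  obtain ⟨c, hc, hterm⟩ : ∃ c : ℝ, 0 < c ∧ ∀ (Ω : TopologicalSpace.Opens (EuclideanSpace ℝ (Fin N)))
      (u : 𝓓(Ω, ℂ)), ∫⁻ ξ, ENNReal.ofReal (c * ‖ξ‖ ^ (2 * σ)) * ‖fhat u ξ‖ₑ ^ 2 ≤
        ENNReal.ofReal (if σ = 0 then l2Inner u u else gagliardoInner σ u u).re := by
    by_cases h : σ = 0
    · refine ⟨1, one_pos, fun Ω u => le_of_eq ?_⟩
      rw [if_pos h, l2Inner_re, h]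
      simp
    · refine ⟨ballVol N / 4 ^ N, by positivity, fun Ω u => ?_⟩
      rw [if_neg h]
      exact le_gagliardoInner (fract_pos h) (Int.fract_lt_one l) u
  refine ⟨m.factorial / c, by positivity, fun Ω v => ?_⟩
  have hpos : ∀ u : 𝓓(Ω, ℂ), 0 ≤ (if σ = 0 then l2Inner u u else gagliardoInner σ u u).re := by
    intro u
    split_ifs
    · rw [l2Inner_self_re]
      exact integral_nonneg fun x => sq_nonneg _
    · rw [gagliardoInner_self_re]
      exact integral_nonneg fun z => by positivity
  unfold homInner
  rw [Complex.re_sum, ENNReal.ofReal_mul (by positivity), ENNReal.ofReal_sum_of_nonneg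
    fun ν _ => hpos _]
  calc _ ≤ ∫⁻ ξ, ENNReal.ofReal (m.factorial / c) *
        ∑ ν ∈ Finset.piAntidiag (Finset.univ : Finset (Fin N)) m,
          ENNReal.ofReal (c * ‖ξ‖ ^ (2 * σ)) * ‖fhat (multiDeriv Ω ν v) ξ‖ₑ ^ 2 := by
        refine lintegral_mono_ae ?_
        filter_upwards [ae_ne_zero] with ξ hξ
        have hn := norm_pos_iff.2 hξ
        have h1 : ∀ ν : Fin N → ℕ, ENNReal.ofReal (c * ‖ξ‖ ^ (2 * σ)) *
            ‖fhat (multiDeriv Ω ν v) ξ‖ₑ ^ 2 = ENNReal.ofReal (c * ‖ξ‖ ^ (2 * σ)) *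
            ENNReal.ofReal (‖∏ i, (2 * Real.pi * Complex.I * ((ξ i : ℝ) : ℂ)) ^ ν i‖ ^ 2) *
              ‖fhat v ξ‖ₑ ^ 2 := by
          intro ν
          rw [fhat_multiDeriv, enorm_mul, mul_pow, ENNReal.ofReal_pow (norm_nonneg _), ofReal_norm,
            ← mul_assoc]
        simp_rw [h1]
        rw [← Finset.sum_mul, ← Finset.mul_sum, ← ENNReal.ofReal_sum_of_nonneg
          fun ν _ => sq_nonneg _, ← mul_assoc, ← ENNReal.ofReal_mul (by positivity),
          ← ENNReal.ofReal_mul (by positivity)]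
        refine mul_le_mul' (ENNReal.ofReal_le_ofReal ?_) le_rfl
        have h2 := norm_pow_le_sum_prod m ξ
        calc ‖ξ‖ ^ (2 * l) = ‖ξ‖ ^ (2 * m) * ‖ξ‖ ^ (2 * σ) := by
              rw [hlm, mul_add, Real.rpow_add hn, ← Real.rpow_natCast]
              push_cast
              rfl
          _ ≤ _ := mul_le_mul_of_nonneg_right h2 (by positivity)
          _ = _ := by field_simp
    _ = ENNReal.ofReal (m.factorial / c) *
        ∑ ν ∈ Finset.piAntidiag (Finset.univ : Finset (Fin N)) m,
          ∫⁻ ξ, ENNReal.ofReal (c * ‖ξ‖ ^ (2 * σ)) * ‖fhat (multiDeriv Ω ν v) ξ‖ₑ ^ 2 := by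
        rw [lintegral_const_mul' _ _ ENNReal.ofReal_ne_top, lintegral_finsetSum]
        intro ν _
        have := (fhat (multiDeriv Ω ν v)).continuous.measurable
        fun_prop
    _ ≤ _ := by
        gcongr with ν
        exact hterm Ω _

lemma integral_fhat_mul_char2pi (v : 𝓓(Ω, ℂ)) (x : EuclideanSpace ℝ (Fin N)) :
    ∫ ξ, fhat v ξ * char2pi x ξ = v x := by
  have h1 : (𝓕⁻ (𝓕 (toSchwartz v)) : 𝓢(EuclideanSpace ℝ (Fin N), ℂ)) x = v x := by
    rw [FourierPair.fourierInv_fourier_eq, toSchwartz_apply]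
  rw [← h1, SchwartzMap.fourierInv_coe, Real.fourierInv_eq']
  refine integral_congr_ae (Filter.Eventually.of_forall fun ξ => ?_)
  simp only [char2pi, fhat, smul_eq_mul]
  rw [mul_comm, real_inner_comm]
  congr 2
  push_cast
  ring

end Plancherel

end SingularBS

namespace SingularBS

variable {N : ℕ} {Ω : TopologicalSpace.Opens (EuclideanSpace ℝ (Fin N))}

/-! ### Operators on the completion, extended from test functions -/

section Extension

/-- The class of a test function in `H₀^l(Ω)`, as a linear map. -/
def toHSobₗ (l : ℝ) (Ω : TopologicalSpace.Opens (EuclideanSpace ℝ (Fin N))) :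
    𝓓(Ω, ℂ) →ₗ[ℂ] HSob l Ω where
  toFun := toHSob l
  map_add' u v := UniformSpace.Completion.coe_add (α := TestSpace l Ω) u v
  map_smul' c v := UniformSpace.Completion.coe_smul (X := TestSpace l Ω) c v

lemma denseRange_toHSob (l : ℝ) : DenseRange (toHSob l : 𝓓(Ω, ℂ) → HSob l Ω) :=
  UniformSpace.Completion.denseRange_coe (α := TestSpace l Ω)

lemma norm_toHSob_sq (l : ℝ) (v : 𝓓(Ω, ℂ)) : ‖toHSob l v‖ ^ 2 = (homInner l v v).re := by
  rw [← inner_toHSob, inner_self_eq_norm_sq_to_K]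
  norm_cast

lemma exists_extension {l : ℝ} {F : Type*} [NormedAddCommGroup F] [InnerProductSpace ℂ F]
    [CompleteSpace F] (φ : 𝓓(Ω, ℂ) →ₗ[ℂ] F) {C : ℝ} (hC : 0 ≤ C)
    (h : ∀ v, ‖φ v‖ ≤ C * ‖toHSob l v‖) :
    ∃ T : HSob l Ω →L[ℂ] F, (∀ v, T (toHSob l v) = φ v) ∧ ‖T‖ ≤ C :=
  ⟨φ.extendOfNorm (toHSobₗ l Ω), LinearMap.extendOfNorm_eq (denseRange_toHSob l) ⟨C, h⟩,
    LinearMap.opNorm_extendOfNorm_le (denseRange_toHSob l) hC h⟩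

lemma norm_le_of_forall_test {l : ℝ} {F : Type*} [NormedAddCommGroup F] [InnerProductSpace ℂ F]
    {T : HSob l Ω →L[ℂ] F} {C : ℝ} (hC : 0 ≤ C)
    (h : ∀ v : 𝓓(Ω, ℂ), ‖T (toHSob l v)‖ ≤ C * ‖toHSob l v‖) : ‖T‖ ≤ C :=
  T.opNorm_le_bound hC fun x => (denseRange_toHSob l).induction_on
    (p := fun x => ‖T x‖ ≤ C * ‖x‖) x (isClosed_le (by fun_prop) (by fun_prop)) h

/-- The heat lift as a bounded operator. -/
lemma exists_heatLift_op [Nontrivial (EuclideanSpace ℝ (Fin N))] {l : ℝ} (hl : 0 < l) :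
    ∃ c : ℝ, 0 < c ∧ ∀ Ω : TopologicalSpace.Opens (EuclideanSpace ℝ (Fin N)),
      ∃ J : HSob l Ω →L[ℂ] Lp ℂ 2 (heatMeasure N), ‖J‖ ^ 2 ≤ c ∧
        ∀ v : 𝓓(Ω, ℂ), (J (toHSob l v) =ᵐ[heatMeasure N] heatLift l (fhat v)) ∧
          ∫⁻ z, ‖heatLift l (fhat v) z‖ₑ ^ 2 ∂heatMeasure N ≤
            ENNReal.ofReal (c * ‖toHSob l v‖ ^ 2) := by
  obtain ⟨C, hC, hv⟩ := exists_lintegral_fhat_le (N := N) hl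
  refine ⟨Real.pi ^ l / Real.Gamma l * C, by positivity, fun Ω => ?_⟩
  set c := Real.pi ^ l / Real.Gamma l * C with hc
  have hc0 : 0 < c := by positivity
  have hfm : ∀ v : 𝓓(Ω, ℂ), Measurable (fhat v : EuclideanSpace ℝ (Fin N) → ℂ) :=
    fun v => (fhat v).continuous.measurable
  have hb : ∀ v : 𝓓(Ω, ℂ), ∫⁻ z, ‖heatLift l (fhat v) z‖ₑ ^ 2 ∂heatMeasure N ≤
      ENNReal.ofReal (c * ‖toHSob l v‖ ^ 2) := by
    intro v
    rw [lintegral_heatLift_sq hl (hfm v), hc, mul_assoc, ENNReal.ofReal_mul (by positivity),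
      norm_toHSob_sq]
    gcongr
    exact hv Ω v
  have hmem : ∀ v : 𝓓(Ω, ℂ), MemLp (heatLift l (fhat v)) 2 (heatMeasure N) := fun v =>
    (memLp_two_iff_lintegral (measurable_heatLift l (hfm v)).aestronglyMeasurable).2
      ((hb v).trans_lt ENNReal.ofReal_lt_top)
  let φ : 𝓓(Ω, ℂ) →ₗ[ℂ] Lp ℂ 2 (heatMeasure N) :=
    { toFun := fun v => (hmem v).toLp _
      map_add' := fun u v => by
        rw [← MemLp.toLp_add]
        refine MemLp.toLp_congr _ _ (Filter.Eventually.of_forall fun z => ?_)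
        have h1 : fhat (u + v) = fhat u + fhat v :=
          map_add (SchwartzMap.fourierTransformCLM ℂ) (toSchwartz u) (toSchwartz v)
        simp only [heatLift, h1, Pi.add_apply]
        rw [← mul_add]
        rfl
      map_smul' := fun k v => by
        rw [RingHom.id_apply, ← MemLp.toLp_const_smul]
        refine MemLp.toLp_congr _ _ (Filter.Eventually.of_forall fun z => ?_)
        have h1 : fhat (k • v) = k • fhat v :=
          map_smul (SchwartzMap.fourierTransformCLM ℂ) k (toSchwartz v)
        simp only [heatLift, h1, Pi.smul_apply, smul_eq_mul]
        rw [mul_left_comm]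
        rfl }
  obtain ⟨J, hJ, hJn⟩ := exists_extension (l := l) φ (Real.sqrt_nonneg c) (fun v => by
    refine (sq_le_sq₀ (norm_nonneg _) (by positivity)).1 ?_
    rw [mul_pow, Real.sq_sqrt hc0.le, ← ENNReal.ofReal_le_ofReal_iff (by positivity)]
    exact (ofReal_norm_toLp_sq (hmem v)).trans_le (hb v))
  refine ⟨J, ?_, fun v => ⟨?_, hb v⟩⟩
  · calc ‖J‖ ^ 2 ≤ √c ^ 2 := by gcongr
      _ = c := Real.sq_sqrt hc0.le
  · rw [hJ]
    exact (hmem v).coeFn_toLp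

end Extension

/-! ### Cwikel's decomposition of multiplication by a weight -/

section Weighted

lemma memLp_weight_mul {μ : Measure (EuclideanSpace ℝ (Fin N))}
    {f : EuclideanSpace ℝ (Fin N) → ℝ} (hf2 : MemLp (fun x => (f x : ℂ)) 2 μ) (v : 𝓓(Ω, ℂ)) :
    MemLp (fun x => (f x : ℂ) * v x) 2 μ := by
  have hc : Continuous (v : EuclideanSpace ℝ (Fin N) → ℂ) := v.contDiff'.continuous
  obtain ⟨B, hB⟩ := v.hasCompactSupport'.exists_bound_of_continuous hc
  refine hf2.of_le_mul (c := B) (hf2.1.mul hc.aestronglyMeasurable)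
    (Filter.Eventually.of_forall fun x => ?_)
  rw [norm_mul, mul_comm]
  gcongr
  exact hB x

/-- Multiplication of test functions by a weight, as a map into `L²(μ)`. -/
def weightMap (Ω : TopologicalSpace.Opens (EuclideanSpace ℝ (Fin N)))
    {μ : Measure (EuclideanSpace ℝ (Fin N))}
    {f : EuclideanSpace ℝ (Fin N) → ℝ} (hf2 : MemLp (fun x => (f x : ℂ)) 2 μ) :
    𝓓(Ω, ℂ) →ₗ[ℂ] Lp ℂ 2 μ where
  toFun v := (memLp_weight_mul hf2 v).toLp _
  map_add' u v := by
    rw [← MemLp.toLp_add]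
    refine MemLp.toLp_congr _ _ (Filter.Eventually.of_forall fun x => ?_)
    simp only [add_apply, Pi.add_apply]
    ring
  map_smul' k v := by
    rw [RingHom.id_apply, ← MemLp.toLp_const_smul]
    refine MemLp.toLp_congr _ _ (Filter.Eventually.of_forall fun x => ?_)
    simp only [smul_apply, Pi.smul_apply, smul_eq_mul]
    ring

/-- Multiplication by a weight is, up to a small operator, Hilbert--Schmidt on `H₀^l(Ω)`. -/
lemma exists_hsBound_near_weightMap {l s : ℝ} (hl : 0 < l) (hlN : 2 * l < N)
    (hs : (N : ℝ) - 2 * l < s) :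
    ∃ C : ℝ, 0 < C ∧ ∀ (Ω : TopologicalSpace.Opens (EuclideanSpace ℝ (Fin N)))
      (μ : Measure (EuclideanSpace ℝ (Fin N))) [IsFiniteMeasure μ] (A θ : ℝ), 0 < A →
      θ = s / (s + 2 * l - N) →
      (∀ᵐ x ∂μ, ∀ r : ℝ, 0 < r → μ (Metric.ball x r) ≤ ENNReal.ofReal (A * r ^ s)) →
      ∀ (f : EuclideanSpace ℝ (Fin N) → ℝ), Measurable f → (∀ x, 0 ≤ f x) →
      Integrable (fun x => f x ^ (2 * θ)) μ →
      ∀ (hf2 : MemLp (fun x => (f x : ℂ)) 2 μ) (b : ℝ), 0 < b →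
      ∃ H : HSob l Ω →L[ℂ] Lp ℂ 2 μ,
        HSBound H (C * A ^ (θ - 1) * (∫ x, f x ^ (2 * θ) ∂μ) * (b ^ 2) ^ (-(θ - 1))) ∧
        ∀ v : 𝓓(Ω, ℂ), ‖weightMap Ω hf2 v - H (toHSob l v)‖ ≤ b * ‖toHSob l v‖ := by
  have hN : 0 < N := by
    have : (0 : ℝ) < N := by linarith
    exact_mod_cast this
  have hnt : Nontrivial (EuclideanSpace ℝ (Fin N)) :=
    Module.nontrivial_of_finrank_pos (R := ℝ) (by rwa [finrank_euclideanSpace_fin])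
  obtain ⟨cJ, hcJ, hJex⟩ := exists_heatLift_op (N := N) hl
  set γ := s + 2 * l - N with hγs
  have hγ : 0 < γ := by linarith
  set a := (N : ℝ) / 2 - l with ha
  have ha0 : 0 < a := by linarith
  have hg := gaussConst_nonneg s
  -- The added 1 makes the constant strictly positive.
  set cB := 4 * gaussConst s / γ + 1 with hcB
  have hcB0 : 0 < cB := by positivity
  refine ⟨cJ * a⁻¹ * (cB * cJ) ^ (s / γ - 1), by positivity, ?_⟩
  intro Ω μ _ A θ hA hθ hμ f hf hf0 hfi hf2 b hb
  -- Since θ - 1 = (N - 2l)/γ = 2a/γ, the weight enters the Hilbert–Schmidt bound with the exponent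
  -- 2θ.
  have hexp : 4 * a / γ = 2 * (θ - 1) := by
    rw [hθ, ha]
    field_simp
    rw [hγs]
    ring
  have hexp2 : 2 + 4 * a / γ = 2 * θ := by rw [hexp]; ring
  obtain ⟨J, hJn, hJ⟩ := hJex Ω
  set D := cB * A * cJ with hD
  have hD0 : 0 < D := by positivity
  -- Chosen so that the squared bound cB A τ² cJ of the near part is b².
  set τ := b / √D with hτdef
  have hτ : 0 < τ := by positivity
  have hτ2 : τ ^ 2 = b ^ 2 / D := by rw [hτdef, div_pow, Real.sq_sqrt hD0.le]
  set K := farKernel l τ γ f with hKdef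
  have hKm : Measurable K := measurable_farKernel l τ γ hf
  have hKle := lintegral_lintegral_farKernel_sq_le (μ := μ) (l := l) (γ := γ) hτ ha0
    (by rw [ha]; ring) hf hf0 (by rw [hexp2]; exact hfi)
  have hK2 := hKle.trans_lt ENNReal.ofReal_lt_top
  have hint0 : 0 ≤ ∫ x, f x ^ (2 + 4 * a / γ) ∂μ :=
    integral_nonneg fun x => Real.rpow_nonneg (hf0 x) _
  refine ⟨kernelOp μ (heatMeasure N) K hKm hK2 ∘L J, ?_, fun v => ?_⟩
  · have h1 := hsBound_kernelOp_comp K hKm hK2 J hJn (by positivity) hKle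
    have hval : cJ * (a⁻¹ * τ ^ (-(4 * a / γ)) * ∫ x, f x ^ (2 + 4 * a / γ) ∂μ) =
        cJ * a⁻¹ * (cB * cJ) ^ (s / γ - 1) * A ^ (θ - 1) * (∫ x, f x ^ (2 * θ) ∂μ) *
          (b ^ 2) ^ (-(θ - 1)) := by
      have h2 : τ ^ (-(4 * a / γ)) = (cB * cJ) ^ (θ - 1) * A ^ (θ - 1) * (b ^ 2) ^ (-(θ - 1)) := by
        rw [hexp, show -(2 * (θ - 1)) = ((2 : ℕ) : ℝ) * (-(θ - 1)) by push_cast; ring,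
          Real.rpow_mul hτ.le, Real.rpow_natCast, hτ2, Real.div_rpow (by positivity) hD0.le,
          Real.rpow_neg hD0.le, div_inv_eq_mul, hD, ← Real.mul_rpow (by positivity) hA.le]
        rw [show cB * A * cJ = cB * cJ * A by ring]
        ring
      rw [h2, hexp2, ← hθ]
      ring
    rw [hval] at h1
    exact h1
  · have hfm : Measurable (fhat v : EuclideanSpace ℝ (Fin N) → ℂ) := (fhat v).continuous.measurable
    have hHv : (fun x => ∫ z, K (x, z) * J (toHSob l v) z ∂heatMeasure N) =
        fun x => ∫ z, K (x, z) * heatLift l (fhat v) z ∂heatMeasure N := by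
      funext x
      refine integral_congr_ae ?_
      filter_upwards [(hJ v).1] with z hz
      rw [hz]
    have hnear : (fun x => (f x : ℂ) * v x) -
        (fun x => ∫ z, K (x, z) * J (toHSob l v) z ∂heatMeasure N) =
        fun x => ∫ z, nearKernel l τ γ f (x, z) * heatLift l (fhat v) z ∂heatMeasure N := by
      rw [hHv]
      funext x
      rw [← integral_nearKernel_eq hl hf hfm (fhat v).integrable x, integral_fhat_mul_char2pi]
      rfl
    -- The finiteness needed for the near bound: the near part is f·v minus its far image, both in
    -- L²(μ).
    have hmem : MemLp (fun x => ∫ z, nearKernel l τ γ f (x, z) * heatLift l (fhat v) z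
        ∂heatMeasure N) 2 μ := by
      rw [← hnear]
      exact (memLp_weight_mul hf2 v).sub (memLp_kernel hKm hK2 _)
    have heq : weightMap Ω hf2 v - (kernelOp μ (heatMeasure N) K hKm hK2 ∘L J) (toHSob l v) =
        hmem.toLp _ := by
      rw [ContinuousLinearMap.comp_apply, kernelOp_apply]
      change (memLp_weight_mul hf2 v).toLp _ - _ = _
      rw [← MemLp.toLp_sub]
      exact MemLp.toLp_congr _ _ (Filter.Eventually.of_forall fun x => congrFun hnear x)
    rw [heq]
    refine (sq_le_sq₀ (norm_nonneg _) (by positivity)).1 ?_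
    rw [← ENNReal.ofReal_le_ofReal_iff (by positivity), ofReal_norm_toLp_sq]
    refine (lintegral_nearKernel_le hl hA.le hγ hγs hμ hf hf2 hfm (fhat v).integrable
      ((memLp_two_iff_lintegral hmem.1).1 hmem)).trans ?_
    calc _ ≤ ENNReal.ofReal (cB * A * τ ^ 2) * ENNReal.ofReal (cJ * ‖toHSob l v‖ ^ 2) := by
          refine mul_le_mul' (ENNReal.ofReal_le_ofReal ?_) (hJ v).2
          have : 4 * gaussConst s / γ ≤ cB := by rw [hcB]; linarith
          gcongr
      _ = _ := by
          rw [← ENNReal.ofReal_mul (by positivity), hτ2]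
          congr 1
          rw [hD]
          field_simp

/-- The square root of a weight as an operator from `H₀^l(Ω)` to `L²(μ)`, with Cwikel's
decomposition. -/
lemma exists_sqrt_weight_op {l s : ℝ} (hl : 0 < l) (hlN : 2 * l < N)
    (hs : (N : ℝ) - 2 * l < s) :
    ∃ C : ℝ, 0 < C ∧ ∀ (Ω : TopologicalSpace.Opens (EuclideanSpace ℝ (Fin N)))
      (μ : Measure (EuclideanSpace ℝ (Fin N))) [IsFiniteMeasure μ] (A θ : ℝ), 0 < A →
      θ = s / (s + 2 * l - N) →
      (∀ᵐ x ∂μ, ∀ r : ℝ, 0 < r → μ (Metric.ball x r) ≤ ENNReal.ofReal (A * r ^ s)) →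
      ∀ (W : EuclideanSpace ℝ (Fin N) → ℝ), (∀ x, 0 ≤ W x) → MemLp W (ENNReal.ofReal θ) μ →
      ∃ T : HSob l Ω →L[ℂ] Lp ℂ 2 μ,
        (∀ v : 𝓓(Ω, ℂ), T (toHSob l v) =ᵐ[μ] fun x => ((√(W x) : ℝ) : ℂ) * v x) ∧
        ∀ b : ℝ, 0 < b → ∃ H : HSob l Ω →L[ℂ] Lp ℂ 2 μ,
          HSBound H (C * A ^ (θ - 1) * (∫ x, W x ^ θ ∂μ) * (b ^ 2) ^ (-(θ - 1))) ∧
          ‖T - H‖ ≤ b := by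
  obtain ⟨C, hC, hex⟩ := exists_hsBound_near_weightMap hl hlN hs
  refine ⟨C, hC, ?_⟩
  intro Ω μ _ A θ hA hθ hμ W hW0 hW
  have hγ : 0 < s + 2 * l - N := by linarith
  have hθ1 : 1 < θ := by
    rw [hθ, lt_div_iff₀ hγ]
    linarith
  -- The cut kernels require a measurable weight, so W is replaced by a measurable representative.
  -- The square root makes f nonnegative everywhere, even where W' is negative.
  set W' := hW.1.mk W with hW'
  have hWm : Measurable W' := hW.1.stronglyMeasurable_mk.measurable
  have hae : W =ᵐ[μ] W' := hW.1.ae_eq_mk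
  set f : EuclideanSpace ℝ (Fin N) → ℝ := fun x => √(W' x) with hf
  have hfm : Measurable f := hWm.sqrt
  have hpow : (fun x => W x ^ θ) =ᵐ[μ] fun x => f x ^ (2 * θ) := by
    filter_upwards [hae] with x hx
    simp only [hf]
    rw [← hx, Real.rpow_mul (Real.sqrt_nonneg _), Real.rpow_two, Real.sq_sqrt (hW0 x)]
  have hWi : Integrable (fun x => W x ^ θ) μ := by
    have := hW.integrable_norm_rpow (by simpa using by linarith) ENNReal.ofReal_ne_top
    rw [ENNReal.toReal_ofReal (by linarith)] at this
    refine this.congr (Filter.Eventually.of_forall fun x => ?_)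
    simp only
    rw [Real.norm_of_nonneg (hW0 x)]
  have hW1 : Integrable W μ := hW.integrable (by simpa using hθ1.le)
  have hf2 : MemLp (fun x => (f x : ℂ)) 2 μ := by
    have hm : Measurable fun x => (f x : ℂ) := Complex.measurable_ofReal.comp hfm
    rw [memLp_two_iff_integrable_sq_norm hm.aestronglyMeasurable]
    refine hW1.congr ?_
    filter_upwards [hae] with x hx
    simp only [hf]
    rw [Complex.norm_real, Real.norm_of_nonneg (Real.sqrt_nonneg _), ← hx, Real.sq_sqrt (hW0 x)]
  have hfi := hWi.congr hpow
  have key := hex Ω μ A θ hA hθ hμ f hfm (fun x => Real.sqrt_nonneg _) hfi hf2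
  -- Boundedness of the multiplication itself follows from the decomposition at b = 1.
  obtain ⟨H₁, -, hH₁⟩ := key 1 one_pos
  obtain ⟨T, hT, -⟩ := exists_extension (l := l) (weightMap Ω hf2)
    (C := 1 + ‖H₁‖) (by positivity) (fun v => by
      calc ‖weightMap Ω hf2 v‖ = ‖(weightMap Ω hf2 v - H₁ (toHSob l v)) + H₁ (toHSob l v)‖ := by
            rw [sub_add_cancel]
        _ ≤ 1 * ‖toHSob l v‖ + ‖H₁‖ * ‖toHSob l v‖ :=
            (norm_add_le _ _).trans (add_le_add (hH₁ v) (H₁.le_opNorm _))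
        _ = _ := by ring)
  refine ⟨T, fun v => ?_, fun b hb => ?_⟩
  · rw [hT]
    refine (memLp_weight_mul hf2 v).coeFn_toLp.trans ?_
    filter_upwards [hae] with x hx
    simp only [hf]
    rw [hx]
  · obtain ⟨H, hH, hHb⟩ := key b hb
    rw [← integral_congr_ae hpow] at hH
    refine ⟨H, hH, norm_le_of_forall_test hb.le fun v => ?_⟩
    rw [sub_apply, hT]
    exact hHb v

end Weighted

end SingularBS

namespace SingularBS

variable {N : ℕ} {Ω : TopologicalSpace.Opens (EuclideanSpace ℝ (Fin N))}

/-! ### The operator of the form and the spectral estimates -/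

section Final

/-- A nonzero μ has a support point, and a ball about it contains the bounded set Ω, which carries
all the mass. -/
lemma isFiniteMeasure_of_ball_bound {μ : Measure (EuclideanSpace ℝ (Fin N))} {A s : ℝ}
    (hΩ : Bornology.IsBounded (Ω : Set (EuclideanSpace ℝ (Fin N))))
    (hμΩ : μ (Ω : Set (EuclideanSpace ℝ (Fin N)))ᶜ = 0)
    (h : ∀ X ∈ μ.support, ∀ r : ℝ, 0 < r → μ (Metric.ball X r) ≤ ENNReal.ofReal (A * r ^ s)) :
    IsFiniteMeasure μ := by
  rcases μ.support.eq_empty_or_nonempty with h0 | ⟨X, hX⟩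
  · rw [Measure.support_eq_empty_iff.1 h0]
    infer_instance
  obtain ⟨r, hr⟩ := hΩ.subset_ball X
  have hr' : (Ω : Set (EuclideanSpace ℝ (Fin N))) ⊆ Metric.ball X (max r 1) :=
    hr.trans (Metric.ball_subset_ball (le_max_left _ _))
  refine ⟨?_⟩
  calc μ univ ≤ μ (Ω : Set (EuclideanSpace ℝ (Fin N))) +
        μ (Ω : Set (EuclideanSpace ℝ (Fin N)))ᶜ := by
        rw [← union_compl_self (Ω : Set (EuclideanSpace ℝ (Fin N)))]
        exact measure_union_le _ _
    _ ≤ μ (Metric.ball X (max r 1)) := by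
        rw [hμΩ, add_zero]
        exact measure_mono hr'
    _ ≤ _ := h X hX _ (lt_max_of_lt_right one_pos)
    _ < ∞ := ENNReal.ofReal_lt_top

/-- The two quadratic forms agree on a dense set, hence everywhere by continuity; over ℂ,
polarization recovers the operator. -/
lemma isOperatorOfForm_unique {l : ℝ} {μ : Measure (EuclideanSpace ℝ (Fin N))}
    {V : EuclideanSpace ℝ (Fin N) → ℂ} {S S' : HSob l Ω →L[ℂ] HSob l Ω}
    (hS : IsOperatorOfForm l Ω μ V S) (hS' : IsOperatorOfForm l Ω μ V S') : S' = S := by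
  have h : ∀ x, inner ℂ x (S' x) = inner ℂ x (S x) := fun x =>
    (denseRange_toHSob l).induction_on (p := fun x => inner ℂ x (S' x) = inner ℂ x (S x)) x
      (isClosed_eq (by fun_prop) (by fun_prop)) fun v => ((hS' v).2.trans (hS v).2.symm)
  refine ContinuousLinearMap.coe_injective ((ext_inner_map _ _).1 fun x => ?_)
  rw [← inner_conj_symm, ← inner_conj_symm (S.toLinearMap x)]
  exact congrArg _ (h x)

lemma isSymmetric_of_form {l : ℝ} {μ : Measure (EuclideanSpace ℝ (Fin N))}
    {V : EuclideanSpace ℝ (Fin N) → ℝ} {S : HSob l Ω →L[ℂ] HSob l Ω}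
    (hS : IsOperatorOfForm l Ω μ (fun x => (V x : ℂ)) S) :
    (S : HSob l Ω →ₗ[ℂ] HSob l Ω).IsSymmetric := by
  rw [LinearMap.isSymmetric_iff_inner_map_self_real]
  intro x
  refine (denseRange_toHSob l).induction_on
    (p := fun x => (starRingEnd ℂ) (inner ℂ (S x) x) = inner ℂ (S x) x) x
      (isClosed_eq (by fun_prop) (by fun_prop)) fun v => ?_
  have h1 : inner ℂ (toHSob l v) (S (toHSob l v)) = ((∫ x, V x * ‖v x‖ ^ 2 ∂μ : ℝ) : ℂ) := by
    rw [(hS v).2, ← integral_complex_ofReal]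
    simp
  rw [← inner_conj_symm (S _), h1]
  simp

/-- Multiplication by a measurable phase on `L²(μ)`. -/
lemma exists_phase_op {μ : Measure (EuclideanSpace ℝ (Fin N))}
    {σ : EuclideanSpace ℝ (Fin N) → ℂ} (hσ : AEStronglyMeasurable σ μ) (hσ1 : ∀ x, ‖σ x‖ ≤ 1) :
    ∃ U : Lp ℂ 2 μ →L[ℂ] Lp ℂ 2 μ, ‖U‖ ≤ 1 ∧ ∀ h, U h =ᵐ[μ] fun x => σ x * h x := by
  have hle : ∀ (h : Lp ℂ 2 μ) x, ‖σ x * h x‖ ≤ ‖h x‖ := fun h x => by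
    rw [norm_mul]
    exact mul_le_of_le_one_left (norm_nonneg _) (hσ1 x)
  have hm : ∀ h : Lp ℂ 2 μ, MemLp (fun x => σ x * h x) 2 μ := fun h =>
    (Lp.memLp h).of_le (hσ.mul (Lp.aestronglyMeasurable h)) (Filter.Eventually.of_forall (hle h))
  let U₀ : Lp ℂ 2 μ →ₗ[ℂ] Lp ℂ 2 μ :=
    { toFun := fun h => (hm h).toLp _
      map_add' := fun g h => by
        rw [← MemLp.toLp_add]
        refine MemLp.toLp_congr _ _ ?_
        filter_upwards [Lp.coeFn_add g h] with x hx
        simp only [Pi.add_apply]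
        rw [hx, Pi.add_apply, mul_add]
      map_smul' := fun c h => by
        rw [RingHom.id_apply, ← MemLp.toLp_const_smul]
        refine MemLp.toLp_congr _ _ ?_
        filter_upwards [Lp.coeFn_smul c h] with x hx
        simp only [Pi.smul_apply, smul_eq_mul]
        rw [hx, Pi.smul_apply, smul_eq_mul]
        ring }
  refine ⟨U₀.mkContinuous 1 fun h => ?_, LinearMap.mkContinuous_norm_le _ zero_le_one _,
    fun h => (hm h).coeFn_toLp⟩
  rw [one_mul]
  refine Lp.norm_le_norm_of_ae_le ?_
  filter_upwards [(hm h).coeFn_toLp] with x hx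
  change ‖((hm h).toLp _ : Lp ℂ 2 μ) x‖ ≤ _
  rw [hx]
  exact hle h x

lemma integrable_mul_norm_sq {μ : Measure (EuclideanSpace ℝ (Fin N))}
    {V : EuclideanSpace ℝ (Fin N) → ℂ} (hV : Integrable V μ) (v : 𝓓(Ω, ℂ)) :
    Integrable (fun x => V x * ((‖v x‖ ^ 2 : ℝ) : ℂ)) μ := by
  have hc : Continuous (v : EuclideanSpace ℝ (Fin N) → ℂ) := v.contDiff'.continuous
  obtain ⟨B, hB⟩ := v.hasCompactSupport'.exists_bound_of_continuous hc
  refine hV.mul_bdd (c := B ^ 2) (by fun_prop) (Filter.Eventually.of_forall fun x => ?_)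
  rw [Complex.norm_real, Real.norm_of_nonneg (sq_nonneg _)]
  exact pow_le_pow_left₀ (norm_nonneg _) (hB x) 2

/-- With b² = λ/4, the factors 4 and 4^(θ-1) combine: this is the origin of 4^θ in the final
constant. -/
lemma bound_eq {C A I lam θ b : ℝ} (hlam : 0 < lam) (hb : b ^ 2 = lam / 4) :
    4 * (C * A ^ (θ - 1) * I * (b ^ 2) ^ (-(θ - 1))) / lam =
      4 ^ θ * C * A ^ (θ - 1) * I * lam ^ (-θ) := by
  rw [hb, Real.div_rpow hlam.le (by norm_num), show -θ = -(θ - 1) - 1 by ring,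
    Real.rpow_sub_one hlam.ne', Real.rpow_neg (by norm_num : (0 : ℝ) ≤ 4),
    Real.rpow_sub_one (by norm_num : (4 : ℝ) ≠ 0)]
  field_simp

/-- The complex case constructs S from the weight |V|. The one-sided counts use another T, with
weight max(εV, 0), and only a form inequality, so they hold for every S with the given form; thus a
single S serves both signs ε = ±1. -/
theorem exists_spectral_bound {l s : ℝ} (hl : 0 < l) (hlN : 2 * l < N)
    (hs : (N : ℝ) - 2 * l < s) :
    ∃ C : ℝ, 0 < C ∧ ∀ (Ω : TopologicalSpace.Opens (EuclideanSpace ℝ (Fin N)))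
      (μ : Measure (EuclideanSpace ℝ (Fin N))) [IsFiniteMeasure μ] (A θ : ℝ), 0 < A →
      θ = s / (s + 2 * l - N) →
      (∀ᵐ x ∂μ, ∀ r : ℝ, 0 < r → μ (Metric.ball x r) ≤ ENNReal.ofReal (A * r ^ s)) →
      (∀ V : EuclideanSpace ℝ (Fin N) → ℂ, MemLp V (ENNReal.ofReal θ) μ →
        ∃ S : HSob l Ω →L[ℂ] HSob l Ω, IsOperatorOfForm l Ω μ V S ∧ IsCompactOperator S ∧
          ∀ lam : ℝ, 0 < lam → nSing lam S ≤
            ENNReal.ofReal (C * A ^ (θ - 1) * (∫ x, ‖V x‖ ^ θ ∂μ) * lam ^ (-θ))) ∧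
      (∀ V : EuclideanSpace ℝ (Fin N) → ℝ, MemLp V (ENNReal.ofReal θ) μ →
        ∀ S : HSob l Ω →L[ℂ] HSob l Ω, IsOperatorOfForm l Ω μ (fun x => (V x : ℂ)) S →
        ∀ ε lam : ℝ, 0 < lam → eigCount S {κ | lam < ε * κ} ≤
            ENNReal.ofReal (C * A ^ (θ - 1) * (∫ x, max (ε * V x) 0 ^ θ ∂μ) * lam ^ (-θ))) := by
  obtain ⟨C, hC, hex⟩ := exists_sqrt_weight_op hl hlN hs
  refine ⟨4 ^ (s / (s + 2 * l - N)) * C, by positivity, ?_⟩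
  intro Ω μ _ A θ hA hθ hμ
  rw [← hθ]
  have hθ1 : 1 < θ := by
    have hγ : 0 < s + 2 * l - N := by linarith
    rw [hθ, lt_div_iff₀ hγ]
    linarith
  have hθE : (1 : ℝ≥0∞) ≤ ENNReal.ofReal θ := by simpa using hθ1.le
  refine ⟨fun V hV => ?_, fun V hV S hS ε lam hlam => ?_⟩
  · obtain ⟨T, hT, hTH⟩ := hex Ω μ A θ hA hθ hμ (fun x => ‖V x‖) (fun x => norm_nonneg _) hV.norm
    -- The phase of V; it is 0 where V vanishes, so V = σ|V| holds everywhere.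
    set σ : EuclideanSpace ℝ (Fin N) → ℂ := fun x => ((‖V x‖⁻¹ : ℝ) : ℂ) * V x with hσ
    have hσm : AEStronglyMeasurable σ μ := by
      have h1 : AEMeasurable V μ := hV.1.aemeasurable
      exact AEMeasurable.aestronglyMeasurable
        ((Complex.measurable_ofReal.comp_aemeasurable h1.norm.inv).mul h1)
    have hσ1 : ∀ x, ‖σ x‖ ≤ 1 := fun x => by
      simp only [hσ]
      rw [norm_mul, Complex.norm_real, norm_inv, norm_norm]
      exact inv_mul_le_one
    have hσV : ∀ x, σ x * ((‖V x‖ : ℝ) : ℂ) = V x := fun x => by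
      simp only [hσ]
      rcases eq_or_ne (V x) 0 with h0 | h0
      · simp [h0]
      · have : ((‖V x‖ : ℝ) : ℂ) ≠ 0 := by exact_mod_cast (norm_ne_zero_iff.2 h0)
        push_cast
        field_simp
    obtain ⟨U, hU1, hU⟩ := exists_phase_op hσm hσ1
    refine ⟨ContinuousLinearMap.adjoint T ∘L U ∘L T, fun v => ⟨integrable_mul_norm_sq
      (hV.integrable hθE) v, ?_⟩, ?_, fun lam hlam => ?_⟩
    · rw [ContinuousLinearMap.comp_apply, ContinuousLinearMap.adjoint_inner_right,
        ContinuousLinearMap.comp_apply, L2.inner_def]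
      refine integral_congr_ae ?_
      filter_upwards [hT v, hU (T (toHSob l v))] with x hx hx'
      rw [hx', hx, RCLike.inner_apply, map_mul, Complex.conj_ofReal]
      have h1 : ((√‖V x‖ : ℝ) : ℂ) * ((√‖V x‖ : ℝ) : ℂ) = ((‖V x‖ : ℝ) : ℂ) := by
        rw [← Complex.ofReal_mul, Real.mul_self_sqrt (norm_nonneg _)]
      have h2 : v x * (starRingEnd ℂ) (v x) = ((‖v x‖ ^ 2 : ℝ) : ℂ) := by
        rw [Complex.mul_conj, Complex.normSq_eq_norm_sq]
      calc _ = σ x * (((√‖V x‖ : ℝ) : ℂ) * ((√‖V x‖ : ℝ) : ℂ)) *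
            (v x * (starRingEnd ℂ) (v x)) := by ring
        _ = _ := by rw [h1, h2, hσV]
    · refine IsCompactOperator.clm_comp (f := U ∘L T) ?_ (ContinuousLinearMap.adjoint T)
      refine IsCompactOperator.clm_comp ?_ U
      refine isCompactOperator_of_forall_hsBound fun b hb => ?_
      obtain ⟨H, hH, hb'⟩ := hTH b hb
      exact ⟨H, _, hH, hb'⟩
    · have hb2 : √(lam / 4) ^ 2 = lam / 4 := Real.sq_sqrt (by positivity)
      obtain ⟨H, hH, hb'⟩ := hTH (√(lam / 4)) (by positivity)
      rw [← bound_eq hlam hb2]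
      exact nSing_le hlam hb' hb2 hH hU1
  · have hεV : MemLp (fun x => ε * V x) (ENNReal.ofReal θ) μ := hV.const_mul ε
    have hWm : MemLp (fun x => max (ε * V x) 0) (ENNReal.ofReal θ) μ := hεV.pos_part
    obtain ⟨T, hT, hTH⟩ := hex Ω μ A θ hA hθ hμ (fun x => max (ε * V x) 0)
      (fun x => le_max_right _ _) hWm
    have hb2 : √(lam / 4) ^ 2 = lam / 4 := Real.sq_sqrt (by positivity)
    obtain ⟨H, hH, hb'⟩ := hTH (√(lam / 4)) (by positivity)
    rw [← bound_eq hlam hb2]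
    -- The form inequality passes from test functions to H₀^l(Ω) by density. On test functions it is
    -- the pointwise bound εV ≤ max(εV, 0).
    refine eigCount_le_of_form_le (isSymmetric_of_form hS) hlam hb' hb2 hH fun x => ?_
    refine (denseRange_toHSob l).induction_on
      (p := fun x => ε * (inner ℂ x (S x)).re ≤ ‖T x‖ ^ 2) x
      (isClosed_le (continuous_const.mul (Complex.continuous_re.comp (by fun_prop)))
        (by fun_prop)) fun v => ?_
    have hint : ∀ W : EuclideanSpace ℝ (Fin N) → ℝ, MemLp W (ENNReal.ofReal θ) μ →
        Integrable (fun x => W x * ‖v x‖ ^ 2) μ := fun W hW => by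
      have := (integrable_mul_norm_sq (hW.integrable hθE).ofReal v).re
      simpa [← Complex.ofReal_mul, ← Complex.ofReal_pow] using this
    have h1 : (inner ℂ (toHSob l v) (S (toHSob l v))).re = ∫ x, V x * ‖v x‖ ^ 2 ∂μ := by
      rw [(hS v).2, ← Complex.ofReal_re (∫ x, V x * ‖v x‖ ^ 2 ∂μ), ← integral_complex_ofReal]
      simp
    have h2 : ‖T (toHSob l v)‖ ^ 2 = ∫ x, max (ε * V x) 0 * ‖v x‖ ^ 2 ∂μ := by
      rw [← Complex.ofReal_re (‖T (toHSob l v)‖ ^ 2),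
        ← Complex.ofReal_re (∫ x, max (ε * V x) 0 * ‖v x‖ ^ 2 ∂μ), ← integral_complex_ofReal]
      congr 1
      have h3 := inner_self_eq_norm_sq_to_K (𝕜 := ℂ) (T (toHSob l v))
      push_cast at h3 ⊢
      refine h3.symm.trans ?_
      rw [L2.inner_def]
      refine integral_congr_ae ?_
      filter_upwards [hT v] with x hx
      rw [hx, inner_self_eq_norm_sq_to_K, norm_mul, Complex.norm_real,
        Real.norm_of_nonneg (Real.sqrt_nonneg _)]
      norm_cast
      rw [mul_pow, Real.sq_sqrt (le_max_right _ _)]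
      rfl
    rw [h1, h2, ← integral_const_mul]
    refine integral_mono ((hint V hV).const_mul ε) (hint _ hWm) fun x => ?_
    simp only
    rw [← mul_assoc]
    gcongr
    exact le_max_left _ _

end Final

end SingularBS

theorem theorem3p3 (N : ℕ) (l s : ℝ) (hl : 0 < l) (hlN : 2 * l < N) (hs : (N : ℝ) - 2 * l < s) :
    ∃ C : ℝ, 0 < C ∧
      ∀ (Ω : TopologicalSpace.Opens (EuclideanSpace ℝ (Fin N)))
        (μ : Measure (EuclideanSpace ℝ (Fin N))) (A θ : ℝ),
        Bornology.IsBounded (Ω : Set (EuclideanSpace ℝ (Fin N))) →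
        μ (Ω : Set (EuclideanSpace ℝ (Fin N)))ᶜ = 0 →
        0 < A →
        (∀ X ∈ μ.support, ∀ r : ℝ, 0 < r → μ (Metric.ball X r) ≤ ENNReal.ofReal (A * r ^ s)) →
        θ = s / (s + 2 * l - N) →
        (∀ V : EuclideanSpace ℝ (Fin N) → ℝ, MemLp V (ENNReal.ofReal θ) μ →
          ∃ S : SingularBS.HSob l Ω →L[ℂ] SingularBS.HSob l Ω,
            SingularBS.IsOperatorOfForm l Ω μ (fun x => (V x : ℂ)) S ∧
            (∀ S', SingularBS.IsOperatorOfForm l Ω μ (fun x => (V x : ℂ)) S' → S' = S) ∧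
            IsSelfAdjoint S ∧ IsCompactOperator S ∧
            ∀ lam : ℝ, 0 < lam →
              SingularBS.nPlus lam S ≤
                ENNReal.ofReal (C * A ^ (θ - 1) * (∫ x, max (V x) 0 ^ θ ∂μ) * lam ^ (-θ)) ∧
              SingularBS.nMinus lam S ≤
                ENNReal.ofReal (C * A ^ (θ - 1) * (∫ x, max (-V x) 0 ^ θ ∂μ) * lam ^ (-θ))) ∧
        (∀ V : EuclideanSpace ℝ (Fin N) → ℂ, MemLp V (ENNReal.ofReal θ) μ →
          ∃ S : SingularBS.HSob l Ω →L[ℂ] SingularBS.HSob l Ω,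
            SingularBS.IsOperatorOfForm l Ω μ V S ∧
            (∀ S', SingularBS.IsOperatorOfForm l Ω μ V S' → S' = S) ∧
            IsCompactOperator S ∧
            ∀ lam : ℝ, 0 < lam →
              SingularBS.nSing lam S ≤
                ENNReal.ofReal (C * A ^ (θ - 1) * (∫ x, ‖V x‖ ^ θ ∂μ) * lam ^ (-θ))) := by
  obtain ⟨C, hC, hex⟩ := SingularBS.exists_spectral_bound (N := N) hl hlN hs
  refine ⟨C, hC, fun Ω μ A θ hΩ hμΩ hA hball hθ => ?_⟩
  have := SingularBS.isFiniteMeasure_of_ball_bound hΩ hμΩ hball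
  -- The growth condition is assumed on the support only, and the support has full measure.
  have hae : ∀ᵐ x ∂μ, ∀ r : ℝ, 0 < r → μ (Metric.ball x r) ≤ ENNReal.ofReal (A * r ^ s) := by
    filter_upwards [Measure.support_mem_ae (μ := μ)] with x hx
    exact hball x hx
  obtain ⟨hcomplex, hreal⟩ := hex Ω μ A θ hA hθ hae
  refine ⟨fun V hV => ?_, fun V hV => ?_⟩
  · obtain ⟨S, hS, hcomp, -⟩ := hcomplex (fun x => (V x : ℂ)) hV.ofReal
    refine ⟨S, hS, fun S' hS' => SingularBS.isOperatorOfForm_unique hS hS',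
      ContinuousLinearMap.isSelfAdjoint_iff_isSymmetric.2 (SingularBS.isSymmetric_of_form hS),
      hcomp, fun lam hlam => ⟨?_, ?_⟩⟩
    · simpa [SingularBS.nPlus] using hreal V hV S hS 1 lam hlam
    · simpa [SingularBS.nMinus] using hreal V hV S hS (-1) lam hlam
  · obtain ⟨S, hS, hcomp, hn⟩ := hcomplex V hV
    exact ⟨S, hS, fun S' hS' => SingularBS.isOperatorOfForm_unique hS hS', hcomp, hn⟩

end
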